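/- **Setting.** Let $u_0<u_1$, $v_0<v_1$, let $\mathcal R=[u_0,u_1]\times[v_0,v_1]$, $C_0=\{u_0\}\times[v_0,v_1]$ and $\underline C_0=[u_0,u_1]\times\{v_0\}$. The spherically symmetric Einstein–scalar field system for functions $r>0$, $\Omega^2>0$, $\phi$ of $(u,v)$, associated with the metric $g=-\Omega^2\,du\,dv+r^2(d\theta^2+\sin^2\theta\,d\varphi^2)$, is $$\partial_u(-\Omega^{-2}\partial_u r)=\Omega^{-2}r(\partial_u\phi)^2,\qquad \partial_v(-\Omega^{-2}\partial_v r)=\Omega^{-2}r(\partial_v\phi)^2,$$ $$\partial_u\partial_v r=-\frac{\Omega^2}{4r}-\frac{\partial_u r\,\partial_v r}{r},\qquad \partial_u\partial_v\log\Omega^2=\frac{\Omega^2}{2r^2}+\frac{2\,\partial_u r\,\partial_v r}{r^2}-2\,\partial_u\phi\,\partial_v\phi,$$ $$\partial_u\partial_v\phi=-\frac{\partial_u r\,\partial_v\phi}{r}-\frac{\partial_v r\,\partial_u\phi}{r}.$$ A *future development* (of trapped characteristic data on $C_0\cup\underline C_0$) is a $C^2$ solution $(r,\Omega^2,\phi)$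 of this system on a relatively open set $\mathcal D\subset\mathcal R$ that contains $C_0\cup\underline C_0$ and contains with each $(u,v)$ all $(u',v')\in\mathcal R$ with $u'\le u$, $v'\le v$, such that $\partial_u r<0$ and $\partial_v r<0$ on $C_0\cup\underline C_0$, with the gauge $\partial_v r=-1$ on $C_0$ and $\partial_u r=-1$ on $\underline C_0$. It is *maximal* if it has no proper extension to another future development. It is *strongly singular* if there are $u_{\mathcal S}\in(u_0,u_1)$ and a continuous, strictly decreasing function $v_*:[u_{\mathcal S},u_1]\to\mathbb R$ with $v_*(u_{\mathcal S})=v_1$ such that $\mathcal D$ consists of those $(u,v)\in\mathcal R$ with $u<u_{\mathcal S}$ or $v<v_*(u)$, and $r$ extends continuously to $0$ on $\mathcal S=\{(u,v_*(u)):u_{\mathcal S}\le u\le u_1\}$. A function $f$ is $C^{0,\beta}$ (resp. $C^{0,\beta,\log}$) in $\mathcal D$ if it is bounded and, for some constant $C$, on every segment in $\mathcal D$ in a coordinate direction and of length $s>0$, its values at the two endpoints differ by at most $Cs^\beta$ (resp. $Cs^\beta(1+|\log s|)$). It is $C^{1,\beta}$ if it is $C^1$ and $\partial_uf,\partial_vf$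 are $C^{0,\beta}$. Put $r_0=r(u_0,v_0)$ and $\bar{\mathcal D}=\mathcal D\cup\mathcal S$; for $p=(u_p,v_p)\in\mathcal S$ put $J^-(p)=\{(u,v)\in\mathcal D:u\le u_p,\ v\le v_p\}$. The Hawking mass $m$ is defined by $1-2m/r=g(\nabla r,\nabla r)=-4\Omega^{-2}\partial_u r\,\partial_v r$. **Theorem.** Let $(\mathcal D,r,\Omega^2,\phi)$ be a maximal future development that is strongly singular. Then: (I) $r^2$ is $C^{1,1/2}$ in $\mathcal D$. There are constants $R_0,R_1>0$ with $R_0\le-r\partial_u r\le R_1$ and $R_0\le-r\partial_v r\le R_1$ in $\mathcal D$. The function $v_*$ is $C^{1,1/2}$ on $[u_{\mathcal S},u_1]$, and $-r\partial_u r$, $-r\partial_v r$ extend continuously to $\bar{\mathcal D}$; their values at $p\in\mathcal S$ are denoted $C_u(p)$, $C_v(p)$. (II) There are a $C^{0,1/2}$ function $\Psi$ and a $C^{0,1/2,\log}$ function $\Xi$ on $\mathcal D$, both extending continuously to $\bar{\mathcal D}$ (with values $\Psi_\infty$, $\Xi_\infty$ on $\mathcal S$), such that in $\mathcal D$ $$\phi=\Psi\log\left(\frac{r_0}{r}\right)+\Xi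 .$$ (III) There is a $C^{0,1/2,\log}$ function $\mathfrak M$ on $\mathcal D$, extending continuously to $\bar{\mathcal D}$ as a positive function (with values $\mathfrak M_\infty$ on $\mathcal S$), such that in $\mathcal D$ $$4\Omega^{-2}\partial_u r\,\partial_v r=\mathfrak M\left(\frac{r}{r_0}\right)^{-(\Psi^2+1)} .$$ (IV) For every $p\in\mathcal S$ there is a constant $D>0$ such that on $J^-(p)$, with $C_u,C_v,\Psi_\infty,\Xi_\infty,\mathfrak M_\infty$ evaluated at $p$ and $\ell(r)=1+|\log r|$, $$|-r\partial_u r-C_u|\le Dr,\quad |-r\partial_v r-C_v|\le Dr,\quad |r^2\partial_u\phi-C_u\Psi_\infty|\le Dr,\quad |r^2\partial_v\phi-C_v\Psi_\infty|\le Dr,$$ $$\left|\phi-\Psi_\infty\log\left(\frac{r_0}{r}\right)-\Xi_\infty\right|\le D\,r\,\ell(r),$$ $$\left|\Omega^2-\frac{4C_uC_v}{r_0^2}\,\mathfrak M_\infty^{-1}\left(\frac{r}{r_0}\right)^{\Psi_\infty^2-1}\right|\le D\,r^{\Psi_\infty^2}\,\ell(r).$$ (V) With the same conventions, on $J^-(p)$,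 $$\left|2m-\mathfrak M_\infty r_0\left(\frac{r_0}{r}\right)^{\Psi_\infty^2}\right|\le D\,r^{-\Psi_\infty^2+1}\,\ell(r),$$ $$\left|\mathrm{Riem}_{\alpha\beta\gamma\delta}\mathrm{Riem}^{\alpha\beta\gamma\delta}-\mathfrak M_\infty^2\left(\frac{r_0}{r}\right)^{2(\Psi_\infty^2+3)}\frac{4(3-2\Psi_\infty^2+2\Psi_\infty^4)}{r_0^4}\right|\le D\,r^{-2\Psi_\infty^2-5}\,\ell(r),$$ $$\left|\nabla_\alpha\phi\nabla^\alpha\phi+\frac{\mathfrak M_\infty\Psi_\infty^2}{r_0^2}\left(\frac{r_0}{r}\right)^{\Psi_\infty^2+3}\right|\le D\,r^{-\Psi_\infty^2-2}\,\ell(r),$$ where the curvature and the gradient are those of the four-dimensional metric $g$. -/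

import Mathlib

open Set Filter Topology

namespace ESFSS

/-! ### Function spaces on a bounded domain of the `(u, v)`-plane -/

/-- Partial derivative in `u` of a function on `D` (one-sided on the edges of `D`). -/
noncomputable def du (D : Set (ℝ × ℝ)) (f : ℝ × ℝ → ℝ) (p : ℝ × ℝ) : ℝ :=
  fderivWithin ℝ f D p (1, 0)

/-- Partial derivative in `v` of a function on `D` (one-sided on the edges of `D`). -/
noncomputable def dv (D : Set (ℝ × ℝ)) (f : ℝ × ℝ → ℝ) (p : ℝ × ℝ) : ℝ :=
  fderivWithin ℝ f D p (0, 1)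

/-- `f` is bounded on `D`, and along every coordinate segment contained in `D` it has the
modulus of continuity `C * ω`. -/
def HasModulus (ω : ℝ → ℝ) (D : Set (ℝ × ℝ)) (f : ℝ × ℝ → ℝ) : Prop :=
  ∃ C : ℝ,
    (∀ p ∈ D, |f p| ≤ C) ∧
    (∀ u v v' : ℝ, v < v' → (∀ t ∈ Icc v v', (u, t) ∈ D) →
      |f (u, v') - f (u, v)| ≤ C * ω (v' - v)) ∧
    (∀ u u' v : ℝ, u < u' → (∀ t ∈ Icc u u', (t, v) ∈ D) →
      |f (u', v) - f (u, v)| ≤ C * ω (u' - u))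

/-- `f` is of class `C^{0,β}` in `D`. -/
def IsHolder (β : ℝ) (D : Set (ℝ × ℝ)) (f : ℝ × ℝ → ℝ) : Prop :=
  HasModulus (fun s => s ^ β) D f

/-- `f` is of class `C^{0,β,log}` in `D`. -/
def IsLogHolder (β : ℝ) (D : Set (ℝ × ℝ)) (f : ℝ × ℝ → ℝ) : Prop :=
  HasModulus (fun s => s ^ β * (1 + |Real.log s|)) D f

/-- `f` is of class `C^{1,β}` in `D`. -/
def IsC1Holder (β : ℝ) (D : Set (ℝ × ℝ)) (f : ℝ × ℝ → ℝ) : Prop :=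
  ContDiffOn ℝ 1 f D ∧ IsHolder β D (du D f) ∧ IsHolder β D (dv D f)

/-! ### The spherically symmetric Einstein-scalar field system -/

/-- The unknowns: the area-radius `r`, the squared null lapse `Ω²` and the scalar field `φ`,
as functions of the null coordinates `(u, v)` (relevant only on the domain of existence). -/
structure Fields where
  r : ℝ × ℝ → ℝ
  Ωsq : ℝ × ℝ → ℝ
  φ : ℝ × ℝ → ℝ

/-- The spherically symmetric Einstein-scalar field equations on `D`: the two Raychaudhuri
equations, the propagation equations for `r` and `Ω²`, and the wave equation for `φ`. -/
structure SolvesESFSS (D : Set (ℝ × ℝ)) (F : Fields) : Prop where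
  raychaudhuri_u : ∀ p ∈ D,
    du D (fun q => -(F.Ωsq q)⁻¹ * du D F.r q) p = (F.Ωsq p)⁻¹ * F.r p * du D F.φ p ^ 2
  raychaudhuri_v : ∀ p ∈ D,
    dv D (fun q => -(F.Ωsq q)⁻¹ * dv D F.r q) p = (F.Ωsq p)⁻¹ * F.r p * dv D F.φ p ^ 2
  wave_r : ∀ p ∈ D,
    du D (dv D F.r) p = -F.Ωsq p / (4 * F.r p) - du D F.r p * dv D F.r p / F.r p
  wave_Ω : ∀ p ∈ D,
    du D (dv D (fun q => Real.log (F.Ωsq q))) p =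
      F.Ωsq p / (2 * F.r p ^ 2) + 2 * du D F.r p * dv D F.r p / F.r p ^ 2
        - 2 * du D F.φ p * dv D F.φ p
  wave_φ : ∀ p ∈ D,
    du D (dv D F.φ) p =
      -(du D F.r p * dv D F.φ p) / F.r p - dv D F.r p * du D F.φ p / F.r p

/-- The characteristic rectangle `[u₀, u₁] × [v₀, v₁]`. -/
def rectangle (u₀ u₁ v₀ v₁ : ℝ) : Set (ℝ × ℝ) := Icc u₀ u₁ ×ˢ Icc v₀ v₁

/-- The initial outgoing null hypersurface `C₀`. -/
def outgoingCone (u₀ v₀ v₁ : ℝ) : Set (ℝ × ℝ) := {u₀} ×ˢ Icc v₀ v₁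

/-- The initial ingoing null hypersurface. -/
def ingoingCone (u₀ u₁ v₀ : ℝ) : Set (ℝ × ℝ) := Icc u₀ u₁ ×ˢ {v₀}

/-- `(D, F)` is a future development of trapped characteristic initial data posed on the two
null hypersurfaces `{u₀} × [v₀, v₁]` and `[u₀, u₁] × {v₀}`, in the gauge where `∂_v r = -1` on
the former and `∂_u r = -1` on the latter: a regular (`C²`) solution on a relatively open,
causally past-closed subset `D` of the characteristic rectangle containing the initial
hypersurfaces. -/
structure IsFutureDevelopment (u₀ u₁ v₀ v₁ : ℝ) (D : Set (ℝ × ℝ)) (F : Fields) : Prop where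
  u_lt : u₀ < u₁
  v_lt : v₀ < v₁
  relatively_open : ∃ O : Set (ℝ × ℝ), IsOpen O ∧ D = rectangle u₀ u₁ v₀ v₁ ∩ O
  past_closed : ∀ p ∈ D, ∀ q ∈ rectangle u₀ u₁ v₀ v₁, q.1 ≤ p.1 → q.2 ≤ p.2 → q ∈ D
  outgoing_subset : outgoingCone u₀ v₀ v₁ ⊆ D
  ingoing_subset : ingoingCone u₀ u₁ v₀ ⊆ D
  contDiffOn_r : ContDiffOn ℝ 2 F.r D
  contDiffOn_Ωsq : ContDiffOn ℝ 2 F.Ωsq D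
  contDiffOn_φ : ContDiffOn ℝ 2 F.φ D
  r_pos : ∀ p ∈ D, 0 < F.r p
  Ωsq_pos : ∀ p ∈ D, 0 < F.Ωsq p
  solves : SolvesESFSS D F
  trapped : ∀ p ∈ outgoingCone u₀ v₀ v₁ ∪ ingoingCone u₀ u₁ v₀, du D F.r p < 0 ∧ dv D F.r p < 0
  gauge_outgoing : ∀ p ∈ outgoingCone u₀ v₀ v₁, dv D F.r p = -1
  gauge_ingoing : ∀ p ∈ ingoingCone u₀ u₁ v₀, du D F.r p = -1

/-- A future development is maximal if it has no proper extension. -/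
def IsMaximalFutureDevelopment (u₀ u₁ v₀ v₁ : ℝ) (D : Set (ℝ × ℝ)) (F : Fields) : Prop :=
  IsFutureDevelopment u₀ u₁ v₀ v₁ D F ∧
    ∀ (D' : Set (ℝ × ℝ)) (F' : Fields), IsFutureDevelopment u₀ u₁ v₀ v₁ D' F' → D ⊆ D' →
      EqOn F'.r F.r D → EqOn F'.Ωsq F.Ωsq D → EqOn F'.φ F.φ D → D' = D

/-- The curve `𝓢 = {(u, v_*(u)) : uS ≤ u ≤ u₁}`, where `uS` stands for `v_*⁻¹(v₁)`. -/
def singularBoundary (uS u₁ : ℝ) (vStar : ℝ → ℝ) : Set (ℝ × ℝ) :=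
  {p | p.1 ∈ Icc uS u₁ ∧ p.2 = vStar p.1}

/-- The development on `D` is strongly singular (with vanishing Maxwell charge): the
part of the characteristic rectangle not reached by `D` is exactly what lies on or to the future
of the spacelike curve `v = v_*(u)`, `uS ≤ u ≤ u₁`, with `uS = v_*⁻¹(v₁)`, and `r` extends
continuously to `0` on that curve. -/
structure IsStronglySingular (u₀ u₁ v₀ v₁ : ℝ) (D : Set (ℝ × ℝ)) (F : Fields)
    (uS : ℝ) (vStar : ℝ → ℝ) : Prop where
  uS_mem : uS ∈ Ioo u₀ u₁
  vStar_uS : vStar uS = v₁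
  continuousOn_vStar : ContinuousOn vStar (Icc uS u₁)
  strictAntiOn_vStar : StrictAntiOn vStar (Icc uS u₁)
  domain_eq : D = {p ∈ rectangle u₀ u₁ v₀ v₁ | uS ≤ p.1 → p.2 < vStar p.1}
  tendsto_r : ∀ p ∈ singularBoundary uS u₁ vStar, Tendsto F.r (𝓝[D] p) (𝓝 0)

/-- The causal past of `p` in `D`. -/
def causalPast (D : Set (ℝ × ℝ)) (p : ℝ × ℝ) : Set (ℝ × ℝ) :=
  {q ∈ D | q.1 ≤ p.1 ∧ q.2 ≤ p.2}

/-- The Hawking mass `m`, given by `1 - 2m/r = g(∇r, ∇r) = -4 Ω⁻² ∂_u r ∂_v r`. -/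
noncomputable def hawkingMass (D : Set (ℝ × ℝ)) (F : Fields) (p : ℝ × ℝ) : ℝ :=
  F.r p / 2 * (1 + 4 * (F.Ωsq p)⁻¹ * du D F.r p * dv D F.r p)

/-! ### The four-dimensional geometry, in the coordinates `(u, v, θ, ϕ)` -/

/-- The coordinate domain: `(u, v) ∈ D`, `0 < θ < π`, and `ϕ` is a (periodic) real variable. -/
def spacetime (D : Set (ℝ × ℝ)) : Set (Fin 4 → ℝ) :=
  {x | (x 0, x 1) ∈ D ∧ x 2 ∈ Ioo 0 Real.pi}

/-- The metric `g = -Ω² du dv + r² (dθ² + sin² θ dϕ²)`. -/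
noncomputable def metric (F : Fields) (x : Fin 4 → ℝ) : Matrix (Fin 4) (Fin 4) ℝ :=
  !![0, -F.Ωsq (x 0, x 1) / 2, 0, 0;
     -F.Ωsq (x 0, x 1) / 2, 0, 0, 0;
     0, 0, F.r (x 0, x 1) ^ 2, 0;
     0, 0, 0, F.r (x 0, x 1) ^ 2 * Real.sin (x 2) ^ 2]

/-- The `i`-th coordinate derivative of a function on `M`. -/
noncomputable def pd (M : Set (Fin 4 → ℝ)) (i : Fin 4) (f : (Fin 4 → ℝ) → ℝ)
    (x : Fin 4 → ℝ) : ℝ :=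
  fderivWithin ℝ f M x (Pi.single i 1)

/-- The Christoffel symbols `Γ^k_{ij}`. -/
noncomputable def christoffel (M : Set (Fin 4 → ℝ))
    (g : (Fin 4 → ℝ) → Matrix (Fin 4) (Fin 4) ℝ) (k i j : Fin 4) (x : Fin 4 → ℝ) : ℝ :=
  1 / 2 * ∑ l, (g x)⁻¹ k l *
    (pd M i (fun y => g y l j) x + pd M j (fun y => g y l i) x - pd M l (fun y => g y i j) x)

/-- The curvature tensor `R^a_{bcd} = ∂_c Γ^a_{db} - ∂_d Γ^a_{cb} + Γ^a_{ce} Γ^e_{db} -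
Γ^a_{de} Γ^e_{cb}`. -/
noncomputable def riemannUp (M : Set (Fin 4 → ℝ))
    (g : (Fin 4 → ℝ) → Matrix (Fin 4) (Fin 4) ℝ) (a b c d : Fin 4) (x : Fin 4 → ℝ) : ℝ :=
  pd M c (christoffel M g a d b) x - pd M d (christoffel M g a c b) x
    + ∑ e, (christoffel M g a c e x * christoffel M g e d b x
        - christoffel M g a d e x * christoffel M g e c b x)

/-- The fully covariant curvature tensor `Riem_{abcd}`. -/
noncomputable def riemann (M : Set (Fin 4 → ℝ))
    (g : (Fin 4 → ℝ) → Matrix (Fin 4) (Fin 4) ℝ) (a b c d : Fin 4) (x : Fin 4 → ℝ) : ℝ :=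
  ∑ e, g x a e * riemannUp M g e b c d x

/-- The fully contravariant curvature tensor `Riem^{abcd}`. -/
noncomputable def riemannContra (M : Set (Fin 4 → ℝ))
    (g : (Fin 4 → ℝ) → Matrix (Fin 4) (Fin 4) ℝ) (a b c d : Fin 4) (x : Fin 4 → ℝ) : ℝ :=
  ∑ a', ∑ b', ∑ c', ∑ d', (g x)⁻¹ a a' * (g x)⁻¹ b b' * (g x)⁻¹ c c' * (g x)⁻¹ d d' *
    riemann M g a' b' c' d' x

/-- The Kretschmann scalar `Riem_{abcd} Riem^{abcd}`. -/
noncomputable def kretschmann (M : Set (Fin 4 → ℝ))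
    (g : (Fin 4 → ℝ) → Matrix (Fin 4) (Fin 4) ℝ) (x : Fin 4 → ℝ) : ℝ :=
  ∑ a, ∑ b, ∑ c, ∑ d, riemann M g a b c d x * riemannContra M g a b c d x

/-- The scalar `∇_a f ∇^a f`. -/
noncomputable def gradSq (M : Set (Fin 4 → ℝ))
    (g : (Fin 4 → ℝ) → Matrix (Fin 4) (Fin 4) ℝ) (f : (Fin 4 → ℝ) → ℝ) (x : Fin 4 → ℝ) : ℝ :=
  ∑ a, ∑ b, (g x)⁻¹ a b * pd M a f x * pd M b f x

end ESFSS

namespace ESFSS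

/-! ### Derivatives along the coordinate lines of a domain -/

/-! The quantities that stay regular at `r = 0` are `P = -r ∂_u r`, `Q = -r ∂_v r`, `A = r² ∂_u φ /
P` and `B = r² ∂_v φ / Q`. Once `P` and `Q` lie between positive constants, both null derivatives of
`r` have size comparable to `1/r`. A quantity whose null derivatives are `O(1/r)` then varies along
causal curves by at most a multiple of the variation of `r`: it has boundary values, attained up to
`O(r)`, and since `r²` is Lipschitz in `(u, v)` it is Hölder of exponent `1/2`. Derivatives of size
`(1 + |log r|)/r` give in the same way errors of order `r (1 + |log r|)` and the logarithmic Hölder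
class. So everything reduces to bounds on first derivatives (`Bounds.controlled`).

Raychaudhuri makes `-Ω⁻² ∂_v r` monotone, whence `Ω² ≤ C/r`; integrating `∂_v P = ∂_u Q = Ω²/4` then
bounds `P` and `Q` (`exists_w_le`, `exists_P_bounds`). The wave equation for `φ` becomes a pair of
transport equations relaxing `A` towards `B` in `v` and `B` towards `A` in `u`, so a maximum
principle bounds both (`exists_scalar_bound`). The relaxation rate is of order `r⁻²`, so an `O(1/r)`
derivative requires `A - B = O(r)`. This is the heart of the proof. The quantities `twist` and
`cotwist`, in essence `r` times the derivatives of `A` and `B` tangent to the level sets of `r`,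
solve a coupled system in which damping beats coupling and the errors are only as large as the
damping coefficient; the maximum principle bounds them (`Bounds.exists_twist_le`), and one
integration yields `A - B = O(r)` (`Bounds.exists_sub_le`).

Now `Ψ` is the extension of `A`, `Ξ` that of `φ - A log(r₀/r)`, and `𝔐` the exponential of the
extension of `logMass`; in the last two the `r⁻²` parts of the derivatives cancel or carry a factor
`A - B`, and this cancellation is what selects the exponent `A² + 1`. For the singular curve, `r²`
at the common past corner of two of its points is integrated once in `u` and once in `v`; equating
the results gives slope `-P/Q` with error of order `3/2` (`exists_vStar_expansion`). Finally the
field equations express the Kretschmann scalar and the squared gradient of `φ` through `r`, `A`, `B`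
and `y = 4 Ω⁻² ∂_u r ∂_v r`, and the asymptotics are substituted. -/

/-- `f'` is the derivative of `f` along the `v`-slices of `D`. -/
def HasV (D : Set (ℝ × ℝ)) (f f' : ℝ × ℝ → ℝ) : Prop :=
  ∀ p ∈ D, HasDerivWithinAt (fun t => f (p.1, t)) (f' p) {t | (p.1, t) ∈ D} p.2

/-- `f'` is the derivative of `f` along the `u`-slices of `D`. -/
def HasU (D : Set (ℝ × ℝ)) (f f' : ℝ × ℝ → ℝ) : Prop :=
  ∀ p ∈ D, HasDerivWithinAt (fun t => f (t, p.2)) (f' p) {t | (t, p.2) ∈ D} p.1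

section Slices

variable {D : Set (ℝ × ℝ)} {f g f' g' : ℝ × ℝ → ℝ}

theorem HasV.swap (h : HasV D f f') :
    HasU (Prod.swap ⁻¹' D) (f ∘ Prod.swap) (f' ∘ Prod.swap) := fun p hp => h p.swap hp

theorem HasU.swap (h : HasU D f f') :
    HasV (Prod.swap ⁻¹' D) (f ∘ Prod.swap) (f' ∘ Prod.swap) := fun p hp => h p.swap hp

theorem HasV.congr_deriv (h : HasV D f f') (e : ∀ p ∈ D, f' p = g' p) : HasV D f g' :=
  fun p hp => e p hp ▸ h p hp

theorem HasV.congr (h : HasV D f f') (e : ∀ p ∈ D, g p = f p) : HasV D g f' :=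
  fun p hp => (h p hp).congr (fun _ ht => e _ ht) (e _ hp)

theorem HasV.const (c : ℝ) : HasV D (fun _ => c) (fun _ => 0) :=
  fun _ _ => hasDerivWithinAt_const _ _ _

theorem HasV.neg (h : HasV D f f') : HasV D (fun p => -f p) (fun p => -f' p) :=
  fun p hp => (h p hp).fun_neg

theorem HasV.add (h : HasV D f f') (k : HasV D g g') :
    HasV D (fun p => f p + g p) (fun p => f' p + g' p) :=
  fun p hp => (h p hp).fun_add (k p hp)

theorem HasV.sub (h : HasV D f f') (k : HasV D g g') :
    HasV D (fun p => f p - g p) (fun p => f' p - g' p) :=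
  fun p hp => (h p hp).fun_sub (k p hp)

theorem HasV.mul (h : HasV D f f') (k : HasV D g g') :
    HasV D (fun p => f p * g p) (fun p => f' p * g p + f p * g' p) :=
  fun p hp => (h p hp).fun_mul (k p hp)

theorem HasV.const_mul (c : ℝ) (h : HasV D f f') :
    HasV D (fun p => c * f p) (fun p => c * f' p) :=
  fun p hp => (h p hp).const_mul c

theorem HasV.div (h : HasV D f f') (k : HasV D g g') (hg : ∀ p ∈ D, g p ≠ 0) :
    HasV D (fun p => f p / g p) (fun p => (f' p * g p - f p * g' p) / g p ^ 2) :=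
  fun p hp => (h p hp).fun_div (k p hp) (hg p hp)

theorem HasV.pow (h : HasV D f f') (n : ℕ) :
    HasV D (fun p => f p ^ n) (fun p => n * f p ^ (n - 1) * f' p) :=
  fun p hp => (h p hp).fun_pow n

theorem HasV.log (h : HasV D f f') (hf : ∀ p ∈ D, f p ≠ 0) :
    HasV D (fun p => Real.log (f p)) (fun p => f' p / f p) :=
  fun p hp => (h p hp).log (hf p hp)

theorem HasV.inv_pow (h : HasV D f f') (hf : ∀ p ∈ D, f p ≠ 0) (n : ℕ) :
    HasV D (fun p => 1 / f p ^ n) (fun p => -(n * f' p / f p ^ (n + 1))) := by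
  refine ((HasV.const 1).div (h.pow n) fun p hp => pow_ne_zero _ (hf p hp)).congr_deriv ?_
  intro p hp
  have := hf p hp
  rcases n with _ | n
  · simp
  · field_simp
    simp only [Nat.add_sub_cancel]
    ring

theorem HasU.congr_deriv (h : HasU D f f') (e : ∀ p ∈ D, f' p = g' p) : HasU D f g' :=
  fun p hp => e p hp ▸ h p hp

theorem HasU.congr (h : HasU D f f') (e : ∀ p ∈ D, g p = f p) : HasU D g f' :=
  fun p hp => (h p hp).congr (fun _ ht => e _ ht) (e _ hp)

theorem HasU.neg (h : HasU D f f') : HasU D (fun p => -f p) (fun p => -f' p) :=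
  fun p hp => (h p hp).fun_neg

theorem HasU.sub (h : HasU D f f') (k : HasU D g g') :
    HasU D (fun p => f p - g p) (fun p => f' p - g' p) :=
  fun p hp => (h p hp).fun_sub (k p hp)

theorem HasU.mul (h : HasU D f f') (k : HasU D g g') :
    HasU D (fun p => f p * g p) (fun p => f' p * g p + f p * g' p) :=
  fun p hp => (h p hp).fun_mul (k p hp)

theorem HasU.const_mul (c : ℝ) (h : HasU D f f') :
    HasU D (fun p => c * f p) (fun p => c * f' p) :=
  fun p hp => (h p hp).const_mul c

theorem HasU.div (h : HasU D f f') (k : HasU D g g') (hg : ∀ p ∈ D, g p ≠ 0) :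
    HasU D (fun p => f p / g p) (fun p => (f' p * g p - f p * g' p) / g p ^ 2) :=
  fun p hp => (h p hp).fun_div (k p hp) (hg p hp)

theorem HasU.log (h : HasU D f f') (hf : ∀ p ∈ D, f p ≠ 0) :
    HasU D (fun p => Real.log (f p)) (fun p => f' p / f p) :=
  fun p hp => (h p hp).log (hf p hp)

theorem HasU.pow (h : HasU D f f') (n : ℕ) :
    HasU D (fun p => f p ^ n) (fun p => n * f p ^ (n - 1) * f' p) :=
  fun p hp => (h p hp).fun_pow n

end Slices

/-! ### Integration along null lines from the initial cones -/

/-- A subset of the quadrant `u₀ ≤ u`, `v₀ ≤ v` that is closed under passing to the causal past,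
with compact initial null segments. -/
structure PastDomain (D : Set (ℝ × ℝ)) (u₀ v₀ : ℝ) : Prop where
  fst_le : ∀ p ∈ D, u₀ ≤ p.1
  snd_le : ∀ p ∈ D, v₀ ≤ p.2
  past : ∀ p ∈ D, ∀ q : ℝ × ℝ, u₀ ≤ q.1 → q.1 ≤ p.1 → v₀ ≤ q.2 → q.2 ≤ p.2 → q ∈ D
  isCompact_fst : IsCompact {p ∈ D | p.1 = u₀}
  isCompact_snd : IsCompact {p ∈ D | p.2 = v₀}

namespace PastDomain

variable {D : Set (ℝ × ℝ)} {u₀ v₀ : ℝ} {f g f' g' : ℝ × ℝ → ℝ}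

theorem swap (hD : PastDomain D u₀ v₀) : PastDomain (Prod.swap ⁻¹' D) v₀ u₀ where
  fst_le p hp := hD.snd_le _ hp
  snd_le p hp := hD.fst_le _ hp
  past p hp q h1 h2 h3 h4 := hD.past _ hp _ h3 h4 h1 h2
  isCompact_fst := by
    have := hD.isCompact_snd.image continuous_swap
    rwa [image_swap_eq_preimage_swap] at this
  isCompact_snd := by
    have := hD.isCompact_fst.image continuous_swap
    rwa [image_swap_eq_preimage_swap] at this

theorem exists_bound (hD : PastDomain D u₀ v₀) (hf : ContinuousOn f D) :
    ∃ M, 0 < M ∧ ∀ p ∈ D, p.1 = u₀ ∨ p.2 = v₀ → |f p| ≤ M := by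
  have hK := hD.isCompact_fst.union hD.isCompact_snd
  obtain ⟨M, hM⟩ := hK.exists_bound_of_continuousOn
    (hf.mono (union_subset (sep_subset _ _) (sep_subset _ _)))
  refine ⟨max M 1, by positivity, fun p hp h => ?_⟩
  have hp' : p ∈ {p ∈ D | p.1 = u₀} ∪ {p ∈ D | p.2 = v₀} :=
    h.elim (fun h => Or.inl ⟨hp, h⟩) (fun h => Or.inr ⟨hp, h⟩)
  exact (hM p hp').trans (le_max_left _ _)

theorem exists_pos_le (hD : PastDomain D u₀ v₀) (hf : ContinuousOn f D)
    (hpos : ∀ p ∈ D, 0 < f p) :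
    ∃ c, 0 < c ∧ ∀ p ∈ D, p.1 = u₀ ∨ p.2 = v₀ → c ≤ f p := by
  obtain ⟨M, hM, h⟩ := hD.exists_bound (hf.inv₀ fun p hp => (hpos p hp).ne')
  refine ⟨M⁻¹, inv_pos.2 hM, fun p hp hp' => ?_⟩
  have h1 := (le_abs_self _).trans (h p hp hp')
  exact inv_le_of_inv_le₀ (hpos p hp) h1

theorem mk_mem_of_le (hD : PastDomain D u₀ v₀) {u v v' : ℝ} (h : (u, v') ∈ D) (h1 : v₀ ≤ v)
    (h2 : v ≤ v') : (u, v) ∈ D :=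
  hD.past _ h (u, v) (hD.fst_le (u, v') h) le_rfl h1 h2

theorem mk_mem_of_le' (hD : PastDomain D u₀ v₀) {u u' v : ℝ} (h : (u', v) ∈ D) (h1 : u₀ ≤ u)
    (h2 : u ≤ u') : (u, v) ∈ D :=
  hD.past _ h (u, v) h1 h2 (hD.snd_le (u', v) h) le_rfl

theorem mono_v (hD : PastDomain D u₀ v₀) (h : HasV D f f') (h0 : ∀ p ∈ D, 0 ≤ f' p)
    {u v v' : ℝ} (hv : v₀ ≤ v) (hvv : v ≤ v') (hm : (u, v') ∈ D) : f (u, v) ≤ f (u, v') := by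
  have hsub : Icc v v' ⊆ {t | (u, t) ∈ D} := fun t ht =>
    hD.mk_mem_of_le hm (hv.trans ht.1) ht.2
  have hd : ∀ t ∈ Icc v v', HasDerivWithinAt (fun t => f (u, t)) (f' (u, t)) (Icc v v') t :=
    fun t ht => (h (u, t) (hsub ht)).mono hsub
  have hmono : MonotoneOn (fun t => f (u, t)) (Icc v v') := by
    refine monotoneOn_of_hasDerivWithinAt_nonneg (convex_Icc v v')
      (f' := fun t => f' (u, t)) (fun t ht => (hd t ht).continuousWithinAt)
      (fun t ht => (hd t (interior_subset ht)).mono interior_subset)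
      (fun t ht => h0 _ (hsub (interior_subset ht)))
  exact hmono (left_mem_Icc.2 hvv) (right_mem_Icc.2 hvv) hvv

theorem mono_u (hD : PastDomain D u₀ v₀) (h : HasU D f f') (h0 : ∀ p ∈ D, 0 ≤ f' p)
    {u u' v : ℝ} (hu : u₀ ≤ u) (huu : u ≤ u') (hm : (u', v) ∈ D) : f (u, v) ≤ f (u', v) :=
  hD.swap.mono_v h.swap (fun _ hp => h0 _ hp) (u := v) (v := u) (v' := u') hu huu hm

theorem le_of_cone (hD : PastDomain D u₀ v₀) (h : HasV D f f') (h0 : ∀ p ∈ D, 0 ≤ f' p)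
    {c : ℝ} (hc : ∀ p ∈ D, p.2 = v₀ → c ≤ f p) : ∀ p ∈ D, c ≤ f p := fun _ hp =>
  (hc _ (hD.mk_mem_of_le hp le_rfl (hD.snd_le _ hp)) rfl).trans
    (hD.mono_v h h0 le_rfl (hD.snd_le _ hp) hp)

/-- Both `g - f` and `g + f` are nondecreasing in `v` and nonnegative on the cone `v = v₀`. -/
theorem abs_le_of_abs_deriv_le (hD : PastDomain D u₀ v₀) (h : HasV D f f') (k : HasV D g g')
    (h0 : ∀ p ∈ D, |f' p| ≤ g' p) (hc : ∀ p ∈ D, p.2 = v₀ → |f p| ≤ g p) :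
    ∀ p ∈ D, |f p| ≤ g p := by
  intro p hp
  have h1 := hD.le_of_cone (k.sub h) (c := 0)
    (fun q hq => by linarith [(abs_le.1 (h0 q hq)).2])
    (fun q hq hq' => by linarith [(abs_le.1 (hc q hq hq')).2]) p hp
  have h2 := hD.le_of_cone (k.add h) (c := 0)
    (fun q hq => by linarith [(abs_le.1 (h0 q hq)).1])
    (fun q hq hq' => by linarith [(abs_le.1 (hc q hq hq')).1]) p hp
  exact abs_le.2 ⟨by linarith, by linarith⟩

end PastDomain

/-! ### Maximum principle for pairs transported in the two null directions -/

theorem HasDerivWithinAt.nonneg_of_max_right {k : ℝ → ℝ} {k' a b : ℝ} (hab : a < b)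
    (h : HasDerivWithinAt k k' (Icc a b) b) (hmax : ∀ t ∈ Icc a b, k t ≤ k b) : 0 ≤ k' := by
  have hs := hasDerivWithinAt_iff_tendsto_slope.1 h
  have : (𝓝[Icc a b \ {b}] b).NeBot := by
    rw [Icc_sdiff_right]
    exact right_nhdsWithin_Ico_neBot hab
  refine ge_of_tendsto hs (eventually_nhdsWithin_of_forall fun t ht => ?_)
  rw [slope_def_field]
  have h1 : t - b < 0 := sub_neg.2 (lt_of_le_of_ne ht.1.2 ht.2)
  exact div_nonneg_of_nonpos (sub_nonpos.2 (hmax t ht.1)) h1.le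

namespace PastDomain

variable {D : Set (ℝ × ℝ)} {u₀ v₀ : ℝ} {f g f' g' : ℝ × ℝ → ℝ}

/-- Maximum principle for a pair of quantities transported in the two null directions. -/
theorem max_principle (hD : PastDomain D u₀ v₀) (hf : HasV D f f') (hg : HasU D g g')
    (cf : ContinuousOn f D) (cg : ContinuousOn g D) {M : ℝ}
    (h0 : ∀ p ∈ D, p.1 = u₀ ∨ p.2 = v₀ → f p ≤ M ∧ g p ≤ M)
    (hf' : ∀ p ∈ D, M < f p → g p ≤ f p → f' p < 0)
    (hg' : ∀ p ∈ D, M < g p → f p ≤ g p → g' p < 0) :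
    ∀ p ∈ D, f p ≤ M ∧ g p ≤ M := by
  intro p hp
  set K : Set (ℝ × ℝ) := Icc u₀ p.1 ×ˢ Icc v₀ p.2 with hK
  have hKD : K ⊆ D := fun q hq => hD.past p hp q hq.1.1 hq.1.2 hq.2.1 hq.2.2
  have hpK : p ∈ K := ⟨right_mem_Icc.2 (hD.fst_le p hp), right_mem_Icc.2 (hD.snd_le p hp)⟩
  -- The larger of the two quantities is maximised over the compact causal past of `p`. If the
  -- maximum exceeds `M`, it is attained off both initial cones, so a segment can be followed
  -- backwards in the transport direction of the larger quantity; the one-sided derivative there is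
  -- nonnegative, against the sign hypothesis.
  obtain ⟨q, hqK, hq⟩ := (isCompact_Icc.prod isCompact_Icc : IsCompact K).exists_isMaxOn ⟨p, hpK⟩
    ((cf.mono hKD).sup (cg.mono hKD))
  have hqD := hKD hqK
  have hmax : ∀ t ∈ K, max (f t) (g t) ≤ max (f q) (g q) := fun t ht => hq ht
  suffices h : max (f q) (g q) ≤ M by
    have := (hmax p hpK).trans h
    exact ⟨(le_max_left _ _).trans this, (le_max_right _ _).trans this⟩
  by_contra! hM
  have hne : q.1 ≠ u₀ ∧ q.2 ≠ v₀ := by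
    by_contra hcon
    have := h0 q hqD (by tauto)
    exact absurd (max_le this.1 this.2) (not_le.2 hM)
  rcases le_total (g q) (f q) with hle | hle
  · rw [max_eq_left hle] at hM hmax
    have hlt : v₀ < q.2 := lt_of_le_of_ne hqK.2.1 (Ne.symm hne.2)
    have hmem : ∀ t ∈ Icc v₀ q.2, (q.1, t) ∈ K := fun t ht =>
      ⟨hqK.1, ht.1, ht.2.trans hqK.2.2⟩
    have := HasDerivWithinAt.nonneg_of_max_right hlt
      ((hf q hqD).mono fun t ht => hKD (hmem t ht))
      (fun t ht => (le_max_left _ _).trans (hmax _ (hmem t ht)))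
    exact absurd (hf' q hqD hM hle) (not_lt.2 this)
  · rw [max_eq_right hle] at hM hmax
    have hlt : u₀ < q.1 := lt_of_le_of_ne hqK.1.1 (Ne.symm hne.1)
    have hmem : ∀ t ∈ Icc u₀ q.1, (t, q.2) ∈ K := fun t ht =>
      ⟨⟨ht.1, ht.2.trans hqK.1.2⟩, hqK.2⟩
    have := HasDerivWithinAt.nonneg_of_max_right hlt
      ((hg q hqD).mono fun t ht => hKD (hmem t ht))
      (fun t ht => (le_max_right _ _).trans (hmax _ (hmem t ht)))
    exact absurd (hg' q hqD hM hle) (not_lt.2 this)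

/-- The scalar principle applied to the squares, which unlike absolute values are differentiable. -/
theorem abs_max_principle (hD : PastDomain D u₀ v₀) (hf : HasV D f f') (hg : HasU D g g')
    (cf : ContinuousOn f D) (cg : ContinuousOn g D) {M : ℝ}
    (h0 : ∀ p ∈ D, p.1 = u₀ ∨ p.2 = v₀ → |f p| ≤ M ∧ |g p| ≤ M)
    (hf' : ∀ p ∈ D, M < |f p| → |g p| ≤ |f p| → f p * f' p < 0)
    (hg' : ∀ p ∈ D, M < |g p| → |f p| ≤ |g p| → g p * g' p < 0)
    (hM : 0 ≤ M) :
    ∀ p ∈ D, |f p| ≤ M ∧ |g p| ≤ M := by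
  intro p hp
  have hf2 := hf.pow 2
  have hg2 := hg.pow 2
  have key := hD.max_principle hf2 hg2 (cf.pow 2) (cg.pow 2) (M := M ^ 2)
    (fun p hp h => by
      have := h0 p hp h
      rw [← sq_abs (f p), ← sq_abs (g p)]
      exact ⟨by gcongr; exact this.1, by gcongr; exact this.2⟩)
    (fun p hp h1 h2 => by
      have := hf' p hp (by simpa [abs_of_nonneg hM] using sq_lt_sq.1 h1) (sq_le_sq.1 h2)
      norm_num
      linarith)
    (fun p hp h1 h2 => by
      have := hg' p hp (by simpa [abs_of_nonneg hM] using sq_lt_sq.1 h1) (sq_le_sq.1 h2)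
      norm_num
      linarith) p hp
  exact ⟨abs_le_of_sq_le_sq key.1 hM, abs_le_of_sq_le_sq key.2 hM⟩

end PastDomain

/-! ### Mixed partial derivatives under weak regularity -/

/-- Peano's criterion for the equality of mixed partial derivatives, on a product of convex
sets. -/
theorem hasDerivWithinAt_partial_of_mixed {N T : Set ℝ} (hN : Convex ℝ N) (hT : Convex ℝ T)
    {f fu fv fvu : ℝ × ℝ → ℝ} {u v : ℝ} (hu : u ∈ N) (hv : v ∈ T)
    [(𝓝[N \ {u}] u).NeBot]
    (hfu : ∀ t ∈ T, HasDerivWithinAt (fun s => f (s, t)) (fu (u, t)) N u)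
    (hfv : ∀ s ∈ N, ∀ t ∈ T, HasDerivWithinAt (fun t => f (s, t)) (fv (s, t)) T t)
    (hfvu : ∀ s ∈ N, ∀ t ∈ T, HasDerivWithinAt (fun s => fv (s, t)) (fvu (s, t)) N s)
    (hc : ContinuousWithinAt fvu (N ×ˢ T) (u, v)) :
    HasDerivWithinAt (fun t => fu (u, t)) (fvu (u, v)) T v := by
  rw [hasDerivWithinAt_iff_isLittleO, Asymptotics.isLittleO_iff]
  intro ε hε
  obtain ⟨δ, hδ, hball⟩ := Metric.continuousWithinAt_iff.1 hc ε hε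
  filter_upwards [self_mem_nhdsWithin,
    mem_nhdsWithin_of_mem_nhds (Metric.ball_mem_nhds v hδ)] with t ht htb
  set c := fvu (u, v) with hcdef
  set N' := N ∩ Metric.ball u δ with hN'
  set T' := T ∩ Metric.ball v δ with hT'
  have hN'c : Convex ℝ N' := hN.inter (convex_ball u δ)
  have hT'c : Convex ℝ T' := hT.inter (convex_ball v δ)
  have huN : u ∈ N' := ⟨hu, Metric.mem_ball_self hδ⟩
  have hvT : v ∈ T' := ⟨hv, Metric.mem_ball_self hδ⟩
  have htT : t ∈ T' := ⟨ht, htb⟩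
  have hclose : ∀ s ∈ N', ∀ τ ∈ T', ‖fvu (s, τ) - c‖ ≤ ε := fun s hs τ hτ => by
    have := hball (x := (s, τ)) ⟨hs.1, hτ.1⟩ (by
      rw [Prod.dist_eq]; exact max_lt hs.2 hτ.2)
    exact this.le
  -- Two mean value inequalities, first in `s` for `fv - c s`, then in `τ` for the `s`-increment of
  -- `f`, bring the second difference of `f` within `ε |s - u| |t - v|` of `c (s - u)(t - v)`.
  -- Dividing by `s - u` and letting `s → u` concludes.
  have h1 : ∀ τ ∈ T', ∀ s ∈ N', ‖(fv (s, τ) - c * s) - (fv (u, τ) - c * u)‖ ≤ ε * ‖s - u‖ :=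
    fun τ hτ s hs => hN'c.norm_image_sub_le_of_norm_hasDerivWithin_le
      (f := fun s => fv (s, τ) - c * s) (f' := fun s => fvu (s, τ) - c * 1)
      (fun x hx => ((hfvu x hx.1 τ hτ.1).mono inter_subset_left).fun_sub
        ((hasDerivWithinAt_id x _).const_mul c))
      (fun x hx => by simpa using hclose x hx τ hτ) huN hs
  have h2 : ∀ s ∈ N', ‖(f (s, t) - f (u, t) - c * (s - u) * t) -
      (f (s, v) - f (u, v) - c * (s - u) * v)‖ ≤ ε * ‖s - u‖ * ‖t - v‖ :=
    fun s hs => hT'c.norm_image_sub_le_of_norm_hasDerivWithin_le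
      (f := fun τ => f (s, τ) - f (u, τ) - c * (s - u) * τ)
      (f' := fun τ => fv (s, τ) - fv (u, τ) - c * (s - u) * 1)
      (fun x hx => (((hfv s hs.1 x hx.1).mono inter_subset_left).fun_sub
        ((hfv u hu x hx.1).mono inter_subset_left)).fun_sub
        ((hasDerivWithinAt_id x _).const_mul _))
      (fun x hx => by
        have := h1 x hx s hs
        refine le_of_eq_of_le ?_ this
        congr 1
        ring) hvT htT
  have hk : HasDerivWithinAt (fun s => f (s, t) - f (s, v) - c * (t - v) * s)
      (fu (u, t) - fu (u, v) - c * (t - v) * 1) N u :=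
    ((hfu t ht).fun_sub (hfu v hv)).fun_sub ((hasDerivWithinAt_id u _).const_mul _)
  have hs := (hasDerivWithinAt_iff_tendsto_slope.1 hk).norm
  have hle : ‖fu (u, t) - fu (u, v) - c * (t - v) * 1‖ ≤ ε * ‖t - v‖ := by
    refine le_of_tendsto hs ?_
    filter_upwards [self_mem_nhdsWithin,
      mem_nhdsWithin_of_mem_nhds (Metric.ball_mem_nhds u hδ)] with s hsN hsb
    have h3 := h2 s ⟨hsN.1, hsb⟩
    have hsu : s - u ≠ 0 := sub_ne_zero.2 hsN.2
    rw [slope_def_field, norm_div, div_le_iff₀ (norm_pos_iff.2 hsu)]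
    refine le_of_eq_of_le ?_ (h3.trans_eq (by ring))
    congr 1
    ring
  refine le_of_eq_of_le ?_ hle
  simp only [smul_eq_mul]
  congr 1
  ring


/-! ### The first-order system and its symmetry under exchange of null coordinates -/

/-- A trapped solution of the spherically symmetric system in first-order form: `w = Ω²`,
`P = -r ∂_u r`, `Q = -r ∂_v r`, `A = r² ∂_u φ / P`, `B = r² ∂_v φ / Q`, and `Wu`, `Wv` are the
derivatives of `log w`, `Pu` that of `P`, etc. -/
structure NullSolution where
  (D : Set (ℝ × ℝ))
  (u₀ v₀ : ℝ)
  (r w φ P Q A B Wu Wv Pu Qv Au Bv : ℝ × ℝ → ℝ)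
  dom : PastDomain D u₀ v₀
  r_pos : ∀ p ∈ D, 0 < r p
  w_pos : ∀ p ∈ D, 0 < w p
  P_pos : ∀ p ∈ D, 0 < P p
  Q_pos : ∀ p ∈ D, 0 < Q p
  r_u : HasU D r fun p => -(P p / r p)
  r_v : HasV D r fun p => -(Q p / r p)
  w_u : HasU D w fun p => w p * Wu p
  w_v : HasV D w fun p => w p * Wv p
  φ_u : HasU D φ fun p => P p * A p / r p ^ 2
  φ_v : HasV D φ fun p => Q p * B p / r p ^ 2
  P_u : HasU D P Pu
  P_v : HasV D P fun p => w p / 4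
  Q_u : HasU D Q fun p => w p / 4
  Q_v : HasV D Q Qv
  A_u : HasU D A Au
  A_v : HasV D A fun p => Q p / r p ^ 2 * (B p - A p) - w p / (4 * P p) * A p
  B_u : HasU D B fun p => P p / r p ^ 2 * (A p - B p) - w p / (4 * Q p) * B p
  B_v : HasV D B Bv
  Wu_v : HasV D Wu fun p =>
    w p / (2 * r p ^ 2) + 2 * (P p * Q p) / r p ^ 4 - 2 * (P p * A p) * (Q p * B p) / r p ^ 4
  Wv_u : HasU D Wv fun p =>
    w p / (2 * r p ^ 2) + 2 * (P p * Q p) / r p ^ 4 - 2 * (P p * A p) * (Q p * B p) / r p ^ 4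
  Pu_v : HasV D Pu fun p => w p * Wu p / 4
  Qv_u : HasU D Qv fun p => w p * Wv p / 4
  Au_v : HasV D Au fun p => (w p / 4 / r p ^ 2 + 2 * P p * Q p / r p ^ 4) * (B p - A p)
    + Q p / r p ^ 2 * (P p / r p ^ 2 * (A p - B p) - w p / (4 * Q p) * B p - Au p)
    - (w p * Wu p / (4 * P p) - w p * Pu p / (4 * P p ^ 2)) * A p - w p / (4 * P p) * Au p
  Bv_u : HasU D Bv fun p => (w p / 4 / r p ^ 2 + 2 * Q p * P p / r p ^ 4) * (A p - B p)
    + P p / r p ^ 2 * (Q p / r p ^ 2 * (B p - A p) - w p / (4 * P p) * A p - Bv p)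
    - (w p * Wv p / (4 * Q p) - w p * Qv p / (4 * Q p ^ 2)) * B p - w p / (4 * Q p) * Bv p
  ray_u : ∀ p ∈ D, Pu p = P p * (Wu p - P p / r p ^ 2 + P p * A p ^ 2 / r p ^ 2)
  ray_v : ∀ p ∈ D, Qv p = Q p * (Wv p - Q p / r p ^ 2 + Q p * B p ^ 2 / r p ^ 2)
  cont_r : ContinuousOn r D
  cont_w : ContinuousOn w D
  cont_P : ContinuousOn P D
  cont_Q : ContinuousOn Q D
  cont_A : ContinuousOn A D
  cont_B : ContinuousOn B D
  cont_Wu : ContinuousOn Wu D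
  cont_Wv : ContinuousOn Wv D
  cont_Pu : ContinuousOn Pu D
  cont_Qv : ContinuousOn Qv D
  cont_Au : ContinuousOn Au D
  cont_Bv : ContinuousOn Bv D

namespace NullSolution

theorem continuousOn_swap {D : Set (ℝ × ℝ)} {f : ℝ × ℝ → ℝ} (h : ContinuousOn f D) :
    ContinuousOn (f ∘ Prod.swap) (Prod.swap ⁻¹' D) :=
  h.comp continuous_swap.continuousOn fun _ hp => hp

/-- The solution with the roles of the two null coordinates exchanged. -/
def swap (X : NullSolution) : NullSolution where
  D := Prod.swap ⁻¹' X.D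
  u₀ := X.v₀
  v₀ := X.u₀
  r := X.r ∘ Prod.swap
  w := X.w ∘ Prod.swap
  φ := X.φ ∘ Prod.swap
  P := X.Q ∘ Prod.swap
  Q := X.P ∘ Prod.swap
  A := X.B ∘ Prod.swap
  B := X.A ∘ Prod.swap
  Wu := X.Wv ∘ Prod.swap
  Wv := X.Wu ∘ Prod.swap
  Pu := X.Qv ∘ Prod.swap
  Qv := X.Pu ∘ Prod.swap
  Au := X.Bv ∘ Prod.swap
  Bv := X.Au ∘ Prod.swap
  dom := X.dom.swap
  r_pos _ hp := X.r_pos _ hp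
  w_pos _ hp := X.w_pos _ hp
  P_pos _ hp := X.Q_pos _ hp
  Q_pos _ hp := X.P_pos _ hp
  r_u := X.r_v.swap
  r_v := X.r_u.swap
  w_u := X.w_v.swap
  w_v := X.w_u.swap
  φ_u := X.φ_v.swap
  φ_v := X.φ_u.swap
  P_u := X.Q_v.swap
  P_v := X.Q_u.swap
  Q_u := X.P_v.swap
  Q_v := X.P_u.swap
  A_u := X.B_v.swap
  A_v := X.B_u.swap
  B_u := X.A_v.swap
  B_v := X.A_u.swap
  Wu_v := X.Wv_u.swap.congr_deriv fun p _ => by simp only [Function.comp]; ring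
  Wv_u := X.Wu_v.swap.congr_deriv fun p _ => by simp only [Function.comp]; ring
  Pu_v := X.Qv_u.swap
  Qv_u := X.Pu_v.swap
  Au_v := X.Bv_u.swap
  Bv_u := X.Au_v.swap
  ray_u _ hp := X.ray_v _ hp
  ray_v _ hp := X.ray_u _ hp
  cont_r := continuousOn_swap X.cont_r
  cont_w := continuousOn_swap X.cont_w
  cont_P := continuousOn_swap X.cont_Q
  cont_Q := continuousOn_swap X.cont_P
  cont_A := continuousOn_swap X.cont_B
  cont_B := continuousOn_swap X.cont_A
  cont_Wu := continuousOn_swap X.cont_Wv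
  cont_Wv := continuousOn_swap X.cont_Wu
  cont_Pu := continuousOn_swap X.cont_Qv
  cont_Qv := continuousOn_swap X.cont_Pu
  cont_Au := continuousOn_swap X.cont_Bv
  cont_Bv := continuousOn_swap X.cont_Au

/-! ### Zeroth-order bounds -/

variable (X : NullSolution)

theorem exists_r_le : ∃ C, 0 < C ∧ ∀ p ∈ X.D, X.r p ≤ C := by
  obtain ⟨M, hM, h⟩ := X.dom.exists_bound X.cont_r
  refine ⟨M, hM, fun p hp => ?_⟩
  have := X.dom.le_of_cone (c := -M) X.r_v.neg
    (fun q hq => by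
      have h1 := X.Q_pos q hq
      have h2 := X.r_pos q hq
      simp only [neg_neg]
      positivity)
    (fun q hq hq' => by linarith [(abs_le.1 (h q hq (Or.inr hq'))).2]) p hp
  linarith

/-- The quotient `Q / (r w)` is `-Ω⁻² ∂_v r`, nondecreasing in `v` by Raychaudhuri. Its positive
lower bound on the cone `v = v₀` therefore propagates, and it reads as an upper bound on `w`. -/
theorem exists_w_le : ∃ C, 0 < C ∧ ∀ p ∈ X.D, X.w p ≤ C * (X.Q p / X.r p) := by
  have hrw : ∀ p ∈ X.D, X.r p * X.w p ≠ 0 := fun p hp =>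
    mul_ne_zero (X.r_pos p hp).ne' (X.w_pos p hp).ne'
  obtain ⟨c, hc, h⟩ := X.dom.exists_pos_le
    (X.cont_Q.div (X.cont_r.mul X.cont_w) hrw)
    (fun p hp => div_pos (X.Q_pos p hp) (mul_pos (X.r_pos p hp) (X.w_pos p hp)))
  have hd := (X.Q_v.div (X.r_v.mul X.w_v) hrw).congr_deriv
    (g' := fun p => X.Q p ^ 2 * X.B p ^ 2 / (X.r p ^ 3 * X.w p)) (by
      intro p hp
      have h1 := (X.r_pos p hp).ne'
      have h2 := (X.w_pos p hp).ne'
      rw [X.ray_v p hp]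
      field_simp
      ring)
  refine ⟨c⁻¹, inv_pos.2 hc, fun p hp => ?_⟩
  have h1 := X.r_pos p hp
  have h2 := X.w_pos p hp
  have key := X.dom.le_of_cone hd (fun q hq => by
    have h1 := X.r_pos q hq
    have h2 := X.w_pos q hq
    positivity) (fun q hq hq' => h q hq (Or.inr hq')) p hp
  rw [le_div_iff₀ (by positivity)] at key
  rw [inv_mul_eq_div, le_div_iff₀ hc, le_div_iff₀ h1]
  linarith

/-- Since `P` increases in `v` at rate `w / 4`, its initial lower bound persists. Its growth is paid
for by the decrease of `r`: with `w ≤ K Q / r` and `∂_v r = -Q / r`, the sum `P + (K/4) r` is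
nonincreasing in `v`. -/
theorem exists_P_bounds : ∃ c C, 0 < c ∧ 0 < C ∧ ∀ p ∈ X.D, c ≤ X.P p ∧ X.P p ≤ C := by
  obtain ⟨c, hc, h⟩ := X.dom.exists_pos_le X.cont_P X.P_pos
  obtain ⟨K, hK, hw⟩ := X.exists_w_le
  obtain ⟨M, hM, h'⟩ := X.dom.exists_bound (X.cont_P.add (X.cont_r.const_smul (K / 4)))
  refine ⟨c, M, hc, hM, fun p hp => ⟨?_, ?_⟩⟩
  · exact X.dom.le_of_cone X.P_v (fun q hq => by linarith [X.w_pos q hq])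
      (fun q hq hq' => h q hq (Or.inr hq')) p hp
  · have := X.dom.le_of_cone (c := -M) ((X.P_v.add (X.r_v.const_mul (K / 4))).neg)
      (fun q hq => by linarith [hw q hq])
      (fun q hq hq' => by
        have := (abs_le.1 (h' q hq (Or.inr hq'))).2
        simp only [Pi.add_apply, Pi.smul_apply, smul_eq_mul] at this
        linarith) p hp
    have h3 : 0 ≤ K / 4 * X.r p := mul_nonneg (by positivity) (X.r_pos p hp).le
    linarith

/-- The equations pull `A` towards `B` and `B` towards `A`, with an extra damping term proportional
to `w`. Where `|A|` is the larger of the two, `A * ∂_v A < 0`, and symmetrically for `B`, so neither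
can exceed the initial maximum. -/
theorem exists_scalar_bound :
    ∃ C, 0 < C ∧ ∀ p ∈ X.D, |X.A p| ≤ C ∧ |X.B p| ≤ C := by
  obtain ⟨M, hM, h⟩ := X.dom.exists_bound X.cont_A
  obtain ⟨N, hN, h'⟩ := X.dom.exists_bound X.cont_B
  refine ⟨max M N, by positivity, X.dom.abs_max_principle X.A_v X.B_u X.cont_A X.cont_B
    (fun p hp hp' => ⟨(h p hp hp').trans (le_max_left _ _), (h' p hp hp').trans (le_max_right _ _)⟩)
    ?_ ?_ (by positivity)⟩
  · intro p hp h1 h2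
    have hA : 0 < |X.A p| := (hM.trans_le (le_max_left _ _)).trans h1
    have hA2 : 0 < X.A p ^ 2 := by rw [← sq_abs]; positivity
    have h3 := X.r_pos p hp
    have h4 := X.w_pos p hp
    have h5 := X.P_pos p hp
    have h6 := X.Q_pos p hp
    have h7 : X.A p * X.B p ≤ X.A p ^ 2 := by
      calc X.A p * X.B p ≤ |X.A p| * |X.B p| := by rw [← abs_mul]; exact le_abs_self _
        _ ≤ |X.A p| * |X.A p| := by gcongr
        _ = _ := by rw [← sq, sq_abs]
    have h8 : X.Q p / X.r p ^ 2 * (X.A p * X.B p - X.A p ^ 2) ≤ 0 :=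
      mul_nonpos_of_nonneg_of_nonpos (by positivity) (by linarith)
    have h9 : 0 < X.w p / (4 * X.P p) * X.A p ^ 2 := by positivity
    linarith
  · intro p hp h1 h2
    have hA : 0 < |X.B p| := (hM.trans_le (le_max_left _ _)).trans h1
    have hA2 : 0 < X.B p ^ 2 := by rw [← sq_abs]; positivity
    have h3 := X.r_pos p hp
    have h4 := X.w_pos p hp
    have h5 := X.P_pos p hp
    have h6 := X.Q_pos p hp
    have h7 : X.B p * X.A p ≤ X.B p ^ 2 := by
      calc X.B p * X.A p ≤ |X.B p| * |X.A p| := by rw [← abs_mul]; exact le_abs_self _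
        _ ≤ |X.B p| * |X.B p| := by gcongr
        _ = _ := by rw [← sq, sq_abs]
    have h8 : X.P p / X.r p ^ 2 * (X.B p * X.A p - X.B p ^ 2) ≤ 0 :=
      mul_nonpos_of_nonneg_of_nonpos (by positivity) (by linarith)
    have h9 : 0 < X.w p / (4 * X.Q p) * X.B p ^ 2 := by positivity
    linarith

/-- Zeroth-order bounds. -/
structure Bounds (c C : ℝ) : Prop where
  c_pos : 0 < c
  C_pos : 0 < C
  r_le : ∀ p ∈ X.D, X.r p ≤ C
  le_P : ∀ p ∈ X.D, c ≤ X.P p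
  P_le : ∀ p ∈ X.D, X.P p ≤ C
  le_Q : ∀ p ∈ X.D, c ≤ X.Q p
  Q_le : ∀ p ∈ X.D, X.Q p ≤ C
  w_le : ∀ p ∈ X.D, X.w p ≤ C / X.r p
  A_le : ∀ p ∈ X.D, |X.A p| ≤ C
  B_le : ∀ p ∈ X.D, |X.B p| ≤ C

variable {X} in
theorem Bounds.swap {c C : ℝ} (h : X.Bounds c C) : X.swap.Bounds c C where
  c_pos := h.c_pos
  C_pos := h.C_pos
  r_le _ hp := h.r_le _ hp
  le_P _ hp := h.le_Q _ hp
  P_le _ hp := h.Q_le _ hp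
  le_Q _ hp := h.le_P _ hp
  Q_le _ hp := h.P_le _ hp
  w_le _ hp := h.w_le _ hp
  A_le _ hp := h.B_le _ hp
  B_le _ hp := h.A_le _ hp

theorem exists_bounds : ∃ c C, X.Bounds c C := by
  obtain ⟨C₁, hC₁, h₁⟩ := X.exists_r_le
  obtain ⟨c₂, C₂, hc₂, hC₂, h₂⟩ := X.exists_P_bounds
  obtain ⟨c₃, C₃, hc₃, hC₃, h₃⟩ := X.swap.exists_P_bounds
  obtain ⟨C₄, hC₄, h₄⟩ := X.exists_w_le
  obtain ⟨C₅, hC₅, h₅⟩ := X.exists_scalar_bound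
  have hQ : ∀ p ∈ X.D, c₃ ≤ X.Q p ∧ X.Q p ≤ C₃ := fun p hp => h₃ p.swap hp
  -- The product `C₄ * C₃` turns `w ≤ C₄ Q / r` into a bound by a constant over `r`; the other
  -- summands serve one field each.
  refine ⟨min c₂ c₃, C₁ + C₂ + C₃ + C₄ * C₃ + C₅, by positivity, by positivity, ?_, ?_, ?_, ?_, ?_,
    ?_, ?_, ?_⟩ <;> intro p hp
  · linarith [h₁ p hp, mul_pos hC₄ hC₃]
  · exact (min_le_left _ _).trans (h₂ p hp).1
  · linarith [h₂ p hp, mul_pos hC₄ hC₃]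
  · exact (min_le_right _ _).trans (hQ p hp).1
  · linarith [hQ p hp, mul_pos hC₄ hC₃]
  · refine (h₄ p hp).trans ?_
    have := X.r_pos p hp
    rw [← mul_div_assoc]
    gcongr
    have : C₄ * X.Q p ≤ C₄ * C₃ := by gcongr; exact (hQ p hp).2
    linarith
  · linarith [h₅ p hp, mul_pos hC₄ hC₃]
  · linarith [h₅ p hp, mul_pos hC₄ hC₃]

/-! ### First derivatives of the lapse and of `P` -/

variable {X} {c C : ℝ}

/-- A quantity whose `v`-derivative is `O(r^{-n-2})` is itself `O(r^{-n})`. -/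
theorem Bounds.transport (hX : X.Bounds c C) {n : ℕ} (hn : 1 ≤ n) {f f' : ℝ × ℝ → ℝ} {K : ℝ}
    (hf : HasV X.D f f') (cf : ContinuousOn f X.D)
    (h : ∀ p ∈ X.D, |f' p| ≤ K / X.r p ^ (n + 2)) :
    ∃ C', 0 < C' ∧ ∀ p ∈ X.D, |f p| ≤ C' / X.r p ^ n := by
  obtain ⟨M, hM, h'⟩ := X.dom.exists_bound (cf.mul (X.cont_r.pow n))
  have hc := hX.c_pos
  refine ⟨M + |K| / c, by positivity, ?_⟩
  -- Because `∂_v r = -Q / r`, the `v`-derivative of `r⁻ⁿ` is `n Q r⁻ⁿ⁻²`, at least `c r⁻ⁿ⁻²` for `n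
  -- ≥ 1`. In the comparison function the part `|K| / c` dominates the derivative and the part `M`
  -- the initial values.
  have hd := (X.r_v.inv_pow (fun p hp => (X.r_pos p hp).ne') n).const_mul (M + |K| / c)
  have := X.dom.abs_le_of_abs_deriv_le hf hd (fun p hp => ?_) (fun p hp hp' => ?_)
  · intro p hp
    rw [div_eq_mul_one_div]
    exact this p hp
  · refine (h p hp).trans ?_
    have hr := X.r_pos p hp
    have hQ := hX.le_Q p hp
    have e : (M + |K| / c) * -(↑n * -(X.Q p / X.r p) / X.r p ^ (n + 1)) =
        ((M + |K| / c) * (n * X.Q p)) / X.r p ^ (n + 2) := by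
      field_simp
      try ring
    rw [e]
    gcongr
    have hn' : (1 : ℝ) ≤ n := by exact_mod_cast hn
    have h1 : c ≤ n * X.Q p := by nlinarith
    calc K ≤ |K| := le_abs_self K
      _ = |K| / c * c := by field_simp
      _ ≤ (M + |K| / c) * (n * X.Q p) := by gcongr; linarith
  · have hr := X.r_pos p hp
    have := h' p hp (Or.inr hp')
    rw [← div_eq_mul_one_div, le_div_iff₀ (by positivity)]
    rw [Pi.mul_apply, Pi.pow_apply, abs_mul, abs_of_pos (pow_pos hr n)] at this
    have : 0 ≤ |K| / c := by positivity
    linarith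

/-- Every term of the `v`-derivative is `O(r⁻⁴)`: `P`, `Q`, `A`, `B` are bounded, and `w r² ≤ C²`
follows from `w ≤ C / r` and `r ≤ C`. Transport with `n = 2` applies. -/
theorem Bounds.exists_Wu_le (hX : X.Bounds c C) :
    ∃ K, 0 < K ∧ ∀ p ∈ X.D, |X.Wu p| ≤ K / X.r p ^ 2 := by
  refine hX.transport (K := C ^ 2 / 2 + 2 * C ^ 2 + 2 * C ^ 4) one_le_two X.Wu_v X.cont_Wu
    fun p hp => ?_
  have hr := X.r_pos p hp
  have hw := X.w_pos p hp
  have hP := X.P_pos p hp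
  have hQ := X.Q_pos p hp
  have hC := hX.C_pos
  have h1 : X.w p / (2 * X.r p ^ 2) ≤ (C ^ 2 / 2) / X.r p ^ 4 := by
    rw [div_le_div_iff₀ (by positivity) (by positivity)]
    have := hX.w_le p hp
    rw [le_div_iff₀ hr] at this
    have h2 : X.w p * X.r p * X.r p ≤ C * C := by gcongr; exact hX.r_le p hp
    have h3 : X.w p * X.r p * X.r p * X.r p ^ 2 ≤ C * C * X.r p ^ 2 := by gcongr
    linarith
  have hPQ : X.P p * X.Q p ≤ C * C := mul_le_mul (hX.P_le p hp) (hX.Q_le p hp) hQ.le hC.le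
  have hAB : |X.A p * X.B p| ≤ C * C := by
    rw [abs_mul]; exact mul_le_mul (hX.A_le p hp) (hX.B_le p hp) (abs_nonneg _) hC.le
  have h2 : |2 * (X.P p * X.Q p) / X.r p ^ 4| ≤ 2 * C ^ 2 / X.r p ^ 4 := by
    rw [abs_of_pos (by positivity)]
    gcongr
    linarith
  have h3 : |2 * (X.P p * X.A p) * (X.Q p * X.B p) / X.r p ^ 4| ≤ 2 * C ^ 4 / X.r p ^ 4 := by
    rw [abs_div, abs_of_pos (pow_pos hr 4)]
    gcongr
    rw [show 2 * (X.P p * X.A p) * (X.Q p * X.B p)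
      = 2 * ((X.P p * X.Q p) * (X.A p * X.B p)) by ring, abs_mul, abs_mul, abs_two,
      abs_of_pos (mul_pos hP hQ)]
    calc 2 * (X.P p * X.Q p * |X.A p * X.B p|) ≤ 2 * ((C * C) * (C * C)) := by gcongr
      _ = _ := by ring
  calc _ ≤ |X.w p / (2 * X.r p ^ 2)| + |2 * (X.P p * X.Q p) / X.r p ^ 4|
        + |2 * (X.P p * X.A p) * (X.Q p * X.B p) / X.r p ^ 4| :=
        (abs_sub _ _).trans (by gcongr; exact abs_add_le _ _)
    _ ≤ (C ^ 2 / 2) / X.r p ^ 4 + 2 * C ^ 2 / X.r p ^ 4 + 2 * C ^ 4 / X.r p ^ 4 := by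
        gcongr
        rwa [abs_of_pos (by positivity)]
    _ = _ := by ring

/-- The source `w Wu / 4` is `O(r⁻¹) O(r⁻²)`, so transport with `n = 1` applies. -/
theorem Bounds.exists_Pu_le (hX : X.Bounds c C) :
    ∃ K, 0 < K ∧ ∀ p ∈ X.D, |X.Pu p| ≤ K / X.r p := by
  obtain ⟨K, hK, h⟩ := hX.exists_Wu_le
  have := hX.transport (n := 1) (K := C * K / 4) le_rfl X.Pu_v X.cont_Pu fun p hp => ?_
  · simpa using this
  · have hr := X.r_pos p hp
    have hw := X.w_pos p hp
    have hC := hX.C_pos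
    rw [abs_div, abs_mul, abs_of_pos hw, abs_of_pos (by norm_num : (0 : ℝ) < 4)]
    calc X.w p * |X.Wu p| / 4 ≤ (C / X.r p) * (K / X.r p ^ 2) / 4 := by
          gcongr
          · exact hX.w_le p hp
          · exact h p hp
      _ = _ := by field_simp

end NullSolution


/-! ### The tangential derivative estimate and the difference `A - B` -/

namespace NullSolution

variable (X : NullSolution)

/-- Up to terms of order one, `r` times the derivative of `r² ∂_u φ / P` along the null-frame
vector field `P⁻¹ ∂_u - Q⁻¹ ∂_v`, which is tangent to the level sets of `r`. -/
noncomputable def twist (p : ℝ × ℝ) : ℝ := X.r p * X.Au p / X.P p + (X.A p - X.B p) / X.r p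

/-- The analogue of `twist` with the null directions exchanged. -/
noncomputable def cotwist (p : ℝ × ℝ) : ℝ := X.r p * X.Bv p / X.Q p + (X.B p - X.A p) / X.r p

/-- The lower-order term in the transport equation of `twist`. -/
noncomputable def twistErr (p : ℝ × ℝ) : ℝ :=
  X.r p * X.w p / (2 * X.P p) * (-(X.A p / X.r p ^ 2) - X.Wu p * X.A p / (2 * X.P p)
    + X.A p * X.Pu p / (2 * X.P p ^ 2) + (X.A p - X.B p) / X.r p ^ 2)

/-- The analogue of `twistErr` with the null directions exchanged. -/
noncomputable def cotwistErr (p : ℝ × ℝ) : ℝ :=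
  X.r p * X.w p / (2 * X.Q p) * (-(X.B p / X.r p ^ 2) - X.Wv p * X.B p / (2 * X.Q p)
    + X.B p * X.Qv p / (2 * X.Q p ^ 2) + (X.B p - X.A p) / X.r p ^ 2)

/-- After substitution of the equations, the terms with coefficient `Q / r²` close up in `twist` and
`cotwist`; everything else carries a factor `w`, which is less singular. -/
theorem twist_v : HasV X.D X.twist fun p =>
    -(X.Q p / X.r p ^ 2 * (X.cotwist p + 2 * X.twist p)) - X.w p / (2 * X.P p) * X.twist p
      + X.twistErr p := by
  have hP : ∀ p ∈ X.D, X.P p ≠ 0 := fun p hp => (X.P_pos p hp).ne'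
  have hr : ∀ p ∈ X.D, X.r p ≠ 0 := fun p hp => (X.r_pos p hp).ne'
  refine (((X.r_v.mul X.Au_v).div X.P_v hP).add
    ((X.A_v.sub X.B_v).div X.r_v hr)).congr_deriv fun p hp => ?_
  have h1 := hP p hp
  have h2 := hr p hp
  have h3 := (X.Q_pos p hp).ne'
  simp only [twist, cotwist, twistErr]
  field_simp
  ring

theorem cotwist_u : HasU X.D X.cotwist fun p =>
    -(X.P p / X.r p ^ 2 * (X.twist p + 2 * X.cotwist p)) - X.w p / (2 * X.Q p) * X.cotwist p
      + X.cotwistErr p := X.swap.twist_v.swap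

theorem continuousOn_twist : ContinuousOn X.twist X.D :=
  ((X.cont_r.mul X.cont_Au).div X.cont_P fun p hp => (X.P_pos p hp).ne').add
    ((X.cont_A.sub X.cont_B).div X.cont_r fun p hp => (X.r_pos p hp).ne')

theorem continuousOn_cotwist : ContinuousOn X.cotwist X.D :=
  ((X.cont_r.mul X.cont_Bv).div X.cont_Q fun p hp => (X.Q_pos p hp).ne').add
    ((X.cont_B.sub X.cont_A).div X.cont_r fun p hp => (X.r_pos p hp).ne')

variable {X} {c C : ℝ}

theorem Bounds.r_mul_w_le (hX : X.Bounds c C) {p : ℝ × ℝ} (hp : p ∈ X.D) :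
    X.r p * X.w p / (2 * X.P p) ≤ C / (2 * c) := by
  have hr := X.r_pos p hp
  have hP := X.P_pos p hp
  have hc := hX.c_pos
  have hC := hX.C_pos
  have h1 := hX.w_le p hp
  rw [le_div_iff₀ hr] at h1
  have := hX.le_P p hp
  gcongr
  linarith

/-- The prefactor `r w / (2 P)` is bounded, and each term of the bracket is `O(r⁻²)` by the bounds
on `Wu`, `Pu`, `A` and `B`. -/
theorem Bounds.exists_twistErr_le (hX : X.Bounds c C) :
    ∃ K, 0 < K ∧ ∀ p ∈ X.D, |X.twistErr p| ≤ K / X.r p ^ 2 := by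
  obtain ⟨K₁, hK₁, h₁⟩ := hX.exists_Wu_le
  obtain ⟨K₂, hK₂, h₂⟩ := hX.exists_Pu_le
  have hc := hX.c_pos
  have hC := hX.C_pos
  refine ⟨C / (2 * c) * (C + K₁ * C / (2 * c) + C * (K₂ * C) / (2 * c ^ 2) + 2 * C),
    by positivity, fun p hp => ?_⟩
  have hr := X.r_pos p hp
  have hP := X.P_pos p hp
  have hw := X.w_pos p hp
  have hA := hX.A_le p hp
  have hB := hX.B_le p hp
  have hcP := hX.le_P p hp
  rw [twistErr, abs_mul, mul_div_assoc (C / (2 * c))]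
  have hfac : |X.r p * X.w p / (2 * X.P p)| ≤ C / (2 * c) := by
    rw [abs_of_pos (by positivity)]
    exact hX.r_mul_w_le hp
  have e1 : |X.A p / X.r p ^ 2| ≤ C / X.r p ^ 2 := by
    rw [abs_div, abs_of_pos (pow_pos hr 2)]
    gcongr
  have e2 : |X.Wu p * X.A p / (2 * X.P p)| ≤ (K₁ * C / (2 * c)) / X.r p ^ 2 := by
    rw [abs_div, abs_mul, abs_of_pos (by positivity : 0 < 2 * X.P p)]
    calc |X.Wu p| * |X.A p| / (2 * X.P p) ≤ (K₁ / X.r p ^ 2) * C / (2 * c) := by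
          gcongr
          exact h₁ p hp
      _ = _ := by ring
  have e3 : |X.A p * X.Pu p / (2 * X.P p ^ 2)| ≤ (C * (K₂ * C) / (2 * c ^ 2)) / X.r p ^ 2 := by
    rw [abs_div, abs_mul, abs_of_pos (by positivity : 0 < 2 * X.P p ^ 2)]
    have : |X.Pu p| ≤ K₂ * C / X.r p ^ 2 := by
      refine (h₂ p hp).trans ?_
      rw [div_le_div_iff₀ hr (by positivity)]
      have := hX.r_le p hp
      calc K₂ * X.r p ^ 2 = K₂ * X.r p * X.r p := by ring
        _ ≤ K₂ * C * X.r p := by gcongr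
    calc |X.A p| * |X.Pu p| / (2 * X.P p ^ 2) ≤ C * (K₂ * C / X.r p ^ 2) / (2 * c ^ 2) := by
          gcongr
      _ = _ := by ring
  have e4 : |(X.A p - X.B p) / X.r p ^ 2| ≤ 2 * C / X.r p ^ 2 := by
    rw [abs_div, abs_of_pos (pow_pos hr 2)]
    gcongr
    linarith [abs_sub (X.A p) (X.B p)]
  refine mul_le_mul hfac ?_ (abs_nonneg _) (by positivity)
  rw [add_div, add_div, add_div]
  refine (abs_add_le _ _).trans (add_le_add ((abs_add_le _ _).trans (add_le_add
    ((abs_sub _ _).trans (add_le_add ?_ e2)) e3)) e4)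
  rwa [abs_neg]

/-- The diagonal coefficient 2 exceeds the coupling coefficient 1: when `|g| ≤ |f|`, at least `q f²`
of damping survives, enough to absorb an error smaller than `q |f|`. -/
theorem mul_transport_neg {q ε f g k x : ℝ} (hq : 0 < q) (hk : 0 ≤ k) (hgf : |g| ≤ |f|)
    (hε : |ε| ≤ x) (hx : x < q * |f|) (hf : 0 < |f|) :
    f * (-(q * (g + 2 * f)) - k * f + ε) < 0 := by
  have h1 : -(f * g) ≤ |f| * |f| := by
    calc -(f * g) ≤ |f * g| := neg_le_abs _
      _ = |f| * |g| := abs_mul _ _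
      _ ≤ _ := by gcongr
  have h2 : f * ε ≤ |f| * x := by
    calc f * ε ≤ |f * ε| := le_abs_self _
      _ = |f| * |ε| := abs_mul _ _
      _ ≤ _ := by gcongr
  have h3 : |f| * x < |f| * (q * |f|) := by gcongr
  have h4 : |f| * |f| = f * f := abs_mul_abs_self f
  have h5 : 0 ≤ k * (f * f) := mul_nonneg hk (mul_self_nonneg f)
  nlinarith

/-- Damping and error are both of order `r⁻²`. Where the larger of the two quantities exceeds the
corresponding error constant over `c`, damping wins, so the maximum principle yields a bound uniform
up to `r = 0`. -/
theorem Bounds.exists_twist_le (hX : X.Bounds c C) :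
    ∃ K, 0 < K ∧ ∀ p ∈ X.D, |X.twist p| ≤ K ∧ |X.cotwist p| ≤ K := by
  obtain ⟨K₁, hK₁, h₁⟩ := hX.exists_twistErr_le
  obtain ⟨K₂, hK₂, h₂'⟩ := hX.swap.exists_twistErr_le
  have h₂ : ∀ p ∈ X.D, |X.cotwistErr p| ≤ K₂ / X.r p ^ 2 := fun p hp => h₂' p.swap hp
  obtain ⟨M, hM, h₃⟩ := X.dom.exists_bound X.continuousOn_twist
  obtain ⟨N, hN, h₄⟩ := X.dom.exists_bound X.continuousOn_cotwist
  have hc := hX.c_pos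
  have hpos : 0 < M + N + K₁ / c + K₂ / c := by positivity
  have hk1 : 0 < K₁ / c := by positivity
  have hk2 : 0 < K₂ / c := by positivity
  refine ⟨M + N + K₁ / c + K₂ / c, hpos, X.dom.abs_max_principle X.twist_v X.cotwist_u
    X.continuousOn_twist X.continuousOn_cotwist
    (fun p hp hp' => ⟨by linarith [h₃ p hp hp'], by linarith [h₄ p hp hp']⟩) ?_ ?_ hpos.le⟩
  · intro p hp h5 h6
    have hr := X.r_pos p hp
    have hP := X.P_pos p hp
    have hQ := X.Q_pos p hp
    have hw := X.w_pos p hp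
    refine mul_transport_neg (by positivity) (by positivity) h6 (h₁ p hp) ?_ (hpos.trans h5)
    rw [div_mul_eq_mul_div]
    gcongr
    have h7 : K₁ / c < |X.twist p| := by linarith
    rw [div_lt_iff₀ hc] at h7
    have := mul_le_mul_of_nonneg_left (hX.le_Q p hp) (abs_nonneg (X.twist p))
    linarith
  · intro p hp h5 h6
    have hr := X.r_pos p hp
    have hP := X.P_pos p hp
    have hQ := X.Q_pos p hp
    have hw := X.w_pos p hp
    refine mul_transport_neg (by positivity) (by positivity) h6 (h₂ p hp) ?_ (hpos.trans h5)
    rw [div_mul_eq_mul_div]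
    gcongr
    have h7 : K₂ / c < |X.cotwist p| := by linarith
    rw [div_lt_iff₀ hc] at h7
    have := mul_le_mul_of_nonneg_left (hX.le_P p hp) (abs_nonneg (X.cotwist p))
    linarith

/-- The weight `r⁻²` is chosen so that the `v`-derivative of `(A - B) / r²` is `-Q cotwist / r³`
plus a term proportional to `w`. It is thus `O(r⁻³)`, and transport with `n = 1` gives `(A - B) / r²
= O(1/r)`. -/
theorem Bounds.exists_sub_le (hX : X.Bounds c C) :
    ∃ K, 0 < K ∧ ∀ p ∈ X.D, |X.A p - X.B p| ≤ K * X.r p := by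
  obtain ⟨K, hK, h⟩ := hX.exists_twist_le
  have hc := hX.c_pos
  have hC := hX.C_pos
  have hr : ∀ p ∈ X.D, X.r p ^ 2 ≠ 0 := fun p hp => (pow_pos (X.r_pos p hp) 2).ne'
  have hd := ((X.A_v.sub X.B_v).div (X.r_v.pow 2) hr).congr_deriv
    (g' := fun p => -(X.Q p * X.cotwist p / X.r p ^ 3)
      - X.w p * X.A p / (4 * X.P p * X.r p ^ 2)) (by
      intro p hp
      have h1 := (X.P_pos p hp).ne'
      have h2 := (X.r_pos p hp).ne'
      have h3 := (X.Q_pos p hp).ne'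
      simp only [cotwist]
      field_simp
      ring)
  obtain ⟨K', hK', h'⟩ := hX.transport (n := 1) (K := C * K + C * C / (4 * c)) le_rfl hd
    ((X.cont_A.sub X.cont_B).div (X.cont_r.pow 2) hr) (fun p hp => by
      have h1 := X.P_pos p hp
      have h2 := X.r_pos p hp
      have h3 := X.Q_pos p hp
      have hw := X.w_pos p hp
      have hcP := hX.le_P p hp
      refine (abs_sub _ _).trans ?_
      rw [add_div]
      refine add_le_add ?_ ?_
      · rw [abs_neg, abs_div, abs_mul, abs_of_pos h3, abs_of_pos (pow_pos h2 3)]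
        gcongr
        · exact hX.Q_le p hp
        · exact (h p hp).2
      · rw [abs_div, abs_mul, abs_of_pos hw,
          abs_of_pos (by positivity : 0 < 4 * X.P p * X.r p ^ 2)]
        calc X.w p * |X.A p| / (4 * X.P p * X.r p ^ 2)
            ≤ (C / X.r p) * C / (4 * c * X.r p ^ 2) := by
              gcongr
              · exact hX.w_le p hp
              · exact hX.A_le p hp
          _ = _ := by field_simp)
  refine ⟨K', hK', fun p hp => ?_⟩
  have h2 := X.r_pos p hp
  have := h' p hp
  rw [abs_div, abs_of_pos (pow_pos h2 2), pow_one, div_le_div_iff₀ (by positivity) h2] at this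
  nlinarith

/-- The definition of `twist` is solved for `Au`, now that both `twist` and `(A - B) / r` are
bounded. -/
theorem Bounds.exists_Au_le (hX : X.Bounds c C) :
    ∃ K, 0 < K ∧ ∀ p ∈ X.D, |X.Au p| ≤ K / X.r p := by
  obtain ⟨K₁, hK₁, h₁⟩ := hX.exists_twist_le
  obtain ⟨K₂, hK₂, h₂⟩ := hX.exists_sub_le
  have hC := hX.C_pos
  refine ⟨C * (K₁ + K₂), by positivity, fun p hp => ?_⟩
  have hr := X.r_pos p hp
  have hP := X.P_pos p hp
  have e : X.Au p = X.P p * (X.twist p - (X.A p - X.B p) / X.r p) / X.r p := by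
    simp only [twist]; field_simp; ring
  rw [e, abs_div, abs_mul, abs_of_pos hr, abs_of_pos hP]
  gcongr
  · exact hX.P_le p hp
  · refine (abs_sub _ _).trans (add_le_add (h₁ p hp).1 ?_)
    rw [abs_div, abs_of_pos hr, div_le_iff₀ hr]
    exact h₂ p hp

/-- One power of `r` gained in `A - B` compensates one of the two in the relaxation rate `Q / r²`.
-/
theorem Bounds.exists_Av_le (hX : X.Bounds c C) :
    ∃ K, 0 < K ∧ ∀ p ∈ X.D,
      |X.Q p / X.r p ^ 2 * (X.B p - X.A p) - X.w p / (4 * X.P p) * X.A p| ≤ K / X.r p := by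
  obtain ⟨K, hK, h⟩ := hX.exists_sub_le
  have hC := hX.C_pos
  have hc := hX.c_pos
  refine ⟨C * K + C / (4 * c) * C, by positivity, fun p hp => ?_⟩
  have hr := X.r_pos p hp
  have hP := X.P_pos p hp
  have hQ := X.Q_pos p hp
  have hw := X.w_pos p hp
  have hcP := hX.le_P p hp
  refine (abs_sub _ _).trans ?_
  rw [add_div, abs_mul, abs_mul, abs_of_pos (by positivity : 0 < X.Q p / X.r p ^ 2),
    abs_of_pos (by positivity : 0 < X.w p / (4 * X.P p)), abs_sub_comm]
  refine add_le_add ?_ ?_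
  · calc X.Q p / X.r p ^ 2 * |X.A p - X.B p| ≤ C / X.r p ^ 2 * (K * X.r p) := by
          gcongr
          · exact hX.Q_le p hp
          · exact h p hp
      _ = _ := by field_simp
  · calc X.w p / (4 * X.P p) * |X.A p| ≤ (C / X.r p) / (4 * c) * C := by
          gcongr
          · exact hX.w_le p hp
          · exact hX.A_le p hp
      _ = _ := by ring

end NullSolution


/-! ### Moduli of continuity expressed through `r` -/

/-- A concave-type modulus: monotone on `[0, R]`, subadditive and continuous at `0`. -/
structure Gauge (h : ℝ → ℝ) (R : ℝ) : Prop where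
  zero : h 0 = 0
  mono : MonotoneOn h (Icc 0 R)
  sub_le : ∀ a b, 0 ≤ b → b ≤ a → h a - h b ≤ h (a - b)
  cont : Continuous h

theorem Gauge.id (R : ℝ) : Gauge (fun x => x) R where
  zero := rfl
  mono := monotone_id.monotoneOn _
  sub_le _ _ _ _ := le_rfl
  cont := continuous_id

/-- The modulus `x (2 + log (R / x))`. -/
noncomputable def logGauge (R x : ℝ) : ℝ := x * (2 + Real.log R - Real.log x)

theorem hasDerivAt_logGauge (R : ℝ) {x : ℝ} (hx : x ≠ 0) :
    HasDerivAt (logGauge R) (1 + Real.log R - Real.log x) x := by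
  have := (hasDerivAt_id x).mul ((Real.hasDerivAt_log hx).const_sub (2 + Real.log R))
  refine this.congr_deriv ?_
  simp only [id]
  field_simp
  ring

theorem continuous_logGauge (R : ℝ) : Continuous (logGauge R) := by
  have : logGauge R = fun x => x * (2 + Real.log R) - x * Real.log x := by
    ext x; simp only [logGauge]; ring
  rw [this]
  exact (continuous_id.mul continuous_const).sub Real.continuous_mul_log

theorem Gauge.log {R : ℝ} : Gauge (logGauge R) R where
  zero := by simp [logGauge]
  mono := by
    refine monotoneOn_of_hasDerivWithinAt_nonneg (convex_Icc 0 R)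
      (f' := fun x => 1 + Real.log R - Real.log x) (continuous_logGauge R).continuousOn ?_ ?_
    · intro x hx
      rw [interior_Icc] at hx
      exact (hasDerivAt_logGauge R hx.1.ne').hasDerivWithinAt
    · intro x hx
      rw [interior_Icc] at hx
      have := Real.log_le_log hx.1 hx.2.le
      linarith
  sub_le a b hb hab := by
    rcases hb.eq_or_lt with rfl | hb
    · simp [logGauge]
    rcases hab.eq_or_lt with rfl | hab
    · simp [logGauge]
    -- The linear terms agree on both sides; what is left is `b log b + (a - b) log (a - b) ≤ a log
    -- a`, which follows from monotonicity of the logarithm.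
    have h1 : Real.log b ≤ Real.log a := Real.log_le_log hb hab.le
    have h2 : Real.log (a - b) ≤ Real.log a := Real.log_le_log (by linarith) (by linarith)
    have h3 := mul_le_mul_of_nonneg_left h1 hb.le
    have h4 := mul_le_mul_of_nonneg_left h2 (sub_pos.2 hab).le
    simp only [logGauge]
    nlinarith
  cont := continuous_logGauge R

theorem Gauge.nonneg {h : ℝ → ℝ} {R x : ℝ} (hh : Gauge h R) (hx : 0 ≤ x) (hxR : x ≤ R) :
    0 ≤ h x := by
  rw [← hh.zero]
  exact hh.mono ⟨le_rfl, hx.trans hxR⟩ ⟨hx, hxR⟩ hx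

/-! ### Oscillation along causal curves and Hölder regularity -/

namespace NullSolution

variable {X : NullSolution} {c C : ℝ}

theorem r_anti_v {u v v' : ℝ} (hm : (u, v') ∈ X.D) (h1 : X.v₀ ≤ v) (h2 : v ≤ v') :
    X.r (u, v') ≤ X.r (u, v) := by
  have := X.dom.mono_v X.r_v.neg (fun p hp => by
    have := X.r_pos p hp
    have := X.Q_pos p hp
    simp only [neg_neg]
    positivity) h1 h2 hm
  linarith

/-- The `v`-derivative of `r²` is `-2 Q`, which lies between `-2 C` and `-2 c`. This is the origin
of the exponent `1/2`. -/
theorem Bounds.sq_sub_sq_le (hX : X.Bounds c C) {u v v' : ℝ} (hm : (u, v') ∈ X.D)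
    (h1 : X.v₀ ≤ v) (h2 : v ≤ v') :
    X.r (u, v) ^ 2 - X.r (u, v') ^ 2 ≤ 2 * C * (v' - v) ∧
      2 * c * (v' - v) ≤ X.r (u, v) ^ 2 - X.r (u, v') ^ 2 := by
  have hid : HasV X.D (fun p => p.2) fun _ => 1 := fun p _ => hasDerivWithinAt_id _ _
  have hsq : HasV X.D (fun p => X.r p ^ 2) fun p => -(2 * X.Q p) :=
    (X.r_v.pow 2).congr_deriv fun p hp => by
      have := (X.r_pos p hp).ne'
      field_simp
      norm_num
      ring
  have k1 := X.dom.mono_v (hsq.add (hid.const_mul (2 * C)))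
    (fun p hp => by linarith [hX.Q_le p hp]) h1 h2 hm
  have k2 := X.dom.mono_v (hsq.add (hid.const_mul (2 * c))).neg
    (fun p hp => by linarith [hX.le_Q p hp]) h1 h2 hm
  constructor <;> linarith

/-- For `0 ≤ y ≤ x` one has `(x - y)² ≤ x² - y²`. -/
theorem Bounds.sub_le_sqrt (hX : X.Bounds c C) {u v v' : ℝ} (hm : (u, v') ∈ X.D)
    (h1 : X.v₀ ≤ v) (h2 : v ≤ v') :
    X.r (u, v) - X.r (u, v') ≤ √(2 * C * (v' - v)) := by
  have h3 := r_anti_v hm h1 h2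
  have h4 := X.r_pos _ hm
  refine Real.le_sqrt_of_sq_le (le_trans ?_ (hX.sq_sub_sq_le hm h1 h2).1)
  nlinarith

/-- A slice has length at most `C² / (2 c)`, since `r² ≤ C²` drops at rate at least `2 c` and stays
positive. This keeps the arguments of a gauge in the interval where it is monotone. -/
theorem Bounds.sqrt_le (hX : X.Bounds c C) {u v v' : ℝ} (hm : (u, v') ∈ X.D)
    (h1 : X.v₀ ≤ v) (h2 : v ≤ v') :
    √(2 * C * (v' - v)) ≤ √(C ^ 3 / c) := by
  have hc := hX.c_pos
  have hC := hX.C_pos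
  have h3 := (hX.sq_sub_sq_le hm h1 h2).2
  have h4 := X.r_pos _ hm
  have h6 := X.dom.mk_mem_of_le hm h1 h2
  have h5 := X.r_pos _ h6
  have h7 : X.r (u, v) ^ 2 ≤ C ^ 2 := by gcongr; exact hX.r_le _ h6
  refine Real.sqrt_le_sqrt ?_
  rw [le_div_iff₀ hc]
  have : 2 * c * (v' - v) ≤ C ^ 2 := by nlinarith
  calc 2 * C * (v' - v) * c = C * (2 * c * (v' - v)) := by ring
    _ ≤ C * C ^ 2 := by gcongr
    _ = C ^ 3 := by ring

/-- The oscillation of `f` along future-directed causal curves is controlled by that of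
`h ∘ r`. -/
def Controlled (X : NullSolution) (h : ℝ → ℝ) (f : ℝ × ℝ → ℝ) : Prop :=
  ∃ K, 0 < K ∧ ∀ q ∈ X.D, ∀ q' ∈ X.D, q.1 ≤ q'.1 → q.2 ≤ q'.2 →
    |f q - f q'| ≤ K * (h (X.r q) - h (X.r q'))

theorem Controlled.swap {h : ℝ → ℝ} {f : ℝ × ℝ → ℝ} (H : X.Controlled h f) :
    X.swap.Controlled h (f ∘ Prod.swap) := by
  obtain ⟨K, hK, H⟩ := H
  exact ⟨K, hK, fun q hq q' hq' h1 h2 => H _ hq _ hq' h2 h1⟩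

/-- By `∂_v r = -Q / r`, the function `h ∘ r` decreases at rate `k(r) Q / r ≥ c k(r) / r`. Hence
`(|K| / c) h ∘ r` outpaces `f`, and subtracting it from `±f` leaves functions nondecreasing in `v`.
-/
theorem Bounds.osc_v (hX : X.Bounds c C) {h k : ℝ → ℝ} {f f' : ℝ × ℝ → ℝ} {K : ℝ}
    (hh : ∀ x, 0 < x → HasDerivAt h (k x) x) (hf : HasV X.D f f')
    (hK : ∀ p ∈ X.D, |f' p| ≤ K * k (X.r p) / X.r p) (hk : ∀ p ∈ X.D, 0 ≤ k (X.r p))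
    {u v v' : ℝ} (hm : (u, v') ∈ X.D) (h1 : X.v₀ ≤ v) (h2 : v ≤ v') :
    |f (u, v) - f (u, v')| ≤ |K| / c * (h (X.r (u, v)) - h (X.r (u, v'))) := by
  have hd : HasV X.D (fun p => -(|K| / c) * h (X.r p))
      (fun p => |K| / c * (k (X.r p) * X.Q p / X.r p)) := fun p hp =>
    (((hh _ (X.r_pos p hp)).comp_hasDerivWithinAt p.2 (X.r_v p hp)).const_mul (-(|K| / c))).congr_deriv
      (by ring)
  have hle : ∀ p ∈ X.D, |f' p| ≤ |K| / c * (k (X.r p) * X.Q p / X.r p) := fun p hp => by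
    have hr := X.r_pos p hp
    have hc := hX.c_pos
    refine (hK p hp).trans ?_
    rw [← mul_div_assoc]
    refine div_le_div_of_nonneg_right ?_ hr.le
    calc K * k (X.r p) ≤ |K| * k (X.r p) := by
          gcongr
          · exact hk p hp
          · exact le_abs_self K
      _ = |K| / c * (k (X.r p) * c) := by field_simp
      _ ≤ _ := by
        gcongr
        · exact hk p hp
        · exact hX.le_Q p hp
  have k1 := X.dom.mono_v (hd.add hf) (fun p hp => by
    linarith [(abs_le.1 (hle p hp)).1]) h1 h2 hm
  have k2 := X.dom.mono_v (hd.sub hf) (fun p hp => by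
    linarith [(abs_le.1 (hle p hp)).2]) h1 h2 hm
  rw [abs_le]
  constructor <;> linarith

theorem Bounds.controlled (hX : X.Bounds c C) {h k : ℝ → ℝ} {f fu fv : ℝ × ℝ → ℝ} {K L : ℝ}
    (hh : ∀ x, 0 < x → HasDerivAt h (k x) x) (hfu : HasU X.D f fu) (hfv : HasV X.D f fv)
    (hu : ∀ p ∈ X.D, |fu p| ≤ K * k (X.r p) / X.r p)
    (hv : ∀ p ∈ X.D, |fv p| ≤ L * k (X.r p) / X.r p)
    (hk : ∀ p ∈ X.D, 0 ≤ k (X.r p)) : X.Controlled h f := by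
  have hc := hX.c_pos
  have hmono : ∀ {u v v'}, (u, v') ∈ X.D → X.v₀ ≤ v → v ≤ v' →
      h (X.r (u, v')) ≤ h (X.r (u, v)) := fun {u v v'} hm h1 h2 => by
    have hd : HasV X.D (fun p => -1 * h (X.r p)) (fun p => k (X.r p) * X.Q p / X.r p) :=
      fun p hp => (((hh _ (X.r_pos p hp)).comp_hasDerivWithinAt p.2
        (X.r_v p hp)).const_mul (-1)).congr_deriv (by ring)
    have := X.dom.mono_v hd (fun p hp => by
      have := X.r_pos p hp
      have := X.Q_pos p hp
      have := hk p hp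
      positivity) h1 h2 hm
    linarith
  have hmono' : ∀ {u u' v}, (u', v) ∈ X.D → X.u₀ ≤ u → u ≤ u' →
      h (X.r (u', v)) ≤ h (X.r (u, v)) := fun {u u' v} hm h1 h2 => by
    have hd : HasU X.D (fun p => -1 * h (X.r p)) (fun p => k (X.r p) * X.P p / X.r p) :=
      fun p hp => (((hh _ (X.r_pos p hp)).comp_hasDerivWithinAt p.1
        (X.r_u p hp)).const_mul (-1)).congr_deriv (by ring)
    have := X.dom.mono_u hd (fun p hp => by
      have := X.r_pos p hp
      have := X.P_pos p hp
      have := hk p hp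
      positivity) h1 h2 hm
    linarith
  refine ⟨|K| / c + |L| / c + 1, by positivity, ?_⟩
  rintro ⟨u, v⟩ hq ⟨u', v'⟩ hq' huu hvv
  have h1 := X.dom.fst_le _ hq
  have h2 := X.dom.snd_le _ hq
  -- The two points are joined through the corner `(u', v)`, which lies in the past of `q'`. As `h ∘
  -- r` is nonincreasing along both legs, the two oscillation bounds add up without loss.
  have hm : (u', v) ∈ X.D := X.dom.mk_mem_of_le hq' h2 hvv
  have k1 := hX.swap.osc_v (u := v) (v := u) (v' := u') hh hfu.swap (fun p hp => hu _ hp)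
    (fun p hp => hk _ hp) hm h1 huu
  have k2 := hX.osc_v hh hfv hv hk hq' h2 hvv
  have k3 := sub_nonneg.2 (hmono hq' h2 hvv)
  have k4 := sub_nonneg.2 (hmono' hm h1 huu)
  have k1' : |f (u, v) - f (u', v)| ≤ |K| / c * (h (X.r (u, v)) - h (X.r (u', v))) := k1
  have h5 : 0 ≤ |K| / c := by positivity
  have h6 : 0 ≤ |L| / c := by positivity
  calc |f (u, v) - f (u', v')| ≤ |f (u, v) - f (u', v)| + |f (u', v) - f (u', v')| :=
        abs_sub_le _ _ _
    _ ≤ |K| / c * (h (X.r (u, v)) - h (X.r (u', v)))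
        + |L| / c * (h (X.r (u', v)) - h (X.r (u', v'))) := add_le_add k1' k2
    _ ≤ (|K| / c + |L| / c + 1) * (h (X.r (u, v)) - h (X.r (u', v)))
        + (|K| / c + |L| / c + 1) * (h (X.r (u', v)) - h (X.r (u', v'))) := by
        gcongr <;> linarith
    _ = _ := by ring

theorem Controlled.exists_abs_le (hX : X.Bounds c C) {h : ℝ → ℝ} {f : ℝ × ℝ → ℝ} {R : ℝ}
    (hh : Gauge h R) (hR : C ≤ R) (H : X.Controlled h f) : ∃ M, ∀ p ∈ X.D, |f p| ≤ M := by
  obtain ⟨K, hK, H⟩ := H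
  refine ⟨|f (X.u₀, X.v₀)| + K * h R, fun p hp => ?_⟩
  have h1 := X.dom.fst_le _ hp
  have h2 := X.dom.snd_le _ hp
  have h0 : (X.u₀, X.v₀) ∈ X.D := X.dom.past _ hp _ le_rfl h1 le_rfl h2
  have h3 := H _ h0 p hp h1 h2
  have h4 := hh.nonneg (X.r_pos p hp).le ((hX.r_le p hp).trans hR)
  have h5 : h (X.r (X.u₀, X.v₀)) ≤ h R := by
    have hr := X.r_pos _ h0
    have hr' := (hX.r_le _ h0).trans hR
    exact hh.mono ⟨hr.le, hr'⟩ ⟨hr.le.trans hr', le_rfl⟩ hr'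
  have h6 : K * (h (X.r (X.u₀, X.v₀)) - h (X.r p)) ≤ K * h R := by gcongr; linarith
  have h7 := abs_sub_abs_le_abs_sub (f p) (f (X.u₀, X.v₀))
  rw [abs_sub_comm] at h7
  linarith

/-- Subadditivity replaces `h(r) - h(r')` by `h(r - r')`, and `r - r'` is at most the square root of
a multiple of the coordinate distance. -/
theorem Controlled.osc_v (hX : X.Bounds c C) {h : ℝ → ℝ} {f : ℝ × ℝ → ℝ} {R K : ℝ}
    (hh : Gauge h R) (hR : √(C ^ 3 / c) ≤ R) (hK : 0 < K)
    (H : ∀ q ∈ X.D, ∀ q' ∈ X.D, q.1 ≤ q'.1 → q.2 ≤ q'.2 →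
      |f q - f q'| ≤ K * (h (X.r q) - h (X.r q')))
    {u v v' : ℝ} (hm : (u, v') ∈ X.D) (h1 : X.v₀ ≤ v) (h2 : v ≤ v') :
    |f (u, v) - f (u, v')| ≤ K * h √(2 * C * (v' - v)) := by
  have hm' := X.dom.mk_mem_of_le hm h1 h2
  refine (H _ hm' _ hm le_rfl h2).trans ?_
  have h3 := r_anti_v hm h1 h2
  have h4 := hX.sub_le_sqrt hm h1 h2
  have h5 := (hX.sqrt_le hm h1 h2).trans hR
  gcongr
  exact (hh.sub_le _ _ (X.r_pos _ hm).le h3).trans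
    (hh.mono ⟨by linarith, by linarith⟩ ⟨by positivity, h5⟩ h4)

theorem Controlled.hasModulus (hX : X.Bounds c C) {h ω : ℝ → ℝ} {f : ℝ × ℝ → ℝ} {R L : ℝ}
    (hh : Gauge h R) (hCR : C ≤ R) (hR : √(C ^ 3 / c) ≤ R) (H : X.Controlled h f)
    (hω : ∀ s, 0 < s → h √(2 * C * s) ≤ L * ω s) (hω0 : ∀ s, 0 < s → 0 ≤ ω s) :
    HasModulus ω X.D f := by
  obtain ⟨M, hM⟩ := H.exists_abs_le hX hh hCR
  have H' := H.swap
  obtain ⟨K, hK, H⟩ := H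
  obtain ⟨K', hK', H'⟩ := H'
  refine ⟨|M| + |K * L| + |K' * L|, fun p hp => ?_, fun u v v' hv hseg => ?_,
    fun u u' v hu hseg => ?_⟩
  · linarith [hM p hp, le_abs_self M, abs_nonneg (K * L), abs_nonneg (K' * L)]
  · have hm := hseg v' (right_mem_Icc.2 hv.le)
    have h1 := X.dom.snd_le _ (hseg v (left_mem_Icc.2 hv.le))
    rw [abs_sub_comm]
    refine (Controlled.osc_v hX hh hR hK H hm h1 hv.le).trans ?_
    have h2 := hω _ (sub_pos.2 hv)
    have h3 := hω0 _ (sub_pos.2 hv)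
    calc K * h √(2 * C * (v' - v)) ≤ K * (L * ω (v' - v)) := by gcongr
      _ = (K * L) * ω (v' - v) := by ring
      _ ≤ _ := by
        gcongr
        linarith [le_abs_self (K * L), abs_nonneg M, abs_nonneg (K' * L)]
  · have hm := hseg u' (right_mem_Icc.2 hu.le)
    have h1 := X.dom.fst_le _ (hseg u (left_mem_Icc.2 hu.le))
    rw [abs_sub_comm]
    refine (Controlled.osc_v hX.swap hh hR hK' H' (u := v) (v := u) (v' := u')
      hm h1 hu.le).trans ?_
    have h2 := hω _ (sub_pos.2 hu)
    have h3 := hω0 _ (sub_pos.2 hu)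
    calc K' * h √(2 * C * (u' - u)) ≤ K' * (L * ω (u' - u)) := by gcongr
      _ = (K' * L) * ω (u' - u) := by ring
      _ ≤ _ := by
        gcongr
        linarith [le_abs_self (K' * L), abs_nonneg M, abs_nonneg (K * L)]

theorem Controlled.uniformContinuousOn (hX : X.Bounds c C) {h : ℝ → ℝ} {f : ℝ × ℝ → ℝ} {R : ℝ}
    (hh : Gauge h R) (hR : √(C ^ 3 / c) ≤ R) (H : X.Controlled h f) :
    UniformContinuousOn f X.D := by
  have H' := H.swap
  obtain ⟨K, hK, H⟩ := H
  obtain ⟨K', hK', H'⟩ := H'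
  rw [Metric.uniformContinuousOn_iff]
  intro ε hε
  have hcont : Continuous fun s => (K + K') * h √(2 * C * s) := by
    have := hh.cont
    fun_prop
  obtain ⟨δ, hδ, hball⟩ := Metric.continuousAt_iff.1 (hcont.continuousAt (x := 0)) (ε / 2)
    (half_pos hε)
  have hsmall : ∀ s, 0 ≤ s → s < δ → (K + K') * h √(2 * C * s) < ε / 2 := fun s hs hsδ => by
    have := hball (x := s) (by rwa [Real.dist_eq, sub_zero, abs_of_nonneg hs])
    rw [Real.dist_eq] at this
    simp only [mul_zero, Real.sqrt_zero, hh.zero, sub_zero] at this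
    exact (le_abs_self _).trans_lt this
  have hseg_v : ∀ {u v v'}, (u, v') ∈ X.D → X.v₀ ≤ v → v ≤ v' → v' - v < δ →
      |f (u, v) - f (u, v')| < ε / 2 := fun {u v v'} hm h1 h2 h3 => by
    refine lt_of_le_of_lt (Controlled.osc_v hX hh hR hK H hm h1 h2) ?_
    have h4 := hh.nonneg (Real.sqrt_nonneg (2 * C * (v' - v))) ((hX.sqrt_le hm h1 h2).trans hR)
    refine lt_of_le_of_lt ?_ (hsmall _ (sub_nonneg.2 h2) h3)
    gcongr
    linarith
  have hseg_u : ∀ {u u' v}, (u', v) ∈ X.D → X.u₀ ≤ u → u ≤ u' → u' - u < δ →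
      |f (u, v) - f (u', v)| < ε / 2 := fun {u u' v} hm h1 h2 h3 => by
    refine lt_of_le_of_lt (Controlled.osc_v hX.swap hh hR hK' H' (u := v) (v := u) (v' := u')
      hm h1 h2) ?_
    have h4 := hh.nonneg (Real.sqrt_nonneg (2 * C * (u' - u)))
      ((hX.swap.sqrt_le (u := v) (v := u) (v' := u') hm h1 h2).trans hR)
    refine lt_of_le_of_lt ?_ (hsmall _ (sub_nonneg.2 h2) h3)
    gcongr
    linarith
  refine ⟨δ, hδ, ?_⟩
  -- Whether the points are causally related or not, they are joined by one `u`-segment and one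
  -- `v`-segment whose corner lies in the past of an endpoint, hence in the domain.
  have main : ∀ q ∈ X.D, ∀ q' ∈ X.D, q.1 ≤ q'.1 → dist q q' < δ → |f q - f q'| < ε := by
    rintro ⟨u, v⟩ hq ⟨u', v'⟩ hq' huu hd
    rw [Prod.dist_eq, max_lt_iff, Real.dist_eq, Real.dist_eq] at hd
    have h1 := X.dom.fst_le _ hq
    have h2 := X.dom.snd_le _ hq
    have h2' := X.dom.snd_le _ hq'
    have d1 := (abs_lt.1 hd.1).1
    have d2 := abs_lt.1 hd.2
    dsimp only at h1 h2 h2' huu d1 d2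
    rcases le_total v v' with hvv | hvv
    · have hm : (u', v) ∈ X.D := X.dom.mk_mem_of_le hq' h2 hvv
      have k1 := hseg_u hm h1 huu (by linarith)
      have k2 := hseg_v hq' h2 hvv (by linarith)
      linarith [abs_sub_le (f (u, v)) (f (u', v)) (f (u', v'))]
    · have k1 := hseg_v hq h2' hvv (by linarith)
      have k2 := hseg_u hq' h1 huu (by linarith)
      rw [abs_sub_comm] at k1
      linarith [abs_sub_le (f (u, v)) (f (u, v')) (f (u', v'))]
  intro q hq q' hq' hd
  rw [Real.dist_eq]
  rcases le_total q.1 q'.1 with hle | hle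
  · exact main q hq q' hq' hle hd
  · rw [abs_sub_comm]
    exact main q' hq' q hq hle (by rwa [dist_comm])

end NullSolution

/-! ### Boundary values -/

theorem UniformContinuousOn.exists_tendsto {D : Set (ℝ × ℝ)} {f : ℝ × ℝ → ℝ}
    (hf : UniformContinuousOn f D) {p : ℝ × ℝ} (hp : p ∈ closure D) :
    ∃ y, Tendsto f (𝓝[D] p) (𝓝 y) := by
  have : (𝓝[D] p).NeBot := mem_closure_iff_nhdsWithin_neBot.1 hp
  have hc : Cauchy (𝓝[D] p) := cauchy_nhds.mono inf_le_left
  have := hc.map_of_le hf inf_le_right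
  exact cauchy_map_iff_exists_tendsto.1 this

theorem UniformContinuousOn.continuousOn_extendFrom {D : Set (ℝ × ℝ)} {f : ℝ × ℝ → ℝ}
    (hf : UniformContinuousOn f D) : ContinuousOn (extendFrom D f) (closure D) :=
  _root_.continuousOn_extendFrom le_rfl fun _ hx =>
    UniformContinuousOn.exists_tendsto hf hx

namespace NullSolution

variable {X : NullSolution} {c C : ℝ}

/-- In the control inequality `q'` tends to `p` within the future of `q`, after the nonnegative term
`h (r q')` has been dropped. -/
theorem Controlled.abs_sub_extendFrom_le (hX : X.Bounds c C) {h : ℝ → ℝ} {f : ℝ × ℝ → ℝ} {R : ℝ}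
    (hh : Gauge h R) (hCR : C ≤ R) (hR : √(C ^ 3 / c) ≤ R) (H : X.Controlled h f) :
    ∃ K, 0 < K ∧ ∀ p, ∀ q ∈ X.D, p ∈ closure (X.D ∩ Ici q) →
      |f q - extendFrom X.D f p| ≤ K * h (X.r q) := by
  have huc := H.uniformContinuousOn hX hh hR
  obtain ⟨K, hK, H⟩ := H
  refine ⟨K, hK, fun p q hq hp => ?_⟩
  have : (𝓝[X.D ∩ Ici q] p).NeBot := mem_closure_iff_nhdsWithin_neBot.1 hp
  have hlim : Tendsto f (𝓝[X.D ∩ Ici q] p) (𝓝 (extendFrom X.D f p)) :=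
    (tendsto_extendFrom (UniformContinuousOn.exists_tendsto huc
      (closure_mono inter_subset_left hp))).mono_left (nhdsWithin_mono _ inter_subset_left)
  refine le_of_tendsto (hlim.const_sub (f q)).abs ?_
  filter_upwards [self_mem_nhdsWithin] with q' hq'
  refine (H q hq q' hq'.1 hq'.2.1 hq'.2.2).trans ?_
  have := hh.nonneg (X.r_pos q' hq'.1).le ((hX.r_le q' hq'.1).trans hCR)
  gcongr
  linarith

/-- The exponential is Lipschitz on the bounded range of `f`. -/
theorem Controlled.exp (hX : X.Bounds c C) {h : ℝ → ℝ} {f : ℝ × ℝ → ℝ} {R : ℝ}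
    (hh : Gauge h R) (hCR : C ≤ R) (H : X.Controlled h f) :
    X.Controlled h fun p => Real.exp (f p) := by
  obtain ⟨M, hM⟩ := H.exists_abs_le hX hh hCR
  obtain ⟨K, hK, H⟩ := H
  refine ⟨Real.exp M * K, by positivity, fun q hq q' hq' h1 h2 => ?_⟩
  have h3 : |Real.exp (f q) - Real.exp (f q')| ≤ Real.exp M * |f q - f q'| := by
    have := (convex_Icc (-M) M).norm_image_sub_le_of_norm_hasDerivWithin_le
      (f := Real.exp) (f' := Real.exp) (C := Real.exp M) (x := f q') (y := f q)
      (fun x _ => (Real.hasDerivAt_exp x).hasDerivWithinAt)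
      (fun x hx => by
        rw [Real.norm_eq_abs, Real.abs_exp]
        exact Real.exp_le_exp.2 hx.2)
      (abs_le.1 (hM q' hq')) (abs_le.1 (hM q hq))
    simpa using this
  refine h3.trans ?_
  rw [mul_assoc]
  gcongr
  exact H q hq q' hq' h1 h2

end NullSolution


/-! ### Partial derivatives on relatively open subsets of the rectangle -/

section Rectangle

variable {u₀ u₁ v₀ v₁ : ℝ} {D : Set (ℝ × ℝ)}

theorem uniqueDiffOn_of_relatively_open (hu : u₀ < u₁) (hv : v₀ < v₁)
    (hD : ∃ O : Set (ℝ × ℝ), IsOpen O ∧ D = rectangle u₀ u₁ v₀ v₁ ∩ O) : UniqueDiffOn ℝ D := by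
  obtain ⟨O, hO, rfl⟩ := hD
  exact ((uniqueDiffOn_Icc hu).prod (uniqueDiffOn_Icc hv)).inter hO

theorem subset_closure_interior (hu : u₀ < u₁) (hv : v₀ < v₁)
    (hD : ∃ O : Set (ℝ × ℝ), IsOpen O ∧ D = rectangle u₀ u₁ v₀ v₁ ∩ O) :
    D ⊆ closure (interior D) := by
  obtain ⟨O, hO, rfl⟩ := hD
  rw [interior_inter, hO.interior_eq, rectangle, interior_prod_eq, interior_Icc, interior_Icc,
    inter_comm, inter_comm _ O]
  refine Subset.trans ?_ hO.inter_closure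
  rw [closure_prod_eq, closure_Ioo hu.ne, closure_Ioo hv.ne]

/-- Near each of its points the domain contains a product of intervals, where Peano's criterion
applies. With `C²` fields the functions `Pu` and `Au` are a priori only continuous; but the
equations make `P_v` and `A_v` differentiable in `u` with continuous derivative, which is what
supplies the `v`-derivatives of `Pu` and `Au`. -/
theorem HasU.mixed (hu : u₀ < u₁)
    (hD : ∃ O : Set (ℝ × ℝ), IsOpen O ∧ D = rectangle u₀ u₁ v₀ v₁ ∩ O)
    {f fu fv fvu : ℝ × ℝ → ℝ} (hfu : HasU D f fu) (hfv : HasV D f fv) (hfvu : HasU D fv fvu)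
    (hc : ContinuousOn fvu D) : HasV D fu fvu := by
  obtain ⟨O, hO, hDO⟩ := hD
  rintro ⟨u, v⟩ hp
  have hpD := hp
  rw [hDO] at hp
  obtain ⟨ε, hε, hball⟩ := Metric.isOpen_iff.1 hO _ hp.2
  set N := Icc u₀ u₁ ∩ Metric.ball u ε with hN
  set T := Icc v₀ v₁ ∩ Metric.ball v ε with hT
  have hsub : N ×ˢ T ⊆ D := by
    rintro ⟨s, t⟩ ⟨hs, ht⟩
    rw [hDO]
    refine ⟨⟨hs.1, ht.1⟩, hball ?_⟩
    rw [← ball_prod_same]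
    exact ⟨hs.2, ht.2⟩
  have huN : u ∈ N := ⟨hp.1.1, Metric.mem_ball_self hε⟩
  have hvT : v ∈ T := ⟨hp.1.2, Metric.mem_ball_self hε⟩
  have hne : (𝓝[N \ {u}] u).NeBot := by
    have h1 : UniqueDiffOn ℝ N := (uniqueDiffOn_Icc hu).inter Metric.isOpen_ball
    exact accPt_principal_iff_nhdsWithin.1 (h1 u huN).accPt
  have key := hasDerivWithinAt_partial_of_mixed
    ((convex_Icc u₀ u₁).inter (convex_ball u ε)) ((convex_Icc v₀ v₁).inter (convex_ball v ε))
    (f := f) (fu := fu) (fv := fv) (fvu := fvu) huN hvT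
    (fun t ht => (hfu (u, t) (hsub ⟨huN, ht⟩)).mono fun s hs => hsub ⟨hs, ht⟩)
    (fun s hs t ht => (hfv (s, t) (hsub ⟨hs, ht⟩)).mono fun t' ht' => hsub ⟨hs, ht'⟩)
    (fun s hs t ht => (hfvu (s, t) (hsub ⟨hs, ht⟩)).mono fun s' hs' => hsub ⟨hs', ht⟩)
    ((hc (u, v) hpD).mono hsub)
  refine key.mono_of_mem_nhdsWithin ?_
  rw [mem_nhdsWithin]
  refine ⟨Metric.ball v ε, Metric.isOpen_ball, hvT.2, fun t ht => ⟨?_, ht.1⟩⟩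
  have h2 : (u, t) ∈ D := ht.2
  rw [hDO] at h2
  exact h2.1.2

theorem HasV.mixed (hv : v₀ < v₁)
    (hD : ∃ O : Set (ℝ × ℝ), IsOpen O ∧ D = rectangle u₀ u₁ v₀ v₁ ∩ O)
    {f fu fv fuv : ℝ × ℝ → ℝ} (hfu : HasU D f fu) (hfv : HasV D f fv) (hfuv : HasV D fu fuv)
    (hc : ContinuousOn fuv D) : HasU D fv fuv := by
  have hD' : ∃ O : Set (ℝ × ℝ), IsOpen O ∧ Prod.swap ⁻¹' D = rectangle v₀ v₁ u₀ u₁ ∩ O := by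
    obtain ⟨O, hO, rfl⟩ := hD
    exact ⟨Prod.swap ⁻¹' O, hO.preimage continuous_swap, by
      ext p; simp [rectangle]⟩
  exact (HasU.mixed hv hD' hfv.swap hfu.swap hfuv.swap
    (hc.comp continuous_swap.continuousOn fun _ hp => hp)).swap

variable {f : ℝ × ℝ → ℝ}

theorem hasU_du (hf : ContDiffOn ℝ 1 f D) : HasU D f (du D f) := fun p hp => by
  have h := (hf.differentiableOn one_ne_zero p hp).hasFDerivWithinAt
  have hl : HasDerivWithinAt (fun t : ℝ => (t, p.2)) ((1 : ℝ), (0 : ℝ)) {t | (t, p.2) ∈ D} p.1 :=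
    (hasDerivWithinAt_id _ _).prodMk (hasDerivWithinAt_const _ _ _)
  exact HasFDerivWithinAt.comp_hasDerivWithinAt p.1 h hl fun t ht => ht

theorem hasV_dv (hf : ContDiffOn ℝ 1 f D) : HasV D f (dv D f) := fun p hp => by
  have h := (hf.differentiableOn one_ne_zero p hp).hasFDerivWithinAt
  have hl : HasDerivWithinAt (fun t : ℝ => (p.1, t)) ((0 : ℝ), (1 : ℝ)) {t | (p.1, t) ∈ D} p.2 :=
    (hasDerivWithinAt_const _ _ _).prodMk (hasDerivWithinAt_id _ _)
  exact HasFDerivWithinAt.comp_hasDerivWithinAt p.2 h hl fun t ht => ht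

theorem contDiffOn_du {n : WithTop ℕ∞} (hD : UniqueDiffOn ℝ D) (hf : ContDiffOn ℝ (n + 1) f D) :
    ContDiffOn ℝ n (du D f) D :=
  (hf.fderivWithin hD le_rfl).clm_apply contDiffOn_const

theorem contDiffOn_dv {n : WithTop ℕ∞} (hD : UniqueDiffOn ℝ D) (hf : ContDiffOn ℝ (n + 1) f D) :
    ContDiffOn ℝ n (dv D f) D :=
  (hf.fderivWithin hD le_rfl).clm_apply contDiffOn_const

/-- At edge points the symmetry of second derivatives persists because the domain lies in the
closure of its interior. -/
theorem dv_du_eq (hD : UniqueDiffOn ℝ D) (hi : D ⊆ closure (interior D))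
    (hf : ContDiffOn ℝ 2 f D) {p : ℝ × ℝ} (hp : p ∈ D) :
    dv D (du D f) p = du D (dv D f) p := by
  have hs := (hf p hp).isSymmSndFDerivWithinAt (by simp) hD (hi hp) hp
  have h1 : DifferentiableWithinAt ℝ (fderivWithin ℝ f D) D p :=
    ((hf.fderivWithin (m := 1) hD (by norm_num)).differentiableOn one_ne_zero) p hp
  have h2 : ∀ w : ℝ × ℝ, fderivWithin ℝ (fun q => fderivWithin ℝ f D q w) D p
      = (fderivWithin ℝ (fderivWithin ℝ f D) D p).flip w := fun w => by
    rw [fderivWithin_clm_apply (hD p hp) h1 (differentiableWithinAt_const w)]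
    simp
  have e1 : dv D (du D f) p = fderivWithin ℝ (fderivWithin ℝ f D) D p (0, 1) (1, 0) := by
    have := h2 (1, 0)
    exact congrArg (fun L => L (0, 1)) this
  have e2 : du D (dv D f) p = fderivWithin ℝ (fderivWithin ℝ f D) D p (1, 0) (0, 1) := by
    have := h2 (0, 1)
    exact congrArg (fun L => L (1, 0)) this
  rw [e1, e2]
  exact hs _ _

end Rectangle

/-! ### Propagation of trapping and reduction to the first-order system -/

namespace IsFutureDevelopment

variable {u₀ u₁ v₀ v₁ : ℝ} {D : Set (ℝ × ℝ)} {F : Fields}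

theorem uniqueDiffOn (h : IsFutureDevelopment u₀ u₁ v₀ v₁ D F) : UniqueDiffOn ℝ D :=
  uniqueDiffOn_of_relatively_open h.u_lt h.v_lt h.relatively_open

theorem subset_closure_interior (h : IsFutureDevelopment u₀ u₁ v₀ v₁ D F) :
    D ⊆ closure (interior D) :=
  ESFSS.subset_closure_interior h.u_lt h.v_lt h.relatively_open

theorem subset_rectangle (h : IsFutureDevelopment u₀ u₁ v₀ v₁ D F) :
    D ⊆ rectangle u₀ u₁ v₀ v₁ := by
  obtain ⟨O, -, rfl⟩ := h.relatively_open
  exact inter_subset_left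

theorem pastDomain (h : IsFutureDevelopment u₀ u₁ v₀ v₁ D F) : PastDomain D u₀ v₀ where
  fst_le p hp := (h.subset_rectangle hp).1.1
  snd_le p hp := (h.subset_rectangle hp).2.1
  past p hp q h1 h2 h3 h4 := h.past_closed p hp q
    ⟨⟨h1, h2.trans (h.subset_rectangle hp).1.2⟩, ⟨h3, h4.trans (h.subset_rectangle hp).2.2⟩⟩ h2 h4
  isCompact_fst := by
    have : {p ∈ D | p.1 = u₀} = {u₀} ×ˢ Icc v₀ v₁ := by
      ext p
      exact ⟨fun hp => ⟨hp.2, (h.subset_rectangle hp.1).2⟩,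
        fun hp => ⟨h.outgoing_subset hp, hp.1⟩⟩
    rw [this]
    exact isCompact_singleton.prod isCompact_Icc
  isCompact_snd := by
    have : {p ∈ D | p.2 = v₀} = Icc u₀ u₁ ×ˢ {v₀} := by
      ext p
      exact ⟨fun hp => ⟨(h.subset_rectangle hp.1).1, hp.2⟩,
        fun hp => ⟨h.ingoing_subset hp, hp.2⟩⟩
    rw [this]
    exact isCompact_Icc.prod isCompact_singleton

variable (h : IsFutureDevelopment u₀ u₁ v₀ v₁ D F)
include h

theorem contDiffOn_du_r : ContDiffOn ℝ 1 (du D F.r) D :=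
  contDiffOn_du h.uniqueDiffOn h.contDiffOn_r

theorem contDiffOn_dv_r : ContDiffOn ℝ 1 (dv D F.r) D :=
  contDiffOn_dv h.uniqueDiffOn h.contDiffOn_r

theorem contDiffOn_du_φ : ContDiffOn ℝ 1 (du D F.φ) D :=
  contDiffOn_du h.uniqueDiffOn h.contDiffOn_φ

theorem contDiffOn_dv_φ : ContDiffOn ℝ 1 (dv D F.φ) D :=
  contDiffOn_dv h.uniqueDiffOn h.contDiffOn_φ

theorem contDiffOn_log : ContDiffOn ℝ 2 (fun q => Real.log (F.Ωsq q)) D :=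
  h.contDiffOn_Ωsq.log fun p hp => (h.Ωsq_pos p hp).ne'

theorem contDiffOn_du_log : ContDiffOn ℝ 1 (du D fun q => Real.log (F.Ωsq q)) D :=
  contDiffOn_du h.uniqueDiffOn h.contDiffOn_log

theorem contDiffOn_dv_log : ContDiffOn ℝ 1 (dv D fun q => Real.log (F.Ωsq q)) D :=
  contDiffOn_dv h.uniqueDiffOn h.contDiffOn_log

/-- Raychaudhuri makes `-Ω⁻² ∂_u r` nondecreasing in `u`, and it is positive on the outgoing cone.
-/
theorem du_r_neg : ∀ p ∈ D, du D F.r p < 0 := by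
  rintro ⟨u, v⟩ hp
  have hr : ContDiffOn ℝ 1 (fun q => -(F.Ωsq q)⁻¹ * du D F.r q) D :=
    ((h.contDiffOn_Ωsq.of_le one_le_two).inv fun p hp => (h.Ωsq_pos p hp).ne').neg.mul
      h.contDiffOn_du_r
  have h0 : (u₀, v) ∈ D := h.pastDomain.mk_mem_of_le' hp le_rfl (h.pastDomain.fst_le _ hp)
  have h1 := h.pastDomain.mono_u (hasU_du hr) (fun q hq => by
    rw [h.solves.raychaudhuri_u q hq]
    have := h.r_pos q hq
    have := h.Ωsq_pos q hq
    positivity) le_rfl (h.pastDomain.fst_le _ hp) hp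
  have h2 := (h.trapped (u₀, v) (Or.inl ⟨rfl, (h.subset_rectangle h0).2⟩)).1
  have h3 : 0 < (F.Ωsq (u₀, v))⁻¹ := inv_pos.2 (h.Ωsq_pos _ h0)
  have h4 : 0 < (F.Ωsq (u, v))⁻¹ := inv_pos.2 (h.Ωsq_pos _ hp)
  dsimp only at h1
  by_contra! hcon
  nlinarith

theorem dv_r_neg : ∀ p ∈ D, dv D F.r p < 0 := by
  rintro ⟨u, v⟩ hp
  have hr : ContDiffOn ℝ 1 (fun q => -(F.Ωsq q)⁻¹ * dv D F.r q) D :=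
    ((h.contDiffOn_Ωsq.of_le one_le_two).inv fun p hp => (h.Ωsq_pos p hp).ne').neg.mul
      h.contDiffOn_dv_r
  have h0 : (u, v₀) ∈ D := h.pastDomain.mk_mem_of_le hp le_rfl (h.pastDomain.snd_le _ hp)
  have h1 := h.pastDomain.mono_v (hasV_dv hr) (fun q hq => by
    rw [h.solves.raychaudhuri_v q hq]
    have := h.r_pos q hq
    have := h.Ωsq_pos q hq
    positivity) le_rfl (h.pastDomain.snd_le _ hp) hp
  have h2 := (h.trapped (u, v₀) (Or.inr ⟨(h.subset_rectangle h0).1, rfl⟩)).2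
  have h3 : 0 < (F.Ωsq (u, v₀))⁻¹ := inv_pos.2 (h.Ωsq_pos _ h0)
  have h4 : 0 < (F.Ωsq (u, v))⁻¹ := inv_pos.2 (h.Ωsq_pos _ hp)
  dsimp only at h1
  by_contra! hcon
  nlinarith

end IsFutureDevelopment


theorem HasU.exp_log {D : Set (ℝ × ℝ)} {f g : ℝ × ℝ → ℝ} (hf : ∀ p ∈ D, 0 < f p)
    (h : HasU D (fun q => Real.log (f q)) g) : HasU D f fun p => f p * g p := fun p hp => by
  refine (((h p hp).exp).congr_deriv (by rw [Real.exp_log (hf p hp)])).congr ?_ ?_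
  · intro t ht
    exact (Real.exp_log (hf _ ht)).symm
  · exact (Real.exp_log (hf _ hp)).symm

theorem HasV.exp_log {D : Set (ℝ × ℝ)} {f g : ℝ × ℝ → ℝ} (hf : ∀ p ∈ D, 0 < f p)
    (h : HasV D (fun q => Real.log (f q)) g) : HasV D f fun p => f p * g p :=
  (HasU.exp_log (D := Prod.swap ⁻¹' D) (f := f ∘ Prod.swap) (g := g ∘ Prod.swap)
    (fun _ hp => hf _ hp) h.swap).swap

namespace IsFutureDevelopment

variable {u₀ u₁ v₀ v₁ : ℝ} {D : Set (ℝ × ℝ)} {F : Fields}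

variable (h : IsFutureDevelopment u₀ u₁ v₀ v₁ D F)
include h

theorem r_ne {p : ℝ × ℝ} (hp : p ∈ D) : F.r p ≠ 0 := (h.r_pos p hp).ne'

theorem Ωsq_ne {p : ℝ × ℝ} (hp : p ∈ D) : F.Ωsq p ≠ 0 := (h.Ωsq_pos p hp).ne'

theorem du_r_ne {p : ℝ × ℝ} (hp : p ∈ D) : du D F.r p ≠ 0 := (h.du_r_neg p hp).ne

theorem dv_r_ne {p : ℝ × ℝ} (hp : p ∈ D) : dv D F.r p ≠ 0 := (h.dv_r_neg p hp).ne

theorem r_u : HasU D F.r (du D F.r) := hasU_du (h.contDiffOn_r.of_le one_le_two)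
theorem r_v : HasV D F.r (dv D F.r) := hasV_dv (h.contDiffOn_r.of_le one_le_two)
theorem φ_u : HasU D F.φ (du D F.φ) := hasU_du (h.contDiffOn_φ.of_le one_le_two)
theorem φ_v : HasV D F.φ (dv D F.φ) := hasV_dv (h.contDiffOn_φ.of_le one_le_two)

theorem r_vu : HasU D (dv D F.r)
    fun p => -F.Ωsq p / (4 * F.r p) - du D F.r p * dv D F.r p / F.r p :=
  (hasU_du h.contDiffOn_dv_r).congr_deriv h.solves.wave_r

theorem r_uv : HasV D (du D F.r)
    fun p => -F.Ωsq p / (4 * F.r p) - du D F.r p * dv D F.r p / F.r p :=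
  (hasV_dv h.contDiffOn_du_r).congr_deriv fun p hp =>
    (dv_du_eq h.uniqueDiffOn h.subset_closure_interior h.contDiffOn_r hp).trans
      (h.solves.wave_r p hp)

theorem φ_vu : HasU D (dv D F.φ)
    fun p => -(du D F.r p * dv D F.φ p) / F.r p - dv D F.r p * du D F.φ p / F.r p :=
  (hasU_du h.contDiffOn_dv_φ).congr_deriv h.solves.wave_φ

theorem φ_uv : HasV D (du D F.φ)
    fun p => -(du D F.r p * dv D F.φ p) / F.r p - dv D F.r p * du D F.φ p / F.r p :=
  (hasV_dv h.contDiffOn_du_φ).congr_deriv fun p hp =>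
    (dv_du_eq h.uniqueDiffOn h.subset_closure_interior h.contDiffOn_φ hp).trans
      (h.solves.wave_φ p hp)

theorem Ωsq_u : HasU D F.Ωsq fun p => F.Ωsq p * du D (fun q => Real.log (F.Ωsq q)) p :=
  HasU.exp_log h.Ωsq_pos (hasU_du (h.contDiffOn_log.of_le one_le_two))

theorem Ωsq_v : HasV D F.Ωsq fun p => F.Ωsq p * dv D (fun q => Real.log (F.Ωsq q)) p :=
  HasV.exp_log h.Ωsq_pos (hasV_dv (h.contDiffOn_log.of_le one_le_two))

theorem contDiffOn_P : ContDiffOn ℝ 1 (fun p => -F.r p * du D F.r p) D :=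
  (h.contDiffOn_r.of_le one_le_two).neg.mul h.contDiffOn_du_r

theorem contDiffOn_Q : ContDiffOn ℝ 1 (fun p => -F.r p * dv D F.r p) D :=
  (h.contDiffOn_r.of_le one_le_two).neg.mul h.contDiffOn_dv_r

theorem contDiffOn_A :
    ContDiffOn ℝ 1 (fun p => F.r p ^ 2 * du D F.φ p / (-F.r p * du D F.r p)) D :=
  (((h.contDiffOn_r.of_le one_le_two).pow 2).mul h.contDiffOn_du_φ).div h.contDiffOn_P
    fun _ hp => mul_ne_zero (neg_ne_zero.2 (h.r_ne hp)) (h.du_r_ne hp)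

theorem contDiffOn_B :
    ContDiffOn ℝ 1 (fun p => F.r p ^ 2 * dv D F.φ p / (-F.r p * dv D F.r p)) D :=
  (((h.contDiffOn_r.of_le one_le_two).pow 2).mul h.contDiffOn_dv_φ).div h.contDiffOn_Q
    fun _ hp => mul_ne_zero (neg_ne_zero.2 (h.r_ne hp)) (h.dv_r_ne hp)

/-- The wave equation for `r` is the statement `∂_v (r ∂_u r) = -Ω² / 4`. -/
theorem P_v : HasV D (fun p => -F.r p * du D F.r p) fun p => F.Ωsq p / 4 :=
  (h.r_v.neg.mul h.r_uv).congr_deriv fun p hp => by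
    have := h.r_ne hp
    field_simp
    ring

theorem Q_u : HasU D (fun p => -F.r p * dv D F.r p) fun p => F.Ωsq p / 4 :=
  (h.r_u.neg.mul h.r_vu).congr_deriv fun p hp => by
    have := h.r_ne hp
    field_simp
    ring

/-- The first-order form of a future development. -/
noncomputable def toNullSolution : NullSolution :=
  let P : ℝ × ℝ → ℝ := fun p => -F.r p * du D F.r p
  let Q : ℝ × ℝ → ℝ := fun p => -F.r p * dv D F.r p
  let A : ℝ × ℝ → ℝ := fun p => F.r p ^ 2 * du D F.φ p / (-F.r p * du D F.r p)
  let B : ℝ × ℝ → ℝ := fun p => F.r p ^ 2 * dv D F.φ p / (-F.r p * dv D F.r p)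
  let Wu : ℝ × ℝ → ℝ := du D fun q => Real.log (F.Ωsq q)
  let Wv : ℝ × ℝ → ℝ := dv D fun q => Real.log (F.Ωsq q)
  let Pu : ℝ × ℝ → ℝ := fun p => P p * (Wu p - P p / F.r p ^ 2 + P p * A p ^ 2 / F.r p ^ 2)
  let Qv : ℝ × ℝ → ℝ := fun p => Q p * (Wv p - Q p / F.r p ^ 2 + Q p * B p ^ 2 / F.r p ^ 2)
  have r1 := h.contDiffOn_r.continuousOn
  have w1 := h.contDiffOn_Ωsq.continuousOn
  have r2 : ∀ p ∈ D, F.r p ^ 2 ≠ 0 := fun p hp => pow_ne_zero 2 (h.r_ne hp)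
  have cP : ContinuousOn P D := h.contDiffOn_P.continuousOn
  have cQ : ContinuousOn Q D := h.contDiffOn_Q.continuousOn
  have cA : ContinuousOn A D := h.contDiffOn_A.continuousOn
  have cB : ContinuousOn B D := h.contDiffOn_B.continuousOn
  have cWu : ContinuousOn Wu D := h.contDiffOn_du_log.continuousOn
  have cWv : ContinuousOn Wv D := h.contDiffOn_dv_log.continuousOn
  have cPu : ContinuousOn Pu D :=
    cP.mul ((cWu.sub (cP.div (r1.pow 2) r2)).add ((cP.mul (cA.pow 2)).div (r1.pow 2) r2))
  have cQv : ContinuousOn Qv D :=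
    cQ.mul ((cWv.sub (cQ.div (r1.pow 2) r2)).add ((cQ.mul (cB.pow 2)).div (r1.pow 2) r2))
  have cAu : ContinuousOn (du D A) D :=
    (contDiffOn_du (n := 0) h.uniqueDiffOn (by rw [zero_add]; exact h.contDiffOn_A)).continuousOn
  have cBv : ContinuousOn (dv D B) D :=
    (contDiffOn_dv (n := 0) h.uniqueDiffOn (by rw [zero_add]; exact h.contDiffOn_B)).continuousOn
  have P_pos : ∀ p ∈ D, 0 < P p := fun p hp =>
    mul_pos_of_neg_of_neg (neg_lt_zero.2 (h.r_pos p hp)) (h.du_r_neg p hp)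
  have Q_pos : ∀ p ∈ D, 0 < Q p := fun p hp =>
    mul_pos_of_neg_of_neg (neg_lt_zero.2 (h.r_pos p hp)) (h.dv_r_neg p hp)
  -- Factoring `P` as `(-Ω⁻² ∂_u r) (r Ω²)` lets Raychaudhuri give the derivative without second
  -- derivatives of `r`.
  have P_u : HasU D P Pu := by
    have hr : ContDiffOn ℝ 1 (fun q => -(F.Ωsq q)⁻¹ * du D F.r q) D :=
      ((h.contDiffOn_Ωsq.of_le one_le_two).inv fun p hp => h.Ωsq_ne hp).neg.mul h.contDiffOn_du_r
    refine ((((hasU_du hr).congr_deriv h.solves.raychaudhuri_u).mul (h.r_u.mul h.Ωsq_u)).congr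
      (g := P) fun p hp => ?_).congr_deriv fun p hp => ?_
    · have := h.Ωsq_ne hp
      simp only [P]
      field_simp
    · have h1 := h.Ωsq_ne hp
      have h2 := h.r_ne hp
      have h3 := h.du_r_ne hp
      simp only [Pu, P, A, Wu]
      field_simp
      ring
  have Q_v : HasV D Q Qv := by
    have hr : ContDiffOn ℝ 1 (fun q => -(F.Ωsq q)⁻¹ * dv D F.r q) D :=
      ((h.contDiffOn_Ωsq.of_le one_le_two).inv fun p hp => h.Ωsq_ne hp).neg.mul h.contDiffOn_dv_r
    refine ((((hasV_dv hr).congr_deriv h.solves.raychaudhuri_v).mul (h.r_v.mul h.Ωsq_v)).congr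
      (g := Q) fun p hp => ?_).congr_deriv fun p hp => ?_
    · have := h.Ωsq_ne hp
      simp only [Q]
      field_simp
    · have h1 := h.Ωsq_ne hp
      have h2 := h.r_ne hp
      have h3 := h.dv_r_ne hp
      simp only [Qv, Q, B, Wv]
      field_simp
      ring
  have P_v : HasV D P fun p => F.Ωsq p / 4 := h.P_v
  have Q_u : HasU D Q fun p => F.Ωsq p / 4 := h.Q_u
  have A_u : HasU D A (du D A) := hasU_du h.contDiffOn_A
  have B_v : HasV D B (dv D B) := hasV_dv h.contDiffOn_B
  have r_u' : HasU D F.r fun p => -(P p / F.r p) := h.r_u.congr_deriv fun p hp => by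
    have := h.r_ne hp
    simp only [P]
    field_simp
  have r_v' : HasV D F.r fun p => -(Q p / F.r p) := h.r_v.congr_deriv fun p hp => by
    have := h.r_ne hp
    simp only [Q]
    field_simp
  have A_v : HasV D A fun p =>
      Q p / F.r p ^ 2 * (B p - A p) - F.Ωsq p / (4 * P p) * A p :=
    (((h.r_v.pow 2).mul h.φ_uv).div h.P_v fun p hp => (P_pos p hp).ne').congr_deriv
      fun p hp => by
        have h1 := h.r_ne hp
        have h2 := h.du_r_ne hp
        have h3 := h.dv_r_ne hp
        simp only [P, Q, A, B]
        field_simp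
        norm_num
        ring
  have B_u : HasU D B fun p =>
      P p / F.r p ^ 2 * (A p - B p) - F.Ωsq p / (4 * Q p) * B p :=
    (((h.r_u.pow 2).mul h.φ_vu).div h.Q_u fun p hp => (Q_pos p hp).ne').congr_deriv
      fun p hp => by
        have h1 := h.r_ne hp
        have h2 := h.du_r_ne hp
        have h3 := h.dv_r_ne hp
        simp only [P, Q, A, B]
        field_simp
        norm_num
        ring
  have wave_w : ∀ p ∈ D, F.Ωsq p / (2 * F.r p ^ 2) + 2 * du D F.r p * dv D F.r p / F.r p ^ 2
        - 2 * du D F.φ p * dv D F.φ p =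
      F.Ωsq p / (2 * F.r p ^ 2) + 2 * (P p * Q p) / F.r p ^ 4
        - 2 * (P p * A p) * (Q p * B p) / F.r p ^ 4 := fun p hp => by
    have h1 := h.r_ne hp
    have h2 := h.du_r_ne hp
    have h3 := h.dv_r_ne hp
    simp only [P, Q, A, B]
    field_simp
  { D := D
    u₀ := u₀
    v₀ := v₀
    r := F.r
    w := F.Ωsq
    φ := F.φ
    P := P
    Q := Q
    A := A
    B := B
    Wu := Wu
    Wv := Wv
    Pu := Pu
    Qv := Qv
    Au := du D A
    Bv := dv D B
    dom := h.pastDomain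
    r_pos := h.r_pos
    w_pos := h.Ωsq_pos
    P_pos := P_pos
    Q_pos := Q_pos
    r_u := r_u'
    r_v := r_v'
    w_u := h.Ωsq_u
    w_v := h.Ωsq_v
    φ_u := h.φ_u.congr_deriv fun p hp => by
      have h1 := h.r_ne hp
      have h2 := h.du_r_ne hp
      simp only [P, A]
      field_simp
    φ_v := h.φ_v.congr_deriv fun p hp => by
      have h1 := h.r_ne hp
      have h2 := h.dv_r_ne hp
      simp only [Q, B]
      field_simp
    P_u := P_u
    P_v := P_v
    Q_u := Q_u
    Q_v := Q_v
    A_u := A_u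
    A_v := A_v
    B_u := B_u
    B_v := B_v
    Wu_v := (hasV_dv h.contDiffOn_du_log).congr_deriv fun p hp =>
      (dv_du_eq h.uniqueDiffOn h.subset_closure_interior h.contDiffOn_log hp).trans
        ((h.solves.wave_Ω p hp).trans (wave_w p hp))
    Wv_u := (hasU_du h.contDiffOn_dv_log).congr_deriv fun p hp =>
      (h.solves.wave_Ω p hp).trans (wave_w p hp)
    Pu_v := HasU.mixed h.u_lt h.relatively_open P_u P_v
      ((h.Ωsq_u.const_mul (1 / 4)).congr (g := fun p => F.Ωsq p / 4)
        (fun p _ => by ring) |>.congr_deriv fun p _ => by ring) ((w1.mul cWu).div_const 4)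
    Qv_u := HasV.mixed h.v_lt h.relatively_open Q_u Q_v
      ((h.Ωsq_v.const_mul (1 / 4)).congr (g := fun p => F.Ωsq p / 4)
        (fun p _ => by ring) |>.congr_deriv fun p _ => by ring) ((w1.mul cWv).div_const 4)
    -- The transport equation of `A` in `v` is differentiated in `u`, and the result is read as the
    -- `v`-derivative of `Au`.
    Au_v := by
      have P4 : ∀ p ∈ D, 4 * P p ≠ 0 := fun p hp => mul_ne_zero four_ne_zero (P_pos p hp).ne'
      have Q4 : ∀ p ∈ D, 4 * Q p ≠ 0 := fun p hp => mul_ne_zero four_ne_zero (Q_pos p hp).ne'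
      refine HasU.mixed h.u_lt h.relatively_open A_u A_v
        ((((Q_u.div (r_u'.pow 2) r2).mul (B_u.sub A_u)).sub
          ((h.Ωsq_u.div (P_u.const_mul 4) P4).mul A_u)).congr_deriv fun p hp => ?_) ?_
      · have h1 := h.r_ne hp
        have h2 := (P_pos p hp).ne'
        have h3 := (Q_pos p hp).ne'
        field_simp
        norm_num
        ring
      · have P44 : ∀ p ∈ D, 4 * P p ^ 2 ≠ 0 := fun p hp =>
          mul_ne_zero four_ne_zero (pow_ne_zero 2 (P_pos p hp).ne')
        have r4 : ∀ p ∈ D, F.r p ^ 4 ≠ 0 := fun p hp => pow_ne_zero 4 (h.r_ne hp)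
        fun_prop (disch := assumption)
    Bv_u := by
      have P4 : ∀ p ∈ D, 4 * P p ≠ 0 := fun p hp => mul_ne_zero four_ne_zero (P_pos p hp).ne'
      have Q4 : ∀ p ∈ D, 4 * Q p ≠ 0 := fun p hp => mul_ne_zero four_ne_zero (Q_pos p hp).ne'
      refine HasV.mixed h.v_lt h.relatively_open B_u B_v
        ((((P_v.div (r_v'.pow 2) r2).mul (A_v.sub B_v)).sub
          ((h.Ωsq_v.div (Q_v.const_mul 4) Q4).mul B_v)).congr_deriv fun p hp => ?_) ?_
      · have h1 := h.r_ne hp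
        have h2 := (P_pos p hp).ne'
        have h3 := (Q_pos p hp).ne'
        field_simp
        norm_num
        ring
      · have Q44 : ∀ p ∈ D, 4 * Q p ^ 2 ≠ 0 := fun p hp =>
          mul_ne_zero four_ne_zero (pow_ne_zero 2 (Q_pos p hp).ne')
        have r4 : ∀ p ∈ D, F.r p ^ 4 ≠ 0 := fun p hp => pow_ne_zero 4 (h.r_ne hp)
        fun_prop (disch := assumption)
    ray_u := fun p _ => rfl
    ray_v := fun p _ => rfl
    cont_r := r1
    cont_w := w1
    cont_P := cP
    cont_Q := cQ
    cont_A := cA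
    cont_B := cB
    cont_Wu := cWu
    cont_Wv := cWv
    cont_Pu := cPu
    cont_Qv := cQv
    cont_Au := cAu
    cont_Bv := cBv }

end IsFutureDevelopment


/-! ### Oscillation of the renormalised quantities -/

namespace NullSolution

variable {X : NullSolution} {c C : ℝ}

theorem Bounds.controlled_P (hX : X.Bounds c C) : X.Controlled (fun x => x) X.P := by
  obtain ⟨K, hK, h⟩ := hX.exists_Pu_le
  refine hX.controlled (k := fun _ => 1) (K := K) (L := C) (fun x _ => hasDerivAt_id x) X.P_u X.P_v
    (fun p hp => by simpa using h p hp) (fun p hp => ?_) (fun _ _ => zero_le_one)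
  have hw := X.w_pos p hp
  rw [abs_of_pos (by positivity), mul_one]
  linarith [hX.w_le p hp]

theorem Bounds.controlled_Q (hX : X.Bounds c C) : X.Controlled (fun x => x) X.Q :=
  hX.swap.controlled_P.swap

theorem Bounds.controlled_A (hX : X.Bounds c C) : X.Controlled (fun x => x) X.A := by
  obtain ⟨K, hK, h⟩ := hX.exists_Au_le
  obtain ⟨L, hL, h'⟩ := hX.exists_Av_le
  exact hX.controlled (k := fun _ => 1) (K := K) (L := L) (fun x _ => hasDerivAt_id x) X.A_u X.A_v
    (fun p hp => by simpa using h p hp) (fun p hp => by simpa using h' p hp)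
    (fun _ _ => zero_le_one)

/-- The regular part of the scalar field. -/
noncomputable def scalarRemainder (X : NullSolution) (r₀ : ℝ) (p : ℝ × ℝ) : ℝ :=
  X.φ p - X.A p * Real.log (r₀ / X.r p)

/-- The logarithm of the renormalised mass `4 P Q / (r² w) (r / r₀)^(A² + 1)`. -/
noncomputable def logMass (X : NullSolution) (r₀ : ℝ) (p : ℝ × ℝ) : ℝ :=
  Real.log (4 * X.P p * X.Q p) - Real.log (X.w p) - 2 * Real.log (X.r p)
    + (X.A p ^ 2 + 1) * (Real.log (X.r p) - Real.log r₀)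

variable {r₀ R : ℝ}

theorem abs_log_sub_le {r : ℝ} (hr : 0 < r) (hrr : r ≤ r₀) (hR : r₀ ≤ R) :
    |Real.log r - Real.log r₀| ≤ 1 + Real.log R - Real.log r ∧
      1 ≤ 1 + Real.log R - Real.log r := by
  have h1 := Real.log_le_log hr hrr
  have h2 := Real.log_le_log (hr.trans_le hrr) hR
  constructor
  · rw [abs_le]; constructor <;> linarith
  · linarith

/-- In `φ - A log(r₀/r)` the `r⁻²` part of the `u`-derivative cancels exactly, that of the
`v`-derivative up to `Q (A - B) / r² = O(1/r)`. What is left is a derivative of `A` times a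
logarithm. -/
theorem Bounds.controlled_scalarRemainder (hX : X.Bounds c C)
    (h₀ : ∀ p ∈ X.D, X.r p ≤ r₀) (hr₀ : 0 < r₀) (hR : r₀ ≤ R) :
    X.Controlled (logGauge R) (X.scalarRemainder r₀) := by
  obtain ⟨K, hK, h⟩ := hX.exists_Au_le
  obtain ⟨L, hL, h'⟩ := hX.exists_Av_le
  obtain ⟨N, hN, h''⟩ := hX.exists_sub_le
  have hr : ∀ p ∈ X.D, X.r p ≠ 0 := fun p hp => (X.r_pos p hp).ne'
  have hlog : ∀ p ∈ X.D, X.scalarRemainder r₀ p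
      = X.φ p - X.A p * -(Real.log (X.r p) - Real.log r₀) := fun p hp => by
    rw [scalarRemainder, Real.log_div hr₀.ne' (hr p hp)]
    ring
  have hlu : HasU X.D (fun p => Real.log (X.r p) - Real.log r₀) fun p => -(P X p / X.r p) / X.r p :=
    fun p hp => ((X.r_u.log hr) p hp).sub_const _
  have hlv : HasV X.D (fun p => Real.log (X.r p) - Real.log r₀) fun p => -(Q X p / X.r p) / X.r p :=
    fun p hp => ((X.r_v.log hr) p hp).sub_const _
  have hu : HasU X.D (X.scalarRemainder r₀) fun p => X.Au p * (Real.log (X.r p) - Real.log r₀) :=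
    ((X.φ_u.sub (X.A_u.mul hlu.neg)).congr hlog).congr_deriv fun p hp => by
      have := hr p hp
      field_simp
      ring
  have hv := ((X.φ_v.sub (X.A_v.mul hlv.neg)).congr hlog).congr_deriv
    (g' := fun p => (X.Q p / X.r p ^ 2 * (X.B p - X.A p) - X.w p / (4 * X.P p) * X.A p)
      * (Real.log (X.r p) - Real.log r₀) - X.Q p / X.r p ^ 2 * (X.A p - X.B p)) fun p hp => by
      have := hr p hp
      have := (X.P_pos p hp).ne'
      field_simp
      ring
  refine hX.controlled (k := fun x => 1 + Real.log R - Real.log x) (K := K) (L := L + C * N)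
    (fun x hx => hasDerivAt_logGauge R hx.ne') hu hv (fun p hp => ?_) (fun p hp => ?_)
    (fun p hp => zero_le_one.trans (abs_log_sub_le (X.r_pos p hp) (h₀ p hp) hR).2)
  · have hrp := X.r_pos p hp
    obtain ⟨h1, h2⟩ := abs_log_sub_le hrp (h₀ p hp) hR
    rw [abs_mul, mul_div_right_comm]
    gcongr
    exact h p hp
  · have hrp := X.r_pos p hp
    have hQ := X.Q_pos p hp
    have hC := hX.C_pos
    obtain ⟨h1, h2⟩ := abs_log_sub_le hrp (h₀ p hp) hR
    refine (abs_sub _ _).trans ?_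
    rw [add_mul, add_div]
    refine add_le_add ?_ ?_
    · rw [abs_mul, mul_div_right_comm]
      gcongr
      exact h' p hp
    · rw [abs_mul, abs_of_pos (by positivity)]
      calc X.Q p / X.r p ^ 2 * |X.A p - X.B p| ≤ C / X.r p ^ 2 * (N * X.r p) := by
            gcongr
            · exact hX.Q_le p hp
            · exact h'' p hp
        _ = C * N * 1 / X.r p := by field_simp
        _ ≤ _ := by gcongr

/-- Raychaudhuri contributes `-P/r² + P A²/r²` to the logarithmic `u`-derivative of `P / w`, and `-2
log r + (A² + 1) log r` cancels exactly this. In `v` the Raychaudhuri term has `B²` in place of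
`A²`, leaving a multiple of `(A - B)(A + B) / r²`, again `O(1/r)`. -/
theorem Bounds.controlled_logMass (hX : X.Bounds c C)
    (h₀ : ∀ p ∈ X.D, X.r p ≤ r₀) (hR : r₀ ≤ R) :
    X.Controlled (logGauge R) (X.logMass r₀) := by
  obtain ⟨K, hK, h⟩ := hX.exists_Au_le
  obtain ⟨L, hL, h'⟩ := hX.exists_Av_le
  obtain ⟨N, hN, h''⟩ := hX.exists_sub_le
  have hr : ∀ p ∈ X.D, X.r p ≠ 0 := fun p hp => (X.r_pos p hp).ne'
  have hw : ∀ p ∈ X.D, X.w p ≠ 0 := fun p hp => (X.w_pos p hp).ne'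
  have hP : ∀ p ∈ X.D, X.P p ≠ 0 := fun p hp => (X.P_pos p hp).ne'
  have hQ : ∀ p ∈ X.D, X.Q p ≠ 0 := fun p hp => (X.Q_pos p hp).ne'
  have hPQ : ∀ p ∈ X.D, 4 * X.P p * X.Q p ≠ 0 := fun p hp =>
    mul_ne_zero (mul_ne_zero four_ne_zero (hP p hp)) (hQ p hp)
  have hlu : HasU X.D (fun p => Real.log (X.r p) - Real.log r₀) fun p => -(P X p / X.r p) / X.r p :=
    fun p hp => ((X.r_u.log hr) p hp).sub_const _
  have hlv : HasV X.D (fun p => Real.log (X.r p) - Real.log r₀) fun p => -(Q X p / X.r p) / X.r p :=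
    fun p hp => ((X.r_v.log hr) p hp).sub_const _
  have hAu : HasU X.D (fun p => X.A p ^ 2 + 1) fun p => 2 * X.A p * X.Au p := fun p hp =>
    (((X.A_u.pow 2) p hp).add_const 1).congr_deriv (by norm_num)
  have hAv : HasV X.D (fun p => X.A p ^ 2 + 1) fun p => 2 * X.A p *
      (X.Q p / X.r p ^ 2 * (X.B p - X.A p) - X.w p / (4 * X.P p) * X.A p) := fun p hp =>
    (((X.A_v.pow 2) p hp).add_const 1).congr_deriv (by norm_num)
  have hu : HasU X.D (X.logMass r₀) fun p =>
      X.w p / (4 * X.Q p) + 2 * X.A p * X.Au p * (Real.log (X.r p) - Real.log r₀) := fun p hp =>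
    (((((((X.P_u.const_mul 4).mul X.Q_u).log hPQ).sub (X.w_u.log hw)).sub
      ((X.r_u.log hr).const_mul 2)) p hp).fun_add ((hAu.mul hlu) p hp)).congr_deriv (by
        have h1 := hr p hp
        have h2 := hw p hp
        have h3 := hP p hp
        have h4 := hQ p hp
        beta_reduce
        rw [X.ray_u p hp]
        field_simp
        ring)
  have hv : HasV X.D (X.logMass r₀) fun p =>
      X.w p / (4 * X.P p) + 2 * X.A p *
        (X.Q p / X.r p ^ 2 * (X.B p - X.A p) - X.w p / (4 * X.P p) * X.A p) *
          (Real.log (X.r p) - Real.log r₀)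
        - X.Q p / X.r p ^ 2 * (X.A p - X.B p) * (X.A p + X.B p) := fun p hp =>
    (((((((X.P_v.const_mul 4).mul X.Q_v).log hPQ).sub (X.w_v.log hw)).sub
      ((X.r_v.log hr).const_mul 2)) p hp).fun_add ((hAv.mul hlv) p hp)).congr_deriv (by
        have h1 := hr p hp
        have h2 := hw p hp
        have h3 := hP p hp
        have h4 := hQ p hp
        beta_reduce
        rw [X.ray_v p hp]
        field_simp
        ring)
  have hC := hX.C_pos
  have hc := hX.c_pos
  refine hX.controlled (k := fun x => 1 + Real.log R - Real.log x) (K := C / (4 * c) + 2 * C * K)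
    (L := C / (4 * c) + 2 * C * L + C * N * (2 * C))
    (fun x hx => hasDerivAt_logGauge R hx.ne') hu hv (fun p hp => ?_) (fun p hp => ?_)
    (fun p hp => zero_le_one.trans (abs_log_sub_le (X.r_pos p hp) (h₀ p hp) hR).2)
  · have hrp := X.r_pos p hp
    have hwp := X.w_pos p hp
    have hQp := X.Q_pos p hp
    have hcQ := hX.le_Q p hp
    obtain ⟨h1, h2⟩ := abs_log_sub_le hrp (h₀ p hp) hR
    refine (abs_add_le _ _).trans ?_
    rw [add_mul, add_div]
    refine add_le_add ?_ ?_
    · rw [abs_of_pos (by positivity)]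
      calc X.w p / (4 * X.Q p) ≤ (C / X.r p) / (4 * c) := by
            gcongr
            exact hX.w_le p hp
        _ = C / (4 * c) * 1 / X.r p := by ring
        _ ≤ _ := by gcongr
    · rw [abs_mul, abs_mul, abs_mul, abs_two]
      calc 2 * |X.A p| * |X.Au p| * |Real.log (X.r p) - Real.log r₀|
          ≤ 2 * C * (K / X.r p) * (1 + Real.log R - Real.log (X.r p)) := by
            gcongr
            · exact hX.A_le p hp
            · exact h p hp
        _ = _ := by ring
  · have hrp := X.r_pos p hp
    have hwp := X.w_pos p hp
    have hPp := X.P_pos p hp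
    have hQp := X.Q_pos p hp
    have hcP := hX.le_P p hp
    obtain ⟨h1, h2⟩ := abs_log_sub_le hrp (h₀ p hp) hR
    refine (abs_sub _ _).trans ?_
    rw [add_mul, add_div]
    refine add_le_add ((abs_add_le _ _).trans ?_) ?_
    · rw [add_mul, add_div]
      refine add_le_add ?_ ?_
      · rw [abs_of_pos (by positivity)]
        calc X.w p / (4 * X.P p) ≤ (C / X.r p) / (4 * c) := by
              gcongr
              exact hX.w_le p hp
          _ = C / (4 * c) * 1 / X.r p := by ring
          _ ≤ _ := by gcongr
      · rw [abs_mul, abs_mul, abs_mul, abs_two]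
        calc _ ≤ 2 * C * (L / X.r p) * (1 + Real.log R - Real.log (X.r p)) := by
              gcongr
              · exact hX.A_le p hp
              · exact h' p hp
          _ = _ := by ring
    · rw [abs_mul, abs_mul, abs_of_pos (by positivity : 0 < X.Q p / X.r p ^ 2)]
      calc X.Q p / X.r p ^ 2 * |X.A p - X.B p| * |X.A p + X.B p|
          ≤ C / X.r p ^ 2 * (N * X.r p) * (2 * C) := by
            gcongr
            · exact hX.Q_le p hp
            · exact h'' p hp
            · linarith [abs_add_le (X.A p) (X.B p), hX.A_le p hp, hX.B_le p hp]
        _ = C * N * (2 * C) * 1 / X.r p := by field_simp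
        _ ≤ _ := by gcongr

theorem exp_logMass (hr₀ : 0 < r₀) {p : ℝ × ℝ} (hp : p ∈ X.D) :
    4 * X.P p * X.Q p / (X.r p ^ 2 * X.w p)
      = Real.exp (X.logMass r₀ p) * (X.r p / r₀) ^ (-(X.A p ^ 2 + 1)) := by
  have hr := X.r_pos p hp
  have hw := X.w_pos p hp
  have hP := X.P_pos p hp
  have hQ := X.Q_pos p hp
  rw [Real.rpow_def_of_pos (by positivity), ← Real.exp_add, logMass, Real.log_div hr.ne' hr₀.ne']
  rw [show Real.log (4 * X.P p * X.Q p) - Real.log (X.w p) - 2 * Real.log (X.r p)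
      + (X.A p ^ 2 + 1) * (Real.log (X.r p) - Real.log r₀)
      + (Real.log (X.r p) - Real.log r₀) * -(X.A p ^ 2 + 1)
      = Real.log (4 * X.P p * X.Q p) - (2 * Real.log (X.r p) + Real.log (X.w p)) by ring]
  rw [← Real.log_rpow hr, ← Real.log_mul (by positivity) (by positivity),
    ← Real.log_div (by positivity) (by positivity), Real.exp_log (by positivity)]
  norm_num

/-- Hölder regularity with exponent `1/2`. -/
theorem Controlled.isHolder (hX : X.Bounds c C) {f : ℝ × ℝ → ℝ}
    (H : X.Controlled (fun x => x) f) : IsHolder (1 / 2) X.D f := by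
  refine Controlled.hasModulus hX (Gauge.id (C + √(C ^ 3 / c))) (L := √(2 * C))
    (by linarith [Real.sqrt_nonneg (C ^ 3 / c)]) (by linarith [hX.C_pos]) H (fun s _ => ?_)
    fun s _ => by positivity
  have hC := hX.C_pos
  rw [Real.sqrt_mul (by positivity), Real.sqrt_eq_rpow s]

theorem Controlled.isLogHolder (hX : X.Bounds c C) {f : ℝ × ℝ → ℝ}
    (hR : C + √(C ^ 3 / c) ≤ R) (H : X.Controlled (logGauge R) f) :
    IsLogHolder (1 / 2) X.D f := by
  have hC := hX.C_pos
  refine Controlled.hasModulus hX Gauge.log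
    (L := √(2 * C) * (|2 + Real.log R - Real.log (2 * C) / 2| + 1))
    (by linarith [Real.sqrt_nonneg (C ^ 3 / c)]) (by linarith) H (fun s hs => ?_)
    fun s _ => by positivity
  have e : logGauge R √(2 * C * s) = √(2 * C) * s ^ (1 / 2 : ℝ) *
      ((2 + Real.log R - Real.log (2 * C) / 2) - Real.log s / 2) := by
    rw [logGauge, Real.log_sqrt (by positivity), Real.log_mul (by positivity) hs.ne',
      Real.sqrt_mul (by positivity), Real.sqrt_eq_rpow s]
    ring
  rw [e]
  have h1 : 2 + Real.log R - Real.log (2 * C) / 2 - Real.log s / 2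
      ≤ (|2 + Real.log R - Real.log (2 * C) / 2| + 1) * (1 + |Real.log s|) := by
    have h2 := le_abs_self (2 + Real.log R - Real.log (2 * C) / 2)
    have h3 := neg_abs_le (Real.log s)
    have h4 := abs_nonneg (Real.log s)
    have h5 := abs_nonneg (2 + Real.log R - Real.log (2 * C) / 2)
    nlinarith
  calc _ ≤ √(2 * C) * s ^ (1 / 2 : ℝ) *
        ((|2 + Real.log R - Real.log (2 * C) / 2| + 1) * (1 + |Real.log s|)) := by gcongr
    _ = _ := by ring

end NullSolution


/-! ### Regularity of the singular boundary curve -/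

namespace NullSolution

variable {X : NullSolution} {c C : ℝ}

/-- The derivative of `r² + 2 L t` is `-2 (Q - L)`, of size at most `2 e`. The mean value inequality
holds on `[v, t]`, and `t → w` removes `r²` at the far end. -/
theorem abs_sq_sub_le {u v w L e : ℝ} (hv : v < w)
    (hD : ∀ t ∈ Ico v w, (u, t) ∈ X.D)
    (hr : Tendsto (fun t => X.r (u, t)) (𝓝[<] w) (𝓝 0))
    (hL : ∀ t ∈ Ico v w, |X.Q (u, t) - L| ≤ e) :
    |X.r (u, v) ^ 2 - 2 * L * (w - v)| ≤ 2 * e * (w - v) := by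
  have hsq : HasV X.D (fun p => X.r p ^ 2) fun p => -(2 * X.Q p) :=
    (X.r_v.pow 2).congr_deriv fun p hp => by
      have := (X.r_pos p hp).ne'
      field_simp
      norm_num
      ring
  have hseg : ∀ t ∈ Ico v w,
      |X.r (u, v) ^ 2 - X.r (u, t) ^ 2 - 2 * L * (t - v)| ≤ 2 * e * (t - v) := fun t ht => by
    have hsub : Icc v t ⊆ Ico v w := fun s hs => ⟨hs.1, hs.2.trans_lt ht.2⟩
    have := (convex_Icc v t).norm_image_sub_le_of_norm_hasDerivWithin_le
      (f := fun s => X.r (u, s) ^ 2 + 2 * L * s)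
      (f' := fun s => -(2 * X.Q (u, s)) + 2 * L * 1) (C := 2 * e)
      (fun s hs => ((hsq (u, s) (hD s (hsub hs))).mono fun x hx => hD x (hsub hx)).fun_add
        ((hasDerivWithinAt_id s _).const_mul (2 * L)))
      (fun s hs => by
        rw [Real.norm_eq_abs, show -(2 * X.Q (u, s)) + 2 * L * 1 = -(2 * (X.Q (u, s) - L)) by ring,
          abs_neg, abs_mul, abs_two]
        have := hL s (hsub hs)
        linarith) (left_mem_Icc.2 ht.1) (right_mem_Icc.2 ht.1)
    rw [Real.norm_eq_abs, Real.norm_eq_abs, abs_of_nonneg (sub_nonneg.2 ht.1), abs_sub_comm] at this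
    refine le_of_eq_of_le ?_ this
    congr 1
    ring
  have hid : Tendsto (fun t : ℝ => t) (𝓝[<] w) (𝓝 w) := tendsto_id.mono_left inf_le_left
  have h1 : Tendsto (fun t => |X.r (u, v) ^ 2 - X.r (u, t) ^ 2 - 2 * L * (t - v)|) (𝓝[<] w)
      (𝓝 |X.r (u, v) ^ 2 - 0 ^ 2 - 2 * L * (w - v)|) :=
    (((hr.pow 2).const_sub _).sub ((hid.sub_const v).const_mul (2 * L))).abs
  have h2 : Tendsto (fun t => 2 * e * (t - v)) (𝓝[<] w) (𝓝 (2 * e * (w - v))) :=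
    (hid.sub_const v).const_mul _
  have := le_of_tendsto_of_tendsto h1 h2 (by
    filter_upwards [Ico_mem_nhdsLT hv] with t ht using hseg t ht)
  simpa using this

theorem le_extendFrom_le {f : ℝ × ℝ → ℝ} (hf : UniformContinuousOn f X.D)
    (hcf : ∀ p ∈ X.D, c ≤ f p) (hfC : ∀ p ∈ X.D, f p ≤ C) {p : ℝ × ℝ} (hp : p ∈ closure X.D) :
    c ≤ extendFrom X.D f p ∧ extendFrom X.D f p ≤ C := by
  have : (𝓝[X.D] p).NeBot := mem_closure_iff_nhdsWithin_neBot.1 hp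
  have hlim := tendsto_extendFrom (UniformContinuousOn.exists_tendsto hf hp)
  exact ⟨ge_of_tendsto hlim (eventually_nhdsWithin_of_forall hcf),
    le_of_tendsto hlim (eventually_nhdsWithin_of_forall hfC)⟩

end NullSolution

namespace IsStronglySingular

variable {u₀ u₁ v₀ v₁ uS : ℝ} {D : Set (ℝ × ℝ)} {F : Fields} {vStar : ℝ → ℝ}

theorem mem_of_lt (hs : IsStronglySingular u₀ u₁ v₀ v₁ D F uS vStar) {u v : ℝ}
    (hu : u ∈ Icc uS u₁) (hv₀ : v₀ ≤ v) (hv : v < vStar u) : (u, v) ∈ D := by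
  rw [hs.domain_eq]
  have h1 : vStar u ≤ v₁ := by
    rw [← hs.vStar_uS]
    exact hs.strictAntiOn_vStar.antitoneOn ⟨le_rfl, hs.uS_mem.2.le⟩ hu hu.1
  exact ⟨⟨⟨hs.uS_mem.1.le.trans hu.1, hu.2⟩, hv₀, hv.le.trans h1⟩, fun _ => hv⟩

/-- The straight segment from `q` to `p` runs inside the future of `q` and, before its endpoint,
below the curve, because `vStar` is strictly decreasing. -/
theorem mem_closure (hs : IsStronglySingular u₀ u₁ v₀ v₁ D F uS vStar) {p q : ℝ × ℝ}
    (hp : p ∈ singularBoundary uS u₁ vStar) (hq : q ∈ D) (h1 : q.1 ≤ p.1) (h2 : q.2 ≤ p.2) :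
    p ∈ closure (D ∩ Ici q) := by
  obtain ⟨hp1, hp2⟩ := hp
  have hq' := hq
  rw [hs.domain_eq] at hq'
  have hvle : ∀ u, uS ≤ u → u ≤ u₁ → vStar u ≤ v₁ := fun u h3 h4 => by
    rw [← hs.vStar_uS]
    exact hs.strictAntiOn_vStar.antitoneOn ⟨le_rfl, hs.uS_mem.2.le⟩ ⟨h3, h4⟩ h3
  have hγ : Tendsto (fun t : ℝ => (q.1 + t * (p.1 - q.1), q.2 + t * (p.2 - q.2))) (𝓝[<] 1)
      (𝓝 p) := by
    have : Continuous fun t : ℝ => (q.1 + t * (p.1 - q.1), q.2 + t * (p.2 - q.2)) := by fun_prop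
    have h3 := (this.tendsto 1).mono_left (nhdsWithin_le_nhds (s := Iio 1))
    simpa using h3
  refine mem_closure_of_tendsto hγ ?_
  filter_upwards [Ioo_mem_nhdsLT (zero_lt_one' ℝ)] with t ht
  have d1 : 0 ≤ t * (p.1 - q.1) := mul_nonneg ht.1.le (sub_nonneg.2 h1)
  have d2 : 0 ≤ t * (p.2 - q.2) := mul_nonneg ht.1.le (sub_nonneg.2 h2)
  have e1 : q.1 + t * (p.1 - q.1) ≤ p.1 := by nlinarith [ht.2]
  have e2 : q.2 + t * (p.2 - q.2) ≤ p.2 := by nlinarith [ht.2]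
  refine ⟨?_, ⟨by dsimp only; linarith, by dsimp only; linarith⟩⟩
  rw [hs.domain_eq]
  refine ⟨⟨⟨by dsimp only; linarith [hq'.1.1.1], e1.trans hp1.2⟩,
    by dsimp only; linarith [hq'.1.2.1], e2.trans (hp2 ▸ hvle _ hp1.1 hp1.2)⟩, fun h3 => ?_⟩
  dsimp only at h3 ⊢
  rcases h1.eq_or_lt with h4 | h4
  · have h5 : q.2 < p.2 := by
      have := hq'.2 (h4 ▸ hp1.1)
      rwa [h4, ← hp2] at this
    rw [h4, sub_self, mul_zero, add_zero, ← hp2]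
    nlinarith [ht.2]
  · have h5 : q.1 + t * (p.1 - q.1) < p.1 := by nlinarith [ht.2]
    have h6 := hs.strictAntiOn_vStar ⟨h3, e1.trans hp1.2⟩ hp1 h5
    linarith

theorem subset_closure (hs : IsStronglySingular u₀ u₁ v₀ v₁ D F uS vStar)
    (hin : ∀ u ∈ Icc u₀ u₁, (u, v₀) ∈ D) : singularBoundary uS u₁ vStar ⊆ closure D := by
  intro p hp
  have h1 := hin p.1 ⟨hs.uS_mem.1.le.trans hp.1.1, hp.1.2⟩
  have h2 := h1
  rw [hs.domain_eq] at h2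
  refine closure_mono inter_subset_left (hs.mem_closure hp h1 le_rfl ?_)
  have := h2.2 hp.1.1
  exact (hp.2 ▸ this).le

variable {X : NullSolution} {c C : ℝ}

/-- Second-order expansion of the singular boundary curve. -/
theorem exists_vStar_expansion (hX : X.Bounds c C)
    (hs : IsStronglySingular X.u₀ u₁ X.v₀ v₁ X.D F uS vStar) (hF : F.r = X.r)
    (hin : ∀ u ∈ Icc X.u₀ u₁, (u, X.v₀) ∈ X.D) {g : ℝ → ℝ}
    (hg : ∀ u, g u = extendFrom X.D X.P (u, vStar u) / extendFrom X.D X.Q (u, vStar u)) :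
    ∃ M, 0 < M ∧ ∀ u ∈ Icc uS u₁, ∀ u' ∈ Icc uS u₁, u < u' →
      |vStar u - vStar u' - g u * (u' - u)| ≤ M * √(u' - u) * (u' - u) ∧
      |vStar u - vStar u' - g u' * (u' - u)| ≤ M * √(u' - u) * (u' - u) ∧
      |g u - g u'| ≤ M * √(u' - u) := by
  have hgauge := Gauge.id (C + √(C ^ 3 / c))
  have hR1 : C ≤ C + √(C ^ 3 / c) := by linarith [Real.sqrt_nonneg (C ^ 3 / c)]
  have hR2 : √(C ^ 3 / c) ≤ C + √(C ^ 3 / c) := by linarith [hX.C_pos]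
  obtain ⟨K₁, hK₁, h₁⟩ := hX.controlled_P.abs_sub_extendFrom_le hX hgauge hR1 hR2
  obtain ⟨K₂, hK₂, h₂⟩ := hX.controlled_Q.abs_sub_extendFrom_le hX hgauge hR1 hR2
  have hc := hX.c_pos
  have hC := hX.C_pos
  set K := K₁ + K₂ with hK
  have hKpos : 0 < K := by positivity
  -- The first summand comes from the expansion with the mixed slope `a' / b`, the second from
  -- replacing that slope by the one at a single point, and `√(2 C)` from `ρ ≤ √(2 C (u' - u))`.
  refine ⟨((K * (1 + C / c)) / c + 4 * K * C / c ^ 2) * √(2 * C), by positivity, ?_⟩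
  intro u hu u' hu' huu
  set p : ℝ × ℝ := (u, vStar u) with hp
  set p' : ℝ × ℝ := (u', vStar u') with hp'
  have hpS : p ∈ singularBoundary uS u₁ vStar := ⟨hu, rfl⟩
  have hpS' : p' ∈ singularBoundary uS u₁ vStar := ⟨hu', rfl⟩
  have hvv : vStar u' < vStar u := hs.strictAntiOn_vStar hu hu' huu
  have hv₀' : X.v₀ < vStar u' := by
    have := hin u' ⟨hs.uS_mem.1.le.trans hu'.1, hu'.2⟩
    rw [hs.domain_eq] at this
    exact this.2 hu'.1
  have hmem_v : ∀ t ∈ Ico (vStar u') (vStar u), (u, t) ∈ X.D := fun t ht =>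
    hs.mem_of_lt hu (hv₀'.le.trans ht.1) ht.2
  have hmem_u : ∀ s ∈ Ico u u', (s, vStar u') ∈ X.D := fun s hs' =>
    hs.mem_of_lt ⟨hu.1.trans hs'.1, hs'.2.le.trans hu'.2⟩ hv₀'.le
      (hs.strictAntiOn_vStar ⟨hu.1.trans hs'.1, hs'.2.le.trans hu'.2⟩ hu' hs'.2)
  -- The common past corner of `p` and `p'`. Integrating `r²` from here in `v` up to `p` and in `u`
  -- up to `p'` gives `r(q)²` as `2 b Δv` and as `2 a' Δu`, each up to `O(r(q))` times the length.
  set q : ℝ × ℝ := (u, vStar u') with hq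
  have hqD : q ∈ X.D := hmem_v _ ⟨le_rfl, hvv⟩
  have hrq := X.r_pos q hqD
  have hu₀ : X.u₀ ≤ u := hs.uS_mem.1.le.trans hu.1
  have hr_v : Tendsto (fun t => X.r (u, t)) (𝓝[<] vStar u) (𝓝 0) := by
    have h3 := hs.tendsto_r p hpS
    rw [hF] at h3
    refine h3.comp (tendsto_nhdsWithin_iff.2 ⟨?_, ?_⟩)
    · exact ((Continuous.prodMk_right u).tendsto (vStar u)).mono_left nhdsWithin_le_nhds
    · filter_upwards [Ico_mem_nhdsLT hvv] with t ht using hmem_v t ht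
  have hr_u : Tendsto (fun s => X.r (s, vStar u')) (𝓝[<] u') (𝓝 0) := by
    have h3 := hs.tendsto_r p' hpS'
    rw [hF] at h3
    refine h3.comp (tendsto_nhdsWithin_iff.2 ⟨?_, ?_⟩)
    · exact ((Continuous.prodMk_left (vStar u')).tendsto u').mono_left nhdsWithin_le_nhds
    · filter_upwards [Ico_mem_nhdsLT huu] with t ht using hmem_u t ht
  set ρ := X.r q with hρ
  set a := extendFrom X.D X.P p
  set a' := extendFrom X.D X.P p'
  set b := extendFrom X.D X.Q p
  set b' := extendFrom X.D X.Q p'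
  have hΔu : 0 < u' - u := sub_pos.2 huu
  have hΔv : 0 < vStar u - vStar u' := sub_pos.2 hvv
  have hcl := hs.mem_closure hpS hqD le_rfl hvv.le
  have hcl' := hs.mem_closure hpS' hqD huu.le le_rfl
  have hKa : ∀ {x y}, |x - y| ≤ K₁ * ρ → |x - y| ≤ K * ρ := fun h =>
    h.trans (by gcongr; linarith)
  have hKb : ∀ {x y}, |x - y| ≤ K₂ * ρ → |x - y| ≤ K * ρ := fun h =>
    h.trans (by gcongr; linarith)
  have Pa := hKa (h₁ p q hqD hcl)
  have Pa' := hKa (h₁ p' q hqD hcl')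
  have Qb := hKb (h₂ p q hqD hcl)
  have Qb' := hKb (h₂ p' q hqD hcl')
  have haa : |a - a'| ≤ 2 * (K * ρ) := by
    rw [abs_sub_comm] at Pa
    linarith [abs_sub_le a (X.P q) a']
  have hbb : |b - b'| ≤ 2 * (K * ρ) := by
    rw [abs_sub_comm] at Qb
    linarith [abs_sub_le b (X.Q q) b']
  have E1 : |ρ ^ 2 - 2 * b * (vStar u - vStar u')| ≤ 2 * (K * ρ) * (vStar u - vStar u') :=
    NullSolution.abs_sq_sub_le hvv hmem_v hr_v fun t ht => by
      have ht' := hmem_v t ht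
      refine (h₂ p (u, t) ht' (hs.mem_closure hpS ht' le_rfl ht.2.le)).trans ?_
      have := NullSolution.r_anti_v ht' hv₀'.le ht.1
      have := X.r_pos _ ht'
      gcongr
      linarith
  have E2 : |ρ ^ 2 - 2 * a' * (u' - u)| ≤ 2 * (K * ρ) * (u' - u) :=
    NullSolution.abs_sq_sub_le (X := X.swap) (u := vStar u') huu hmem_u hr_u fun s hs' => by
      have ht' := hmem_u s hs'
      refine (h₁ p' (s, vStar u') ht' (hs.mem_closure hpS' ht' hs'.2.le le_rfl)).trans ?_
      have : X.r (s, vStar u') ≤ X.r (u, vStar u') :=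
        NullSolution.r_anti_v (X := X.swap) (u := vStar u') ht' hu₀ hs'.1
      have := X.r_pos _ ht'
      gcongr
      linarith
  -- With the midpoint and half-width of `[c, C]`, the same lemma returns the crude two-sided
  -- comparison of `ρ²` with the coordinate lengths.
  have E3 := NullSolution.abs_sq_sub_le (X := X) (L := (c + C) / 2) (e := (C - c) / 2)
    hvv hmem_v hr_v fun t ht => by
      rw [abs_le]
      constructor <;> linarith [hX.le_Q _ (hmem_v t ht), hX.Q_le _ (hmem_v t ht)]
  have E4 : |ρ ^ 2 - 2 * ((c + C) / 2) * (u' - u)| ≤ 2 * ((C - c) / 2) * (u' - u) :=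
    NullSolution.abs_sq_sub_le (X := X.swap) (u := vStar u') huu hmem_u hr_u fun t ht => by
      have h3 : c ≤ X.swap.Q (vStar u', t) := hX.le_P _ (hmem_u t ht)
      have h4 : X.swap.Q (vStar u', t) ≤ C := hX.P_le _ (hmem_u t ht)
      rw [abs_le]
      constructor <;> linarith
  have hρu : ρ ^ 2 ≤ 2 * C * (u' - u) := by linarith [(abs_le.1 E4).2]
  have hρv : 2 * c * (vStar u - vStar u') ≤ ρ ^ 2 := by
    have := (abs_le.1 E3).1
    have e : X.r (u, vStar u') = ρ := rfl
    rw [e] at this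
    linarith
  have hvle : vStar u - vStar u' ≤ C / c * (u' - u) := by
    rw [div_mul_eq_mul_div, le_div_iff₀ hc]
    linarith
  have hρs : ρ ≤ √(2 * C) * √(u' - u) := by
    rw [← Real.sqrt_mul (by positivity)]
    exact Real.le_sqrt_of_sq_le hρu
  have huP := hX.controlled_P.uniformContinuousOn hX hgauge hR2
  have huQ := hX.controlled_Q.uniformContinuousOn hX hgauge hR2
  have hScl := hs.subset_closure hin
  have ba := NullSolution.le_extendFrom_le huP hX.le_P hX.P_le (hScl hpS)
  have ba' := NullSolution.le_extendFrom_le huP hX.le_P hX.P_le (hScl hpS')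
  have bb := NullSolution.le_extendFrom_le huQ hX.le_Q hX.Q_le (hScl hpS)
  have bb' := NullSolution.le_extendFrom_le huQ hX.le_Q hX.Q_le (hScl hpS')
  have hb : 0 < b := hc.trans_le bb.1
  have hb' : 0 < b' := hc.trans_le bb'.1
  have ha : 0 < a := hc.trans_le ba.1
  have ha' : 0 < a' := hc.trans_le ba'.1
  have hmid : |vStar u - vStar u' - a' / b * (u' - u)| ≤ K * (1 + C / c) / c * ρ * (u' - u) := by
    have e : vStar u - vStar u' - a' / b * (u' - u)
        = (b * (vStar u - vStar u') - a' * (u' - u)) / b := by field_simp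
    rw [e, abs_div, abs_of_pos hb, div_le_iff₀ hb]
    have h3 : |b * (vStar u - vStar u') - a' * (u' - u)|
        ≤ K * ρ * ((vStar u - vStar u') + (u' - u)) := by
      rw [abs_le] at E1 E2 ⊢
      constructor <;> linarith
    refine h3.trans ?_
    calc K * ρ * ((vStar u - vStar u') + (u' - u))
        ≤ K * ρ * (C / c * (u' - u) + (u' - u)) := by gcongr
      _ = K * (1 + C / c) / c * ρ * (u' - u) * c := by field_simp; ring
      _ ≤ _ := by gcongr; exact bb.1
  have hquot : ∀ {x x' y y' : ℝ}, 0 < y → 0 < y' → c ≤ y → c ≤ y' → y' ≤ C → 0 < x' → x' ≤ C →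
      |x - x'| ≤ 2 * (K * ρ) → |y - y'| ≤ 2 * (K * ρ) →
      |x / y - x' / y'| ≤ 4 * K * C / c ^ 2 * ρ := by
    intro x x' y y' hy hy' hcy hcy' hyC hx' hxC h3 h4
    have e : x / y - x' / y' = ((x - x') * y' + x' * (y' - y)) / (y * y') := by
      field_simp
      ring
    rw [e, abs_div, abs_of_pos (mul_pos hy hy'), div_le_iff₀ (mul_pos hy hy')]
    rw [abs_sub_comm] at h4
    calc |(x - x') * y' + x' * (y' - y)| ≤ |x - x'| * y' + x' * |y' - y| := by
          refine (abs_add_le _ _).trans ?_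
          rw [abs_mul, abs_mul, abs_of_pos hy', abs_of_pos hx']
      _ ≤ 2 * (K * ρ) * C + C * (2 * (K * ρ)) := by gcongr
      _ = 4 * K * C / c ^ 2 * ρ * (c * c) := by field_simp; ring
      _ ≤ _ := by gcongr
  have g1 : |a' / b - a / b| ≤ 4 * K * C / c ^ 2 * ρ :=
    hquot hb hb bb.1 bb.1 bb.2 ha ba.2 (by rwa [abs_sub_comm]) (by simp; positivity)
  have g2 : |a' / b - a' / b'| ≤ 4 * K * C / c ^ 2 * ρ :=
    hquot hb hb' bb.1 bb'.1 bb'.2 ha' ba'.2 (by simp; positivity) hbb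
  have g3 : |a / b - a' / b'| ≤ 4 * K * C / c ^ 2 * ρ :=
    hquot hb hb' bb.1 bb'.1 bb'.2 ha' ba'.2 haa hbb
  have hfin : ∀ y, |a' / b - y| ≤ 4 * K * C / c ^ 2 * ρ →
      |vStar u - vStar u' - y * (u' - u)|
        ≤ ((K * (1 + C / c)) / c + 4 * K * C / c ^ 2) * √(2 * C) * √(u' - u) * (u' - u) := by
    intro y hy
    calc |vStar u - vStar u' - y * (u' - u)|
        = |(vStar u - vStar u' - a' / b * (u' - u)) + (a' / b - y) * (u' - u)| := by
          congr 1; ring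
      _ ≤ |vStar u - vStar u' - a' / b * (u' - u)| + |a' / b - y| * (u' - u) := by
          refine (abs_add_le _ _).trans ?_
          rw [abs_mul (a' / b - y), abs_of_pos hΔu]
      _ ≤ K * (1 + C / c) / c * ρ * (u' - u) + 4 * K * C / c ^ 2 * ρ * (u' - u) := by gcongr
      _ = ((K * (1 + C / c)) / c + 4 * K * C / c ^ 2) * ρ * (u' - u) := by ring
      _ ≤ ((K * (1 + C / c)) / c + 4 * K * C / c ^ 2) * (√(2 * C) * √(u' - u)) * (u' - u) := by
          gcongr
      _ = _ := by ring
  refine ⟨?_, ?_, ?_⟩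
  · rw [hg]; exact hfin _ g1
  · rw [hg]; exact hfin _ g2
  · rw [hg, hg]
    refine g3.trans ?_
    calc 4 * K * C / c ^ 2 * ρ
        ≤ ((K * (1 + C / c)) / c + 4 * K * C / c ^ 2) * (√(2 * C) * √(u' - u)) := by
          gcongr
          have : 0 ≤ (K * (1 + C / c)) / c := by positivity
          linarith
      _ = _ := by ring

end IsStronglySingular

/-- A function with a first-order expansion whose remainder has exponent `3/2` is of class
`C^{1,1/2}`. -/
theorem contDiffOn_of_expansion {a b : ℝ} (hab : a < b) {f g : ℝ → ℝ} {M : ℝ}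
    (hM : 0 < M) (h : ∀ u ∈ Icc a b, ∀ u' ∈ Icc a b, u < u' →
      |f u - f u' - g u * (u' - u)| ≤ M * √(u' - u) * (u' - u) ∧
      |f u - f u' - g u' * (u' - u)| ≤ M * √(u' - u) * (u' - u) ∧
      |g u - g u'| ≤ M * √(u' - u)) :
    ContDiffOn ℝ 1 f (Icc a b) ∧
      ∃ K : NNReal, HolderOnWith K (1 / 2) (derivWithin f (Icc a b)) (Icc a b) := by
  -- The expansion based at `u` serves points to its right, the one based at `u'` points to its
  -- left; the sign comes from the decreasing convention `f u - f u'`.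
  have hd : ∀ u ∈ Icc a b, HasDerivWithinAt f (-g u) (Icc a b) u := by
    intro u hu
    have hbound : ∀ x ∈ Icc a b, |f x - f u - (x - u) • -g u| ≤ M * √|x - u| * |x - u| := by
      intro x hx
      rcases lt_trichotomy x u with hxu | rfl | hxu
      · have := (h x hx u hu hxu).2.1
        rw [abs_sub_comm x u, abs_of_pos (sub_pos.2 hxu)]
        refine le_of_eq_of_le ?_ this
        congr 1
        simp only [smul_eq_mul]
        ring
      · simp
      · have := (h u hu x hx hxu).1
        rw [abs_of_pos (sub_pos.2 hxu)]
        refine le_of_eq_of_le ?_ this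
        rw [← abs_neg]
        congr 1
        simp only [smul_eq_mul]
        ring
    rw [hasDerivWithinAt_iff_isLittleO, Asymptotics.isLittleO_iff]
    intro ε hε
    have hcont : Tendsto (fun x => M * √|x - u|) (𝓝[Icc a b] u) (𝓝 0) := by
      have : Continuous fun x => M * √|x - u| := by fun_prop
      have := (this.tendsto u).mono_left (nhdsWithin_le_nhds (s := Icc a b))
      simpa using this
    filter_upwards [self_mem_nhdsWithin, hcont.eventually (gt_mem_nhds hε)] with x hx hxε
    rw [Real.norm_eq_abs, Real.norm_eq_abs]
    refine (hbound x hx).trans ?_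
    gcongr
  have hud := uniqueDiffOn_Icc hab
  have hholder : HolderOnWith M.toNNReal (1 / 2) (derivWithin f (Icc a b)) (Icc a b) := by
    intro x hx y hy
    rw [(hd x hx).derivWithin (hud x hx), (hd y hy).derivWithin (hud y hy), edist_dist, edist_dist,
      ENNReal.ofReal_rpow_of_nonneg dist_nonneg (by positivity), ← ENNReal.ofReal_coe_nnreal,
      ← ENNReal.ofReal_mul (by positivity), Real.coe_toNNReal _ hM.le]
    refine ENNReal.ofReal_le_ofReal ?_
    have key : |g x - g y| ≤ M * √|x - y| := by
      rcases lt_trichotomy x y with hxy | rfl | hxy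
      · rw [abs_sub_comm x y, abs_of_pos (sub_pos.2 hxy)]
        exact (h x hx y hy hxy).2.2
      · simp
      · rw [abs_sub_comm, abs_of_pos (sub_pos.2 hxy)]
        exact (h y hy x hx hxy).2.2
    rw [Real.dist_eq, Real.dist_eq, neg_sub_neg, abs_sub_comm]
    rw [Real.sqrt_eq_rpow] at key
    simpa using key
  refine ⟨?_, _, hholder⟩
  rw [contDiffOn_one_iff_derivWithin hud]
  exact ⟨fun u hu => (hd u hu).differentiableWithinAt,
    hholder.continuousOn (by norm_num)⟩


/-! ### Coordinate derivatives on the four-dimensional spacetime -/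

/-- `y` is the family of coordinate derivatives of `f` within `M` at `x`. -/
def HasPd (M : Set (Fin 4 → ℝ)) (f : (Fin 4 → ℝ) → ℝ) (y : Fin 4 → ℝ) (x : Fin 4 → ℝ) : Prop :=
  ∃ L : (Fin 4 → ℝ) →L[ℝ] ℝ, HasFDerivWithinAt f L M x ∧ ∀ i, L (Pi.single i 1) = y i

section Pd

variable {M : Set (Fin 4 → ℝ)} {f g : (Fin 4 → ℝ) → ℝ} {y z : Fin 4 → ℝ} {x : Fin 4 → ℝ}

theorem HasPd.pd_eq (hf : HasPd M f y x) (hM : UniqueDiffWithinAt ℝ M x) (i : Fin 4) :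
    pd M i f x = y i := by
  obtain ⟨L, hL, h⟩ := hf
  rw [pd, hL.fderivWithin hM, h]

theorem HasPd.congr (hf : HasPd M f y x) (hx : x ∈ M) (e : ∀ t ∈ M, g t = f t) :
    HasPd M g y x := by
  obtain ⟨L, hL, h⟩ := hf
  exact ⟨L, hL.congr e (e x hx), h⟩

theorem HasPd.congr_deriv (hf : HasPd M f y x) (e : ∀ i, y i = z i) : HasPd M f z x := by
  obtain ⟨L, hL, h⟩ := hf
  exact ⟨L, hL, fun i => (h i).trans (e i)⟩

theorem hasPd_const (c : ℝ) : HasPd M (fun _ => c) (fun _ => 0) x :=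
  ⟨0, hasFDerivWithinAt_const c x M, fun _ => rfl⟩

theorem HasPd.mul (hf : HasPd M f y x) (hg : HasPd M g z x) :
    HasPd M (fun t => f t * g t) (fun i => y i * g x + f x * z i) x := by
  obtain ⟨L, hL, h⟩ := hf
  obtain ⟨L', hL', h'⟩ := hg
  refine ⟨_, hL.mul hL', fun i => ?_⟩
  simp [h, h']
  ring

theorem HasPd.comp {k : ℝ → ℝ} {k' : ℝ} (hf : HasPd M f y x) (hk : HasDerivAt k k' (f x)) :
    HasPd M (fun t => k (f t)) (fun i => k' * y i) x := by
  obtain ⟨L, hL, h⟩ := hf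
  refine ⟨_, hk.comp_hasFDerivWithinAt x hL, fun i => ?_⟩
  simp [h]

theorem HasPd.div (hf : HasPd M f y x) (hg : HasPd M g z x) (h0 : g x ≠ 0) :
    HasPd M (fun t => f t / g t) (fun i => (y i * g x - f x * z i) / g x ^ 2) x := by
  have := (hf.mul (hg.comp (hasDerivAt_inv h0))).congr_deriv
    (z := fun i => (y i * g x - f x * z i) / g x ^ 2) fun i => by
      field_simp
      ring
  simpa only [div_eq_mul_inv] using this

theorem hasPd_coord (j : Fin 4) : HasPd M (fun t => t j) (Pi.single j 1) x :=
  ⟨ContinuousLinearMap.proj j, hasFDerivWithinAt_apply j x M, fun i => by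
    simp [Pi.single_apply, eq_comm]⟩

theorem hasPd_pullback {D : Set (ℝ × ℝ)} {G : ℝ × ℝ → ℝ} (hx : x ∈ spacetime D)
    (hG : ContDiffOn ℝ 1 G D) :
    HasPd (spacetime D) (fun t => G (t 0, t 1))
      ![du D G (x 0, x 1), dv D G (x 0, x 1), 0, 0] x := by
  have h1 := (hG.differentiableOn one_ne_zero _ hx.1).hasFDerivWithinAt
  let π : (Fin 4 → ℝ) →L[ℝ] ℝ × ℝ :=
    (ContinuousLinearMap.proj 0).prod (ContinuousLinearMap.proj 1)
  have h2 : HasFDerivWithinAt (fun t => G (t 0, t 1)) _ (spacetime D) x :=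
    HasFDerivWithinAt.comp x (f := π) h1 π.hasFDerivWithinAt fun t ht => ht.1
  refine ⟨_, h2, fun i => ?_⟩
  fin_cases i <;> simp [π, du, dv]
  · exact map_zero _
  · exact map_zero _

end Pd

section Table

/-- The connection matrices `Γ^a_{c e}` of a spherically symmetric metric in double null
coordinates, as a linear function of their independent components. -/
def conn (y : Fin 10 → ℝ) (c : Fin 4) : Matrix (Fin 4) (Fin 4) ℝ :=
  ![!![y 0, 0, 0, 0; 0, 0, 0, 0; 0, 0, y 2, 0; 0, 0, 0, y 2],
    !![0, 0, 0, 0; 0, y 1, 0, 0; 0, 0, y 3, 0; 0, 0, 0, y 3],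
    !![0, 0, y 5, 0; 0, 0, y 4, 0; y 2, y 3, 0, 0; 0, 0, 0, y 9],
    !![0, 0, 0, y 7; 0, 0, 0, y 6; 0, 0, 0, y 8; y 2, y 3, y 9, 0]] c

/-- Each entry of `conn` is zero or one of the ten components, so differentiation acts entrywise. -/
theorem hasPd_conn {M : Set (Fin 4 → ℝ)} {Y : (Fin 4 → ℝ) → Fin 10 → ℝ}
    {Z : Fin 4 → Fin 10 → ℝ} {x : Fin 4 → ℝ}
    (h : ∀ j, HasPd M (fun t => Y t j) (fun i => Z i j) x) (k a b : Fin 4) :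
    HasPd M (fun t => conn (Y t) k a b) (fun i => conn (Z i) k a b) x := by
  fin_cases k <;> fin_cases a <;> fin_cases b <;>
    first | exact hasPd_const 0 | exact h _

/-- The exchange of the two null indices. -/
def flip : Fin 4 → Fin 4 := ![1, 0, 2, 3]

/-- The metric coefficients `g_{a, flip a}`. -/
noncomputable def lower (w r s : ℝ) : Fin 4 → ℝ := ![-w / 2, -w / 2, r ^ 2, r ^ 2 * s ^ 2]

variable (F : Fields) (x : Fin 4 → ℝ)

theorem metric_apply (a b : Fin 4) : metric F x a b =
    if b = flip a then lower (F.Ωsq (x 0, x 1)) (F.r (x 0, x 1)) (Real.sin (x 2)) a else 0 := by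
  fin_cases a <;> fin_cases b <;> simp [metric, flip, lower]

theorem metric_inv (hw : F.Ωsq (x 0, x 1) ≠ 0) (hr : F.r (x 0, x 1) ≠ 0)
    (hs : Real.sin (x 2) ≠ 0) : (metric F x)⁻¹ = Matrix.of fun a b =>
      if b = flip a then
        (lower (F.Ωsq (x 0, x 1)) (F.r (x 0, x 1)) (Real.sin (x 2)) a)⁻¹ else 0 := by
  refine Matrix.inv_eq_right_inv ?_
  ext a b
  rw [Matrix.mul_apply]
  simp only [metric_apply, Matrix.of_apply]
  fin_cases a <;> fin_cases b <;>
    simp [Fin.sum_univ_four, flip, lower] <;> field_simp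

end Table


/-! ### Algebra of the curvature two-forms -/

section Curvature

/-- The curvature two-forms computed from connection matrices `conn Y` with derivatives
`conn (Z i)`. -/
def curv (Y : Fin 10 → ℝ) (Z : Fin 4 → Fin 10 → ℝ) (c d : Fin 4) : Matrix (Fin 4) (Fin 4) ℝ :=
  conn (Z c) d - conn (Z d) c + (conn Y c * conn Y d - conn Y d * conn Y c)

variable (r w p q k e m n s c a b a' b' : ℝ)

/-- The components of the Christoffel symbols; `p = ∂_u r`, `q = ∂_v r`, `a = ∂_u log Ω²`,
`b = ∂_v log Ω²`. -/
noncomputable def connVal : Fin 10 → ℝ :=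
  ![a, b, p / r, q / r, 2 * r * p / w, 2 * r * q / w, 2 * r * p / w * s ^ 2,
    2 * r * q / w * s ^ 2, -(s * c), c / s]

/-- The derivatives of the components of the Christoffel symbols; `e`, `m`, `n` stand for the
components of the Hessian of `r` divided by `r`, and `k = ∂_u ∂_v log Ω²`. -/
noncomputable def connDer : Fin 4 → Fin 10 → ℝ :=
  ![![a', k, a * p / r + m - p ^ 2 / r ^ 2, e - p * q / r ^ 2,
      2 * p ^ 2 / w + 2 * r ^ 2 * m / w, 2 * p * q / w + 2 * r ^ 2 * e / w - 2 * a * r * q / w,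
      (2 * p ^ 2 / w + 2 * r ^ 2 * m / w) * s ^ 2,
      (2 * p * q / w + 2 * r ^ 2 * e / w - 2 * a * r * q / w) * s ^ 2, 0, 0],
    ![k, b', e - p * q / r ^ 2, b * q / r + n - q ^ 2 / r ^ 2,
      2 * p * q / w + 2 * r ^ 2 * e / w - 2 * b * r * p / w, 2 * q ^ 2 / w + 2 * r ^ 2 * n / w,
      (2 * p * q / w + 2 * r ^ 2 * e / w - 2 * b * r * p / w) * s ^ 2,
      (2 * q ^ 2 / w + 2 * r ^ 2 * n / w) * s ^ 2, 0, 0],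
    ![0, 0, 0, 0, 0, 0, 2 * r * p / w * (2 * s * c), 2 * r * q / w * (2 * s * c),
      s ^ 2 - c ^ 2, -(1 / s ^ 2)],
    0]

/-- The curvature two-forms of a spherically symmetric metric, as matrices indexed by the two
form indices. -/
noncomputable def curvTable : Fin 4 → Fin 4 → Matrix (Fin 4) (Fin 4) ℝ :=
  ![![0, !![-k, 0, 0, 0; 0, k, 0, 0; 0, 0, 0, 0; 0, 0, 0, 0],
      !![0, 0, 2 * r ^ 2 * e / w, 0; 0, 0, 2 * r ^ 2 * m / w, 0; m, e, 0, 0; 0, 0, 0, 0],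
      !![0, 0, 0, 2 * r ^ 2 * e / w * s ^ 2; 0, 0, 0, 2 * r ^ 2 * m / w * s ^ 2; 0, 0, 0, 0;
        m, e, 0, 0]],
    ![0, 0, !![0, 0, 2 * r ^ 2 * n / w, 0; 0, 0, 2 * r ^ 2 * e / w, 0; e, n, 0, 0; 0, 0, 0, 0],
      !![0, 0, 0, 2 * r ^ 2 * n / w * s ^ 2; 0, 0, 0, 2 * r ^ 2 * e / w * s ^ 2; 0, 0, 0, 0;
        e, n, 0, 0]],
    ![0, 0, 0, !![0, 0, 0, 0; 0, 0, 0, 0; 0, 0, 0, s ^ 2 * (1 + 4 * p * q / w);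
      0, 0, -(1 + 4 * p * q / w), 0]],
    0]

variable {r w s c}

/-- With the second derivatives of `r` written through its Hessian, all dependence on `a`, `b` and
their derivatives `a'`, `b'` cancels; only `k`, `e`, `m`, `n` and `1 + 4 p q / w` survive. -/
theorem curv_eq (hr : r ≠ 0) (hw : w ≠ 0) (hs : s ≠ 0) (hsc : c ^ 2 = 1 - s ^ 2) :
    ∀ g h : Fin 4, g < h → curv (connVal r w p q s c a b)
      (connDer r w p q k e m n s c a b a' b') g h = curvTable r w p q k e m n s g h := by
  have h1 : ∀ y : Fin 10 → ℝ, conn y 0 =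
    !![y 0, 0, 0, 0; 0, 0, 0, 0; 0, 0, y 2, 0; 0, 0, 0, y 2] := fun _ => rfl
  have h2 : ∀ y : Fin 10 → ℝ, conn y 1 =
    !![0, 0, 0, 0; 0, y 1, 0, 0; 0, 0, y 3, 0; 0, 0, 0, y 3] := fun _ => rfl
  have h3 : ∀ y : Fin 10 → ℝ, conn y 2 =
    !![0, 0, y 5, 0; 0, 0, y 4, 0; y 2, y 3, 0, 0; 0, 0, 0, y 9] := fun _ => rfl
  have h4 : ∀ y : Fin 10 → ℝ, conn y 3 =
    !![0, 0, 0, y 7; 0, 0, 0, y 6; 0, 0, 0, y 8; y 2, y 3, y 9, 0] := fun _ => rfl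
  intro g h hgh
  fin_cases g <;> fin_cases h <;> first | (exfalso; revert hgh; decide) | skip
  all_goals
    simp [curv, h1, h2, h3, h4, connVal, connDer, curvTable]
    repeat' apply And.intro
    all_goals first
      | (ext i; fin_cases i <;> simp)
      | (field_simp; (try simp only [hsc]); (try ring))

theorem curv_antisymm (Y : Fin 10 → ℝ) (Z : Fin 4 → Fin 10 → ℝ) (g h : Fin 4) :
    curv Y Z g h = -curv Y Z h g := by
  simp only [curv]
  abel

/-- The full contraction of the curvature tensor. -/
theorem sum_curv_sq (hr : r ≠ 0) (hw : w ≠ 0) (hs : s ≠ 0)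
    {R : Fin 4 → Fin 4 → Matrix (Fin 4) (Fin 4) ℝ} (hR : ∀ g h, R g h = -R h g)
    (hT : ∀ g h, g < h → R g h = curvTable r w p q k e m n s g h) :
    ∑ i, ∑ j, ∑ g, ∑ h, (lower w r s i * R g h (flip i) j) *
      ((lower w r s i)⁻¹ * (lower w r s j)⁻¹ * (lower w r s g)⁻¹ * (lower w r s h)⁻¹ *
        (lower w r s (flip i) * R (flip g) (flip h) i (flip j)))
      = 4 * (1 + 4 * p * q / w) ^ 2 / r ^ 4 + 16 * k ^ 2 / w ^ 2
        + 64 * (e ^ 2 + m * n) / w ^ 2 := by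
  have h00 : ∀ g, R g g = 0 := fun g => by
    ext i j
    exact self_eq_neg.1 (congrFun (congrFun (hR g g) i) j)
  have h01 := hT 0 1 (by decide)
  have h02 := hT 0 2 (by decide)
  have h03 := hT 0 3 (by decide)
  have h12 := hT 1 2 (by decide)
  have h13 := hT 1 3 (by decide)
  have h23 := hT 2 3 (by decide)
  have h10 := hR 1 0
  have h20 := hR 2 0
  have h30 := hR 3 0
  have h21 := hR 2 1
  have h31 := hR 3 1
  have h32 := hR 3 2
  rw [h01] at h10
  rw [h02] at h20
  rw [h03] at h30
  rw [h12] at h21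
  rw [h13] at h31
  rw [h23] at h32
  simp only [curvTable, Matrix.cons_val] at h01 h02 h03 h12 h13 h23 h10 h20 h30 h21 h31 h32
  have f0 : flip 0 = 1 := rfl
  have f1 : flip 1 = 0 := rfl
  have f2 : flip 2 = 2 := rfl
  have f3 : flip 3 = 3 := rfl
  have l0 : lower w r s 0 = -w / 2 := rfl
  have l1 : lower w r s 1 = -w / 2 := rfl
  have l2 : lower w r s 2 = r ^ 2 := rfl
  have l3 : lower w r s 3 = r ^ 2 * s ^ 2 := rfl
  simp [Fin.sum_univ_four, f0, f1, f2, f3, l0, l1, l2, l3, h00, h01, h02, h03, h12, h13, h23,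
    h10, h20, h30, h21, h31, h32]
  field_simp
  ring

end Curvature


/-! ### Christoffel symbols and scalar invariants of a development -/

theorem uniqueDiffOn_spacetime {u₀ u₁ v₀ v₁ : ℝ} {D : Set (ℝ × ℝ)} (hu : u₀ < u₁) (hv : v₀ < v₁)
    (hD : ∃ O : Set (ℝ × ℝ), IsOpen O ∧ D = rectangle u₀ u₁ v₀ v₁ ∩ O) :
    UniqueDiffOn ℝ (spacetime D) := by
  obtain ⟨O, hO, rfl⟩ := hD
  have h1 : UniqueDiffOn ℝ (univ.pi ![Icc u₀ u₁, Icc v₀ v₁, Ioo 0 Real.pi, univ]) := by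
    refine UniqueDiffOn.univ_pi fun i => ?_
    fin_cases i
    · exact uniqueDiffOn_Icc hu
    · exact uniqueDiffOn_Icc hv
    · exact uniqueDiffOn_Ioo _ _
    · exact uniqueDiffOn_univ
  have h2 : IsOpen {x : Fin 4 → ℝ | (x 0, x 1) ∈ O} :=
    hO.preimage ((continuous_apply 0).prodMk (continuous_apply 1))
  have e : spacetime (rectangle u₀ u₁ v₀ v₁ ∩ O)
      = univ.pi ![Icc u₀ u₁, Icc v₀ v₁, Ioo 0 Real.pi, univ] ∩
        {x : Fin 4 → ℝ | (x 0, x 1) ∈ O} := by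
    ext x
    constructor
    · rintro ⟨⟨⟨h0, h1⟩, h3⟩, h4⟩
      refine ⟨fun i _ => ?_, h3⟩
      fin_cases i
      · exact h0
      · exact h1
      · exact h4
      · exact mem_univ _
    · rintro ⟨h, h3⟩
      exact ⟨⟨⟨h 0 (mem_univ _), h 1 (mem_univ _)⟩, h3⟩, h 2 (mem_univ _)⟩
  rw [e]
  exact h1.inter h2

theorem du_mul {D : Set (ℝ × ℝ)} {f g : ℝ × ℝ → ℝ} {p : ℝ × ℝ} (hD : UniqueDiffWithinAt ℝ D p)
    (hf : DifferentiableWithinAt ℝ f D p) (hg : DifferentiableWithinAt ℝ g D p) :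
    du D (fun q => f q * g q) p = f p * du D g p + g p * du D f p := by
  simp [du, fderivWithin_fun_mul hD hf hg]

theorem dv_mul {D : Set (ℝ × ℝ)} {f g : ℝ × ℝ → ℝ} {p : ℝ × ℝ} (hD : UniqueDiffWithinAt ℝ D p)
    (hf : DifferentiableWithinAt ℝ f D p) (hg : DifferentiableWithinAt ℝ g D p) :
    dv D (fun q => f q * g q) p = f p * dv D g p + g p * dv D f p := by
  simp [dv, fderivWithin_fun_mul hD hf hg]

theorem fderivWithin_neg_inv {D : Set (ℝ × ℝ)} {f : ℝ × ℝ → ℝ} {p : ℝ × ℝ}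
    (hD : UniqueDiffWithinAt ℝ D p) (hf : DifferentiableWithinAt ℝ f D p) (h0 : f p ≠ 0) :
    fderivWithin ℝ (fun q => -(f q)⁻¹) D p = (f p ^ 2)⁻¹ • fderivWithin ℝ f D p := by
  have := ((hasDerivAt_inv h0).comp_hasFDerivWithinAt p hf.hasFDerivWithinAt).fun_neg
  refine (HasFDerivWithinAt.fderivWithin this hD).trans ?_
  ext <;> simp

namespace IsFutureDevelopment

variable {u₀ u₁ v₀ v₁ : ℝ} {D : Set (ℝ × ℝ)} {F : Fields}

variable (h : IsFutureDevelopment u₀ u₁ v₀ v₁ D F)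
include h

theorem fderivWithin_Ωsq {p : ℝ × ℝ} (hp : p ∈ D) : fderivWithin ℝ F.Ωsq D p =
    F.Ωsq p • fderivWithin ℝ (fun q => Real.log (F.Ωsq q)) D p := by
  have h1 := h.contDiffOn_Ωsq.differentiableOn two_ne_zero p hp
  rw [fderivWithin.log h1 (h.Ωsq_ne hp) (h.uniqueDiffOn p hp), smul_inv_smul₀ (h.Ωsq_ne hp)]

/-- Raychaudhuri solved for the second derivative, in the form that identifies the Hessian component
`m` of `connDer` with `-(∂_u φ)²`. -/
theorem du_du_r {p : ℝ × ℝ} (hp : p ∈ D) : du D (du D F.r) p =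
    du D (fun q => Real.log (F.Ωsq q)) p * du D F.r p + F.r p * -(du D F.φ p) ^ 2 := by
  have h1 := h.contDiffOn_Ωsq.differentiableOn two_ne_zero p hp
  have hw := h.Ωsq_ne hp
  have h2 := h.solves.raychaudhuri_u p hp
  rw [du_mul (f := fun q => -(F.Ωsq q)⁻¹) (h.uniqueDiffOn p hp) (h1.inv hw).neg
    (h.contDiffOn_du_r.differentiableOn one_ne_zero p hp)] at h2
  have h3 : du D (fun q => -(F.Ωsq q)⁻¹) p
      = (F.Ωsq p)⁻¹ * du D (fun q => Real.log (F.Ωsq q)) p := by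
    rw [du, fderivWithin_neg_inv (h.uniqueDiffOn p hp) h1 hw, h.fderivWithin_Ωsq hp]
    simp only [du, smul_apply, smul_eq_mul]
    field_simp
  rw [h3] at h2
  field_simp at h2
  linear_combination -h2

theorem dv_dv_r {p : ℝ × ℝ} (hp : p ∈ D) : dv D (dv D F.r) p =
    dv D (fun q => Real.log (F.Ωsq q)) p * dv D F.r p + F.r p * -(dv D F.φ p) ^ 2 := by
  have h1 := h.contDiffOn_Ωsq.differentiableOn two_ne_zero p hp
  have hw := h.Ωsq_ne hp
  have h2 := h.solves.raychaudhuri_v p hp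
  rw [dv_mul (f := fun q => -(F.Ωsq q)⁻¹) (h.uniqueDiffOn p hp) (h1.inv hw).neg
    (h.contDiffOn_dv_r.differentiableOn one_ne_zero p hp)] at h2
  have h3 : dv D (fun q => -(F.Ωsq q)⁻¹) p
      = (F.Ωsq p)⁻¹ * dv D (fun q => Real.log (F.Ωsq q)) p := by
    rw [dv, fderivWithin_neg_inv (h.uniqueDiffOn p hp) h1 hw, h.fderivWithin_Ωsq hp]
    simp only [dv, smul_apply, smul_eq_mul]
    field_simp
  rw [h3] at h2
  field_simp at h2
  linear_combination -h2

/-- The components of the Christoffel symbols at a point of the spacetime. -/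
noncomputable def connAt (_ : IsFutureDevelopment u₀ u₁ v₀ v₁ D F) (x : Fin 4 → ℝ) : Fin 10 → ℝ :=
  connVal (F.r (x 0, x 1)) (F.Ωsq (x 0, x 1)) (du D F.r (x 0, x 1)) (dv D F.r (x 0, x 1))
    (Real.sin (x 2)) (Real.cos (x 2)) (du D (fun q => Real.log (F.Ωsq q)) (x 0, x 1))
    (dv D (fun q => Real.log (F.Ωsq q)) (x 0, x 1))

/-- In each row the metric and its inverse have a single nonzero entry, at the index `flip`, so the
defining sum collapses to one term. -/
theorem christoffel_eq {x : Fin 4 → ℝ} (hx : x ∈ spacetime D) (k i j : Fin 4) :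
    christoffel (spacetime D) (metric F) k i j x = conn (h.connAt x) i k j := by
  have hM := uniqueDiffOn_spacetime h.u_lt h.v_lt h.relatively_open x hx
  have hw := h.Ωsq_ne hx.1
  have hr := h.r_ne hx.1
  have hs : Real.sin (x 2) ≠ 0 := (Real.sin_pos_of_mem_Ioo hx.2).ne'
  have pr := hasPd_pullback hx (h.contDiffOn_r.of_le one_le_two)
  have pw := hasPd_pullback hx (h.contDiffOn_Ωsq.of_le one_le_two)
  have hwu : du D F.Ωsq (x 0, x 1)
      = F.Ωsq (x 0, x 1) * du D (fun q => Real.log (F.Ωsq q)) (x 0, x 1) := by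
    rw [du, h.fderivWithin_Ωsq hx.1]; rfl
  have hwv : dv D F.Ωsq (x 0, x 1)
      = F.Ωsq (x 0, x 1) * dv D (fun q => Real.log (F.Ωsq q)) (x 0, x 1) := by
    rw [dv, h.fderivWithin_Ωsq hx.1]; rfl
  rw [hwu, hwv] at pw
  have ps : HasPd (spacetime D) (fun t => Real.sin (t 2)) ![0, 0, Real.cos (x 2), 0] x :=
    ((hasPd_coord 2).comp (Real.hasDerivAt_sin (x 2))).congr_deriv fun i => by
      fin_cases i <;> simp
  let dlow : Fin 4 → Fin 4 → ℝ := fun l i =>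
    ![-F.Ωsq (x 0, x 1) * ![du D (fun q => Real.log (F.Ωsq q)) (x 0, x 1),
        dv D (fun q => Real.log (F.Ωsq q)) (x 0, x 1), 0, 0] i / 2,
      -F.Ωsq (x 0, x 1) * ![du D (fun q => Real.log (F.Ωsq q)) (x 0, x 1),
        dv D (fun q => Real.log (F.Ωsq q)) (x 0, x 1), 0, 0] i / 2,
      2 * F.r (x 0, x 1) * ![du D F.r (x 0, x 1), dv D F.r (x 0, x 1), 0, 0] i,
      2 * F.r (x 0, x 1) * ![du D F.r (x 0, x 1), dv D F.r (x 0, x 1), 0, 0] i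
        * Real.sin (x 2) ^ 2 + F.r (x 0, x 1) ^ 2 * (2 * Real.sin (x 2)
          * ![0, 0, Real.cos (x 2), 0] i)] l
  have pmw : HasPd (spacetime D) (fun t => -F.Ωsq (t 0, t 1) / 2) (dlow 0) x := by
    refine ((((hasPd_const (-1)).mul pw).div (hasPd_const 2) two_ne_zero).congr hx
      fun t _ => by ring).congr_deriv fun i => ?_
    fin_cases i <;> simp only [dlow, Fin.zero_eta, Fin.mk_one, Fin.reduceFinMk, Matrix.cons_val] <;> ring
  have pmr : HasPd (spacetime D) (fun t => F.r (t 0, t 1) ^ 2) (dlow 2) x := by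
    refine ((pr.mul pr).congr hx fun t _ => by ring).congr_deriv fun i => ?_
    fin_cases i <;> simp only [dlow, Fin.zero_eta, Fin.mk_one, Fin.reduceFinMk, Matrix.cons_val] <;> ring
  have pms : HasPd (spacetime D) (fun t => F.r (t 0, t 1) ^ 2 * Real.sin (t 2) ^ 2) (dlow 3) x := by
    refine ((pmr.mul (ps.mul ps)).congr hx fun t _ => by ring).congr_deriv fun i => ?_
    fin_cases i <;> simp only [dlow, Fin.zero_eta, Fin.mk_one, Fin.reduceFinMk, Matrix.cons_val] <;> ring
  have key : ∀ l m : Fin 4, HasPd (spacetime D) (fun t => metric F t l m)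
      (fun i => if m = flip l then dlow l i else 0) x := by
    intro l m
    fin_cases l <;> fin_cases m <;> first
      | exact hasPd_const 0
      | exact pmw
      | exact pmr
      | exact pms
  have keyd : ∀ i l m : Fin 4, pd (spacetime D) i (fun t => metric F t l m) x
      = if m = flip l then dlow l i else 0 := fun i l m => (key l m).pd_eq hM i
  have hinv : ∀ k l, (metric F x)⁻¹ k l = if l = flip k then
      (lower (F.Ωsq (x 0, x 1)) (F.r (x 0, x 1)) (Real.sin (x 2)) k)⁻¹ else 0 := fun k l => by
    rw [metric_inv F x hw hr hs, Matrix.of_apply]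
  rw [christoffel]
  simp only [hinv, keyd, ite_mul, zero_mul, Finset.sum_ite_eq',
    Finset.mem_univ, if_true]
  fin_cases k <;> fin_cases i <;> fin_cases j <;>
    simp [flip, lower, dlow, conn, connAt, connVal] <;> (try field_simp)

end IsFutureDevelopment


theorem hasPd_connVal {M : Set (Fin 4 → ℝ)} {x : Fin 4 → ℝ}
    {R W P Q S C A B : (Fin 4 → ℝ) → ℝ} {k e m n a' b' : ℝ}
    (hr : R x ≠ 0) (hw : W x ≠ 0) (hs : S x ≠ 0) (hsc : C x ^ 2 = 1 - S x ^ 2)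
    (hR : HasPd M R ![P x, Q x, 0, 0] x) (hW : HasPd M W ![W x * A x, W x * B x, 0, 0] x)
    (hP : HasPd M P ![A x * P x + R x * m, R x * e, 0, 0] x)
    (hQ : HasPd M Q ![R x * e, B x * Q x + R x * n, 0, 0] x)
    (hS : HasPd M S ![0, 0, C x, 0] x) (hC : HasPd M C ![0, 0, -S x, 0] x)
    (hA : HasPd M A ![a', k, 0, 0] x) (hB : HasPd M B ![k, b', 0, 0] x) (j : Fin 10) :
    HasPd M (fun t => connVal (R t) (W t) (P t) (Q t) (S t) (C t) (A t) (B t) j)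
      (fun i => connDer (R x) (W x) (P x) (Q x) k e m n (S x) (C x) (A x) (B x) a' b' i j) x := by
  have h2 : HasPd M (fun _ => (2 : ℝ)) (fun _ => 0) x := hasPd_const 2
  have hL := ((h2.mul hR).mul hP).div hW hw
  have hN := ((h2.mul hR).mul hQ).div hW hw
  have hSS := hS.mul hS
  have hSn : S x * S x ≠ 0 := mul_ne_zero hs hs
  fin_cases j
  · refine hA.congr_deriv fun i => ?_
    fin_cases i <;> rfl
  · refine hB.congr_deriv fun i => ?_
    fin_cases i <;> rfl
  · refine (hP.div hR hr).congr_deriv fun i => ?_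
    fin_cases i <;> simp [connDer] <;> field_simp
  · refine (hQ.div hR hr).congr_deriv fun i => ?_
    fin_cases i <;> simp [connDer] <;> field_simp
  · refine hL.congr_deriv fun i => ?_
    fin_cases i <;> simp [connDer] <;> field_simp <;> ring
  · refine hN.congr_deriv fun i => ?_
    fin_cases i <;> simp [connDer] <;> field_simp <;> ring
  · have := hL.mul hSS
    simp only [← pow_two] at this
    refine this.congr_deriv fun i => ?_
    fin_cases i <;>
      simp [connDer, -mul_eq_mul_left_iff, -mul_eq_mul_right_iff] <;> field_simp <;> ring
  · have := hN.mul hSS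
    simp only [← pow_two] at this
    refine this.congr_deriv fun i => ?_
    fin_cases i <;>
      simp [connDer, -mul_eq_mul_left_iff, -mul_eq_mul_right_iff] <;> field_simp <;> ring
  · have := (hasPd_const (-1)).mul (hS.mul hC)
    simp only [neg_one_mul] at this
    refine this.congr_deriv fun i => ?_
    fin_cases i <;> simp [connDer]
    ring
  · refine (hC.div hS hs).congr_deriv fun i => ?_
    fin_cases i <;> simp [connDer]
    field_simp
    linear_combination -hsc

theorem flip_flip (a : Fin 4) : flip (flip a) = a := by
  fin_cases a <;> rfl

namespace IsFutureDevelopment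

variable {u₀ u₁ v₀ v₁ : ℝ} {D : Set (ℝ × ℝ)} {F : Fields}

variable (h : IsFutureDevelopment u₀ u₁ v₀ v₁ D F)
include h

theorem hasPd_connAt {x : Fin 4 → ℝ} (hx : x ∈ spacetime D) (j : Fin 10) :
    HasPd (spacetime D) (fun t => h.connAt t j)
      (fun i => connDer (F.r (x 0, x 1)) (F.Ωsq (x 0, x 1)) (du D F.r (x 0, x 1))
        (dv D F.r (x 0, x 1)) (du D (dv D fun q => Real.log (F.Ωsq q)) (x 0, x 1))
        (du D (dv D F.r) (x 0, x 1) / F.r (x 0, x 1)) (-(du D F.φ (x 0, x 1)) ^ 2)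
        (-(dv D F.φ (x 0, x 1)) ^ 2) (Real.sin (x 2)) (Real.cos (x 2))
        (du D (fun q => Real.log (F.Ωsq q)) (x 0, x 1))
        (dv D (fun q => Real.log (F.Ωsq q)) (x 0, x 1))
        (du D (du D fun q => Real.log (F.Ωsq q)) (x 0, x 1))
        (dv D (dv D fun q => Real.log (F.Ωsq q)) (x 0, x 1)) i j) x := by
  have hr := h.r_ne hx.1
  have hw := h.Ωsq_ne hx.1
  have hs : Real.sin (x 2) ≠ 0 := (Real.sin_pos_of_mem_Ioo hx.2).ne'
  have pr := hasPd_pullback hx (h.contDiffOn_r.of_le one_le_two)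
  have pw := hasPd_pullback hx (h.contDiffOn_Ωsq.of_le one_le_two)
  have pp := hasPd_pullback hx h.contDiffOn_du_r
  have pq := hasPd_pullback hx h.contDiffOn_dv_r
  have pa := hasPd_pullback hx h.contDiffOn_du_log
  have pb := hasPd_pullback hx h.contDiffOn_dv_log
  have hwu : du D F.Ωsq (x 0, x 1)
      = F.Ωsq (x 0, x 1) * du D (fun q => Real.log (F.Ωsq q)) (x 0, x 1) := by
    rw [du, h.fderivWithin_Ωsq hx.1]; rfl
  have hwv : dv D F.Ωsq (x 0, x 1)
      = F.Ωsq (x 0, x 1) * dv D (fun q => Real.log (F.Ωsq q)) (x 0, x 1) := by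
    rw [dv, h.fderivWithin_Ωsq hx.1]; rfl
  have hre : du D (dv D F.r) (x 0, x 1)
      = F.r (x 0, x 1) * (du D (dv D F.r) (x 0, x 1) / F.r (x 0, x 1)) :=
    (mul_div_cancel₀ _ hr).symm
  rw [hwu, hwv] at pw
  rw [h.du_du_r hx.1, dv_du_eq h.uniqueDiffOn h.subset_closure_interior h.contDiffOn_r hx.1,
    hre] at pp
  rw [h.dv_dv_r hx.1, hre] at pq
  rw [dv_du_eq h.uniqueDiffOn h.subset_closure_interior h.contDiffOn_log hx.1] at pa
  have ps : HasPd (spacetime D) (fun t => Real.sin (t 2)) ![0, 0, Real.cos (x 2), 0] x :=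
    ((hasPd_coord 2).comp (Real.hasDerivAt_sin (x 2))).congr_deriv fun i => by
      fin_cases i <;> simp
  have pc : HasPd (spacetime D) (fun t => Real.cos (t 2)) ![0, 0, -Real.sin (x 2), 0] x :=
    ((hasPd_coord 2).comp (Real.hasDerivAt_cos (x 2))).congr_deriv fun i => by
      fin_cases i <;> simp
  exact hasPd_connVal (R := fun t => F.r (t 0, t 1)) (W := fun t => F.Ωsq (t 0, t 1))
    (P := fun t => du D F.r (t 0, t 1)) (Q := fun t => dv D F.r (t 0, t 1))
    (S := fun t => Real.sin (t 2)) (C := fun t => Real.cos (t 2))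
    (A := fun t => du D (fun q => Real.log (F.Ωsq q)) (t 0, t 1))
    (B := fun t => dv D (fun q => Real.log (F.Ωsq q)) (t 0, t 1)) hr hw hs
    (Real.cos_sq' _) pr pw pp pq ps pc pa pb j

/-- The Kretschmann scalar in terms of the Hessian of the area radius and the curvature of the
orbit space. -/
theorem kretschmann_eq {x : Fin 4 → ℝ} (hx : x ∈ spacetime D) :
    kretschmann (spacetime D) (metric F) x =
      4 * (1 + 4 * du D F.r (x 0, x 1) * dv D F.r (x 0, x 1) / F.Ωsq (x 0, x 1)) ^ 2
          / F.r (x 0, x 1) ^ 4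
        + 16 * du D (dv D fun q => Real.log (F.Ωsq q)) (x 0, x 1) ^ 2 / F.Ωsq (x 0, x 1) ^ 2
        + 64 * ((du D (dv D F.r) (x 0, x 1) / F.r (x 0, x 1)) ^ 2
          + -(du D F.φ (x 0, x 1)) ^ 2 * -(dv D F.φ (x 0, x 1)) ^ 2) / F.Ωsq (x 0, x 1) ^ 2 := by
  have hr := h.r_ne hx.1
  have hw := h.Ωsq_ne hx.1
  have hs : Real.sin (x 2) ≠ 0 := (Real.sin_pos_of_mem_Ioo hx.2).ne'
  have hM := uniqueDiffOn_spacetime h.u_lt h.v_lt h.relatively_open x hx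
  set Z := connDer (F.r (x 0, x 1)) (F.Ωsq (x 0, x 1)) (du D F.r (x 0, x 1))
        (dv D F.r (x 0, x 1)) (du D (dv D fun q => Real.log (F.Ωsq q)) (x 0, x 1))
        (du D (dv D F.r) (x 0, x 1) / F.r (x 0, x 1)) (-(du D F.φ (x 0, x 1)) ^ 2)
        (-(dv D F.φ (x 0, x 1)) ^ 2) (Real.sin (x 2)) (Real.cos (x 2))
        (du D (fun q => Real.log (F.Ωsq q)) (x 0, x 1))
        (dv D (fun q => Real.log (F.Ωsq q)) (x 0, x 1))
        (du D (du D fun q => Real.log (F.Ωsq q)) (x 0, x 1))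
        (dv D (dv D fun q => Real.log (F.Ωsq q)) (x 0, x 1)) with hZ
  have hder : ∀ i a c b, pd (spacetime D) i (christoffel (spacetime D) (metric F) a c b) x
      = conn (Z i) c a b := fun i a c b =>
    ((hasPd_conn (h.hasPd_connAt hx) c a b).congr hx
      fun t ht => h.christoffel_eq ht a c b).pd_eq hM i
  set L := lower (F.Ωsq (x 0, x 1)) (F.r (x 0, x 1)) (Real.sin (x 2)) with hL
  have hup : ∀ a b c d, riemannUp (spacetime D) (metric F) a b c d x
      = curv (h.connAt x) Z c d a b := fun a b c d => by
    rw [riemannUp, hder, hder, curv, Matrix.add_apply, Matrix.sub_apply, Matrix.sub_apply,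
      Matrix.mul_apply, Matrix.mul_apply, Finset.sum_sub_distrib]
    simp only [h.christoffel_eq hx]
  have hlow : ∀ a b c d, riemann (spacetime D) (metric F) a b c d x
      = L a * curv (h.connAt x) Z c d (flip a) b := fun a b c d => by
    simp only [riemann, metric_apply, ite_mul, zero_mul, Finset.sum_ite_eq', Finset.mem_univ,
      if_true, hup]
    rfl
  have hinv : ∀ k l, (metric F x)⁻¹ k l = if l = flip k then (L k)⁻¹ else 0 := fun k l => by
    rw [metric_inv F x hw hr hs, Matrix.of_apply]
  have hcontra : ∀ a b c d, riemannContra (spacetime D) (metric F) a b c d x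
      = (L a)⁻¹ * (L b)⁻¹ * (L c)⁻¹ * (L d)⁻¹ *
        (L (flip a) * curv (h.connAt x) Z (flip c) (flip d) a (flip b)) := fun a b c d => by
    simp only [riemannContra, hlow, hinv]
    rw [Finset.sum_eq_single (flip a) (fun i _ hi => by simp [hi]) (by simp),
      Finset.sum_eq_single (flip b) (fun i _ hi => by simp [hi]) (by simp),
      Finset.sum_eq_single (flip c) (fun i _ hi => by simp [hi]) (by simp),
      Finset.sum_eq_single (flip d) (fun i _ hi => by simp [hi]) (by simp)]
    simp only [if_true, flip_flip]
  simp only [kretschmann, hlow, hcontra]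
  exact sum_curv_sq _ _ _ _ _ _ hr hw hs (curv_antisymm _ _)
    (curv_eq _ _ _ _ _ _ _ _ _ _ hr hw hs (Real.cos_sq' _))

theorem gradSq_eq {x : Fin 4 → ℝ} (hx : x ∈ spacetime D) :
    gradSq (spacetime D) (metric F) (fun y => F.φ (y 0, y 1)) x =
      -(4 * du D F.φ (x 0, x 1) * dv D F.φ (x 0, x 1) / F.Ωsq (x 0, x 1)) := by
  have hr := h.r_ne hx.1
  have hw := h.Ωsq_ne hx.1
  have hs : Real.sin (x 2) ≠ 0 := (Real.sin_pos_of_mem_Ioo hx.2).ne'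
  have hM := uniqueDiffOn_spacetime h.u_lt h.v_lt h.relatively_open x hx
  have hp := (hasPd_pullback hx (h.contDiffOn_φ.of_le one_le_two)).pd_eq hM
  simp only [gradSq, hp, metric_inv F x hw hr hs, Matrix.of_apply, ite_mul, zero_mul,
    Finset.sum_ite_eq', Finset.mem_univ, if_true]
  simp [Fin.sum_univ_four, flip, lower]
  field_simp
  ring

end IsFutureDevelopment


/-! ### Calculus of approximation by constants -/

section ApproxOn

variable {α : Type*} {J : Set α} {e e' f g r : α → ℝ} {c d r₀ : ℝ}

/-- On `J`, the function `f` equals the constant `c` up to an error of order `e`. -/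
def ApproxOn (J : Set α) (e f : α → ℝ) (c : ℝ) : Prop := (fun q => f q - c) =O[𝓟 J] e

theorem ApproxOn.congr (h : ApproxOn J e f c) (hfg : ∀ q ∈ J, g q = f q) : ApproxOn J e g c :=
  Asymptotics.IsBigO.congr' h (eventually_principal.2 fun q hq => by simp only [hfg q hq])
    EventuallyEq.rfl

theorem ApproxOn.of_le {K : ℝ} (h : ∀ q ∈ J, |f q - c| ≤ K * |e q|) : ApproxOn J e f c :=
  Asymptotics.IsBigO.of_bound K (eventually_principal.2 h)

theorem ApproxOn.mono (h : ApproxOn J e f c) (he : e =O[𝓟 J] e') : ApproxOn J e' f c :=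
  Asymptotics.IsBigO.trans h he

theorem approxOn_const (c : ℝ) : ApproxOn J e (fun _ => c) c :=
  .of_le (K := 0) fun _ _ => by simp

theorem ApproxOn.isBigO_one (h : ApproxOn J e f c) (he : e =O[𝓟 J] (1 : α → ℝ)) :
    f =O[𝓟 J] (1 : α → ℝ) := by
  have h1 : (fun _ : α => c) =O[𝓟 J] (1 : α → ℝ) := Asymptotics.isBigO_const_const _ one_ne_zero _
  simpa using (Asymptotics.IsBigO.trans h he).add h1

theorem ApproxOn.add (hf : ApproxOn J e f c) (hg : ApproxOn J e g d) :
    ApproxOn J e (fun q => f q + g q) (c + d) :=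
  (Asymptotics.IsBigO.add hf hg).congr_left fun q => by ring

theorem ApproxOn.mul (he : e =O[𝓟 J] (1 : α → ℝ)) (hf : ApproxOn J e f c)
    (hg : ApproxOn J e g d) : ApproxOn J e (fun q => f q * g q) (c * d) := by
  have h1 := Asymptotics.IsBigO.mul hf (hg.isBigO_one he)
  have h2 := (Asymptotics.IsBigO.const_mul_left hg c).add (h1.trans (by simpa using Asymptotics.isBigO_refl e _))
  exact h2.congr_left fun q => by ring

theorem ApproxOn.const_mul (b : ℝ) (hf : ApproxOn J e f c) :
    ApproxOn J e (fun q => b * f q) (b * c) :=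
  (Asymptotics.IsBigO.const_mul_left hf b).congr_left fun q => by ring

theorem ApproxOn.sub (hf : ApproxOn J e f c) (hg : ApproxOn J e g d) :
    ApproxOn J e (fun q => f q - g q) (c - d) :=
  (Asymptotics.IsBigO.sub hf hg).congr_left fun q => by ring

theorem ApproxOn.pow (he : e =O[𝓟 J] (1 : α → ℝ)) (hf : ApproxOn J e f c) (n : ℕ) :
    ApproxOn J e (fun q => f q ^ n) (c ^ n) := by
  induction n with
  | zero => simpa using approxOn_const 1
  | succ n ih => simpa only [pow_succ] using ih.mul he hf

theorem ApproxOn.exp (he : e =O[𝓟 J] (1 : α → ℝ)) (hf : ApproxOn J e f c) :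
    ApproxOn J e (fun q => Real.exp (f q)) (Real.exp c) := by
  obtain ⟨K, hK⟩ := (hf.isBigO_one he).bound
  have h : (fun q => Real.exp (f q) - Real.exp c) =O[𝓟 J] fun q => f q - c := by
    refine .of_bound (Real.exp (max K c)) (eventually_principal.2 fun q hq => ?_)
    have h1 : |f q| ≤ K := by simpa using eventually_principal.1 hK q hq
    exact (convex_Iic (max K c)).norm_image_sub_le_of_norm_hasDerivWithin_le
      (fun x _ => (Real.hasDerivAt_exp x).hasDerivWithinAt)
      (fun x hx => by
        rw [Real.norm_eq_abs, Real.abs_exp]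
        exact Real.exp_le_exp.2 hx)
      (le_max_right K c) ((le_abs_self _).trans (h1.trans (le_max_left K c)))
  exact h.trans hf

/-- Quantifying over all large `B` lets finitely many estimates share one constant through a filter
intersection. -/
theorem ApproxOn.eventually_le (h : ApproxOn J e f c) (he : ∀ q ∈ J, 0 ≤ e q) :
    ∀ᶠ B : ℝ in atTop, ∀ q ∈ J, |f q - c| ≤ B * e q := by
  obtain ⟨K, hK⟩ := Asymptotics.IsBigO.bound h
  filter_upwards [eventually_ge_atTop K] with B hB q hq
  have h1 : |f q - c| ≤ K * |e q| := eventually_principal.1 hK q hq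
  rw [abs_of_nonneg (he q hq)] at h1
  exact h1.trans (mul_le_mul_of_nonneg_right hB (he q hq))

theorem ApproxOn.eventually_le_rpow
    (h : ApproxOn J (fun q => r q * (1 + |Real.log (r q)|)) f c) (hr : ∀ q ∈ J, 0 < r q)
    (hr₀ : 0 < r₀) (a : ℝ) : ∀ᶠ B : ℝ in atTop, ∀ q ∈ J,
      |(f q - c) * (r q / r₀) ^ a| ≤ B * r q ^ (a + 1) * (1 + |Real.log (r q)|) := by
  have h1 := h.eventually_le fun q hq => by
    have := hr q hq
    positivity
  have h2 := (tendsto_id.atTop_mul_const (Real.rpow_pos_of_pos hr₀ a)).eventually h1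
  filter_upwards [h2] with B hB q hq
  have hrq := hr q hq
  have h3 := hB q hq
  rw [abs_mul, Real.div_rpow hrq.le hr₀.le, abs_of_pos (a := _ / _) (by positivity),
    Real.rpow_add_one hrq.ne']
  calc _ ≤ (B * r₀ ^ a * (r q * (1 + |Real.log (r q)|))) * (r q ^ a / r₀ ^ a) :=
        mul_le_mul_of_nonneg_right h3 (by positivity)
    _ = _ := by
      have := (Real.rpow_pos_of_pos hr₀ a).ne'
      field_simp

theorem isBigO_mul_log_one (hr : ∀ q ∈ J, 0 < r q) (h₀ : ∀ q ∈ J, r q ≤ r₀) :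
    (fun q => r q * (1 + |Real.log (r q)|)) =O[𝓟 J] (1 : α → ℝ) := by
  refine .of_bound (r₀ + 1 + r₀ ^ 2) (eventually_principal.2 fun q hq => ?_)
  have h1 := hr q hq
  have h2 := h₀ q hq
  -- From `log r ≤ r` and `-log r ≤ 1/r`.
  have h3 : r q * |Real.log (r q)| ≤ 1 + r q ^ 2 := by
    have h4 := Real.log_le_self h1.le
    have h5 := Real.log_le_self (inv_pos.2 h1).le
    rw [Real.log_inv] at h5
    have h6 : r q * -Real.log (r q) ≤ 1 := by
      calc _ ≤ r q * (r q)⁻¹ := mul_le_mul_of_nonneg_left h5 h1.le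
        _ = 1 := mul_inv_cancel₀ h1.ne'
    rcases abs_cases (Real.log (r q)) with h7 | h7 <;> rw [h7.1] <;> nlinarith
  have h8 : r q ^ 2 ≤ r₀ ^ 2 := by gcongr
  simp only [Pi.one_apply, norm_one, mul_one]
  rw [Real.norm_eq_abs, abs_of_nonneg (by positivity)]
  linarith

theorem isBigO_self_mul_log : r =O[𝓟 J] fun q => r q * (1 + |Real.log (r q)|) := by
  refine .of_bound 1 (eventually_principal.2 fun q hq => ?_)
  rw [Real.norm_eq_abs, Real.norm_eq_abs, one_mul, abs_mul]
  exact le_mul_of_one_le_right (abs_nonneg _)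
    ((le_add_of_nonneg_right (abs_nonneg _)).trans (le_abs_self _))

theorem isBigO_log (b : ℝ) :
    (fun q => b - Real.log (r q)) =O[𝓟 J] fun q => 1 + |Real.log (r q)| := by
  refine .of_bound (|b| + 1) (eventually_principal.2 fun q _ => ?_)
  have h1 := abs_sub b (Real.log (r q))
  rw [Real.norm_eq_abs, Real.norm_eq_abs, abs_of_nonneg (a := 1 + _) (by positivity)]
  nlinarith [abs_nonneg b, abs_nonneg (Real.log (r q))]

end ApproxOn

namespace NullSolution

variable {X : NullSolution} {c C r₀ R : ℝ} {J : Set (ℝ × ℝ)} {p : ℝ × ℝ}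

theorem Controlled.approxOn (hX : X.Bounds c C) (hR1 : C ≤ R) (hR2 : √(C ^ 3 / c) ≤ R)
    {f : ℝ × ℝ → ℝ} (H : X.Controlled (fun x => x) f) (hJ : J ⊆ X.D)
    (hp : ∀ q ∈ J, p ∈ closure (X.D ∩ Ici q)) : ApproxOn J X.r f (extendFrom X.D f p) := by
  obtain ⟨K, hK, h⟩ := H.abs_sub_extendFrom_le hX (Gauge.id R) hR1 hR2
  refine .of_le (K := K) fun q hq => ?_
  rw [abs_of_pos (X.r_pos q (hJ hq))]
  exact h p q (hJ hq) (hp q hq)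

theorem Controlled.approxOn_log (hX : X.Bounds c C) (hR1 : C ≤ R) (hR2 : √(C ^ 3 / c) ≤ R)
    {f : ℝ × ℝ → ℝ} (H : X.Controlled (logGauge R) f) (hJ : J ⊆ X.D)
    (hp : ∀ q ∈ J, p ∈ closure (X.D ∩ Ici q)) :
    ApproxOn J (fun q => X.r q * (1 + |Real.log (X.r q)|)) f (extendFrom X.D f p) := by
  obtain ⟨K, hK, h⟩ := H.abs_sub_extendFrom_le hX Gauge.log hR1 hR2
  have h1 : ApproxOn J (fun q => X.r q * (2 + Real.log R - Real.log (X.r q))) f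
      (extendFrom X.D f p) := .of_le (K := K) fun q hq =>
    (h p q (hJ hq) (hp q hq)).trans (mul_le_mul_of_nonneg_left (le_abs_self _) hK.le)
  exact h1.mono ((Asymptotics.isBigO_refl _ _).mul (isBigO_log _))

/-- Because `A - B = O(r)`, a single limit governs both null derivatives of `φ`. -/
theorem Bounds.approxOn_B (hX : X.Bounds c C) (hJ : J ⊆ X.D) {a : ℝ}
    (hA : ApproxOn J X.r X.A a) : ApproxOn J X.r X.B a := by
  obtain ⟨K, hK, h⟩ := hX.exists_sub_le
  have h1 : ApproxOn J X.r (fun q => X.A q - X.B q) 0 := .of_le (K := K) fun q hq => by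
    rw [abs_of_pos (X.r_pos q (hJ hq)), sub_zero]
    exact h q (hJ hq)
  have := hA.sub h1
  simpa using this

/-- The profile `X` of the renormalised mass with respect to the limiting exponent. -/
theorem approxOn_profile (hJ : J ⊆ X.D) (h₀ : ∀ q ∈ J, X.r q ≤ r₀) (hr₀ : 0 < r₀) {a m : ℝ}
    (hA : ApproxOn J X.r X.A a)
    (hM : ApproxOn J (fun q => X.r q * (1 + |Real.log (X.r q)|)) (X.logMass r₀) m) :
    ∃ Y : ℝ × ℝ → ℝ,
      ApproxOn J (fun q => X.r q * (1 + |Real.log (X.r q)|)) Y (Real.exp m) ∧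
      ApproxOn J (fun q => X.r q * (1 + |Real.log (X.r q)|)) (fun q => (Y q)⁻¹) (Real.exp m)⁻¹ ∧
      (∀ q, 0 < Y q) ∧ ∀ q ∈ J, 4 * X.P q * X.Q q / (X.r q ^ 2 * X.w q)
        = Y q * (X.r q / r₀) ^ (-(a ^ 2 + 1)) := by
  have hr : ∀ q ∈ J, 0 < X.r q := fun q hq => X.r_pos q (hJ hq)
  have he := isBigO_mul_log_one hr h₀
  have hr1 : X.r =O[𝓟 J] (1 : ℝ × ℝ → ℝ) := (isBigO_self_mul_log).trans he
  -- Replacing the variable exponent `A²` by its limit costs a factor `exp ((A² - a²) log (r₀/r))`,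
  -- whose exponent is `O(r)` times a logarithm.
  have h1 : (fun q => (X.A q ^ 2 - a ^ 2) * (Real.log r₀ - Real.log (X.r q))) =O[𝓟 J]
      fun q => X.r q * (1 + |Real.log (X.r q)|) :=
    Asymptotics.IsBigO.mul (hA.pow hr1 2) (isBigO_log _)
  have h2 : ApproxOn J (fun q => X.r q * (1 + |Real.log (X.r q)|))
      (fun q => (X.A q ^ 2 - a ^ 2) * (Real.log r₀ - Real.log (X.r q))) 0 := by
    simpa [ApproxOn] using h1
  have h3 : ApproxOn J (fun q => X.r q * (1 + |Real.log (X.r q)|)) (fun q => X.logMass r₀ q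
      + (X.A q ^ 2 - a ^ 2) * (Real.log r₀ - Real.log (X.r q))) m := by
    simpa using hM.add h2
  refine ⟨fun q => Real.exp (X.logMass r₀ q
      + (X.A q ^ 2 - a ^ 2) * (Real.log r₀ - Real.log (X.r q))), h3.exp he, ?_,
      fun q => Real.exp_pos _, fun q hq => ?_⟩
  · simpa only [neg_mul, one_mul, Real.exp_neg] using (h3.const_mul (-1)).exp he
  · have hrq := hr q hq
    rw [X.exp_logMass hr₀ (hJ hq), Real.rpow_def_of_pos (by positivity),
      Real.rpow_def_of_pos (by positivity), ← Real.exp_add, ← Real.exp_add,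
      Real.log_div hrq.ne' hr₀.ne']
    congr 1
    ring

end NullSolution


/-! ### Pointwise asymptotics in the causal past of a singular point -/

namespace IsFutureDevelopment

variable {u₀ u₁ v₀ v₁ : ℝ} {D : Set (ℝ × ℝ)} {F : Fields}

variable (h : IsFutureDevelopment u₀ u₁ v₀ v₁ D F)
include h

theorem mul_A {q : ℝ × ℝ} (hq : q ∈ D) :
    h.toNullSolution.P q * h.toNullSolution.A q = F.r q ^ 2 * du D F.φ q :=
  mul_div_cancel₀ _ (h.toNullSolution.P_pos q hq).ne'

theorem mul_B {q : ℝ × ℝ} (hq : q ∈ D) :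
    h.toNullSolution.Q q * h.toNullSolution.B q = F.r q ^ 2 * dv D F.φ q :=
  mul_div_cancel₀ _ (h.toNullSolution.Q_pos q hq).ne'

theorem du_r_mul_dv_r {q : ℝ × ℝ} (hq : q ∈ D) :
    4 * h.toNullSolution.P q * h.toNullSolution.Q q / (F.r q ^ 2 * F.Ωsq q)
      = 4 * du D F.r q * dv D F.r q / F.Ωsq q := by
  have hr := h.r_ne hq
  have hw := h.Ωsq_ne hq
  change 4 * (-F.r q * du D F.r q) * (-F.r q * dv D F.r q) / _ = _
  field_simp

theorem du_φ_mul_dv_φ {q : ℝ × ℝ} (hq : q ∈ D) :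
    4 * du D F.φ q * dv D F.φ q * F.r q ^ 2 = 4 * du D F.r q * dv D F.r q *
      h.toNullSolution.A q * h.toNullSolution.B q := by
  have hr := h.r_ne hq
  have h1 := h.mul_A hq
  have h2 := h.mul_B hq
  change -F.r q * du D F.r q * _ = _ at h1
  change -F.r q * dv D F.r q * _ = _ at h2
  have h3 : F.r q ^ 2 * (4 * du D F.φ q * dv D F.φ q * F.r q ^ 2) = F.r q ^ 2 *
      (4 * du D F.r q * dv D F.r q * h.toNullSolution.A q * h.toNullSolution.B q) := by
    linear_combination (-4 * (F.r q ^ 2 * dv D F.φ q)) * h1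
      - 4 * (-F.r q * du D F.r q * h.toNullSolution.A q) * h2
  exact mul_left_cancel₀ (pow_ne_zero 2 hr) h3

/-- The field equations reduce the curvature to a polynomial in `y`, `A`, `B`. As `A, B → a`, the
coefficient of `y²` in the bracket becomes `2 + (1 - a²)² + a⁴ = 3 - 2a² + 2a⁴`. -/
theorem kretschmann_eq_of_mass {x : Fin 4 → ℝ} (hx : x ∈ spacetime D) {q : ℝ × ℝ}
    (hq : (x 0, x 1) = q) {y : ℝ} (hy : 4 * du D F.r q * dv D F.r q / F.Ωsq q = y) :
    kretschmann (spacetime D) (metric F) x = 4 / F.r q ^ 4 * (2 * (1 + y) ^ 2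
      + (1 + y - y * h.toNullSolution.A q * h.toNullSolution.B q) ^ 2
      + (y * h.toNullSolution.A q * h.toNullSolution.B q) ^ 2) := by
  have hqD : q ∈ D := hq ▸ hx.1
  rw [h.kretschmann_eq hx, hq, h.solves.wave_r q hqD, h.solves.wave_Ω q hqD]
  have hr := h.r_ne hqD
  have hw := h.Ωsq_ne hqD
  have h1 := h.du_φ_mul_dv_φ hqD
  have h2 : 4 * du D F.r q * dv D F.r q = y * F.Ωsq q := by rw [← hy]; field_simp
  rw [h2] at h1
  have h3 : du D F.φ q * dv D F.φ q = y * F.Ωsq q * h.toNullSolution.A q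
      * h.toNullSolution.B q / (4 * F.r q ^ 2) := by
    field_simp
    linear_combination h1
  have h4 : du D F.r q * dv D F.r q = y * F.Ωsq q / 4 := by linear_combination h2 / 4
  rw [show -(du D F.φ q) ^ 2 * -(dv D F.φ q) ^ 2 = (du D F.φ q * dv D F.φ q) ^ 2 by ring,
    show F.Ωsq q / (2 * F.r q ^ 2) + 2 * du D F.r q * dv D F.r q / F.r q ^ 2
        - 2 * du D F.φ q * dv D F.φ q = F.Ωsq q / (2 * F.r q ^ 2)
        + 2 * (du D F.r q * dv D F.r q) / F.r q ^ 2 - 2 * (du D F.φ q * dv D F.φ q) by ring,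
    h3, h4, hy]
  field_simp
  ring

theorem gradSq_eq_of_mass {x : Fin 4 → ℝ} (hx : x ∈ spacetime D) {q : ℝ × ℝ}
    (hq : (x 0, x 1) = q) {y : ℝ} (hy : 4 * du D F.r q * dv D F.r q / F.Ωsq q = y) :
    gradSq (spacetime D) (metric F) (fun z => F.φ (z 0, z 1)) x =
      -(y * h.toNullSolution.A q * h.toNullSolution.B q / F.r q ^ 2) := by
  have hqD : q ∈ D := hq ▸ hx.1
  have hr := h.r_ne hqD
  have hw := h.Ωsq_ne hqD
  rw [h.gradSq_eq hx, hq, ← hy]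
  have h1 := h.du_φ_mul_dv_φ hqD
  field_simp
  linear_combination -h1 / 4

variable {c C r₀ R : ℝ} {J : Set (ℝ × ℝ)} {cu cv a ξ m : ℝ}

theorem eventually_estimates (hX : h.toNullSolution.Bounds c C) (hJ : J ⊆ D)
    (h₀ : ∀ q ∈ J, F.r q ≤ r₀) (hr₀ : 0 < r₀)
    (hP : ApproxOn J F.r h.toNullSolution.P cu) (hQ : ApproxOn J F.r h.toNullSolution.Q cv)
    (hA : ApproxOn J F.r h.toNullSolution.A a)
    (hΞ : ApproxOn J (fun q => F.r q * (1 + |Real.log (F.r q)|))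
      (h.toNullSolution.scalarRemainder r₀) ξ)
    (hM : ApproxOn J (fun q => F.r q * (1 + |Real.log (F.r q)|))
      (h.toNullSolution.logMass r₀) m) :
    ∀ᶠ B : ℝ in atTop, ∀ q ∈ J,
      |-F.r q * du D F.r q - cu| ≤ B * F.r q ∧
      |-F.r q * dv D F.r q - cv| ≤ B * F.r q ∧
      |F.r q ^ 2 * du D F.φ q - cu * a| ≤ B * F.r q ∧
      |F.r q ^ 2 * dv D F.φ q - cv * a| ≤ B * F.r q ∧
      |F.φ q - a * Real.log (r₀ / F.r q) - ξ| ≤ B * F.r q * (1 + |Real.log (F.r q)|) ∧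
      |F.Ωsq q - 4 * cu * cv / r₀ ^ 2 * (Real.exp m)⁻¹ * (F.r q / r₀) ^ (a ^ 2 - 1)| ≤
        B * F.r q ^ (a ^ 2) * (1 + |Real.log (F.r q)|) ∧
      |2 * hawkingMass D F q - Real.exp m * r₀ * (r₀ / F.r q) ^ (a ^ 2)| ≤
        B * F.r q ^ (-a ^ 2 + 1) * (1 + |Real.log (F.r q)|) ∧
      (∀ θ ∈ Ioo 0 Real.pi, ∀ ϕ : ℝ,
        |kretschmann (spacetime D) (metric F) ![q.1, q.2, θ, ϕ]
            - Real.exp m ^ 2 * (r₀ / F.r q) ^ (2 * (a ^ 2 + 3))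
              * (4 * (3 - 2 * a ^ 2 + 2 * a ^ 4) / r₀ ^ 4)| ≤
          B * F.r q ^ (-2 * a ^ 2 - 5) * (1 + |Real.log (F.r q)|)) ∧
      (∀ θ ∈ Ioo 0 Real.pi, ∀ ϕ : ℝ,
        |gradSq (spacetime D) (metric F) (fun x => F.φ (x 0, x 1)) ![q.1, q.2, θ, ϕ]
            + Real.exp m * a ^ 2 / r₀ ^ 2 * (r₀ / F.r q) ^ (a ^ 2 + 3)| ≤
          B * F.r q ^ (-a ^ 2 - 2) * (1 + |Real.log (F.r q)|)) := by
  have hr : ∀ q ∈ J, 0 < F.r q := fun q hq => h.r_pos q (hJ hq)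
  have he := isBigO_mul_log_one hr h₀
  have hre : F.r =O[𝓟 J] fun q => F.r q * (1 + |Real.log (F.r q)|) := isBigO_self_mul_log
  have hr1 : F.r =O[𝓟 J] (1 : ℝ × ℝ → ℝ) := hre.trans he
  have hB : ApproxOn J F.r h.toNullSolution.B a := hX.approxOn_B hJ hA
  obtain ⟨Y, hY, hY', hYpos, hYeq⟩ := NullSolution.approxOn_profile hJ h₀ hr₀ hA hM
  replace hYeq : ∀ q ∈ J, 4 * du D F.r q * dv D F.r q / F.Ωsq q
      = Y q * (F.r q / r₀) ^ (-(a ^ 2 + 1)) := fun q hq =>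
    (h.du_r_mul_dv_r (hJ hq)).symm.trans (hYeq q hq)
  -- Since `a² + 1 ≥ 1` and `r ≤ r₀`, this power is at most `r / r₀`. It represents the summand 1 in
  -- `1 + y`, which is thereby absorbed in the error.
  have hρ : ApproxOn J (fun q => F.r q * (1 + |Real.log (F.r q)|))
      (fun q => (F.r q / r₀) ^ (a ^ 2 + 1)) 0 := by
    have h1 : ApproxOn J F.r (fun q => (F.r q / r₀) ^ (a ^ 2 + 1)) 0 := by
      refine .of_le (K := r₀⁻¹) fun q hq => ?_
      have hq0 := hr q hq
      have h2 : F.r q / r₀ ≤ 1 := (div_le_one hr₀).2 (h₀ q hq)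
      rw [sub_zero, abs_of_pos (by positivity), abs_of_pos hq0]
      calc (F.r q / r₀) ^ (a ^ 2 + 1) ≤ (F.r q / r₀) ^ (1 : ℝ) :=
            Real.rpow_le_rpow_of_exponent_ge (by positivity) h2 (by nlinarith)
        _ = r₀⁻¹ * F.r q := by rw [Real.rpow_one]; ring
    exact h1.mono hre
  have hφ : ApproxOn J (fun q => F.r q * (1 + |Real.log (F.r q)|))
      (fun q => F.φ q - a * Real.log (r₀ / F.r q)) ξ := by
    have h1 : (fun q => (h.toNullSolution.A q - a) * (Real.log r₀ - Real.log (F.r q))) =O[𝓟 J]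
        fun q => F.r q * (1 + |Real.log (F.r q)|) := Asymptotics.IsBigO.mul hA (isBigO_log _)
    have h2 : ApproxOn J (fun q => F.r q * (1 + |Real.log (F.r q)|))
        (fun q => (h.toNullSolution.A q - a) * (Real.log r₀ - Real.log (F.r q))) 0 := by
      simpa [ApproxOn] using h1
    have h3 := hΞ.add h2
    rw [add_zero] at h3
    refine h3.congr fun q hq => ?_
    change _ = F.φ q - _ * Real.log (r₀ / F.r q) + _
    rw [Real.log_div hr₀.ne' (hr q hq).ne']
    ring
  have hPe := hP.mono hre
  have hQe := hQ.mono hre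
  have hAB := (hA.mono hre).mul he (hB.mono hre)
  have hYAB := hY.mul he hAB
  have hsum := hρ.add hY
  -- With `ρ = r / r₀`, each quantity is a convergent factor times a power of `ρ`. The powers are
  -- read off from `y = Y ρ^(-(a² + 1))`: `Ω²` equals `4 P Q Y⁻¹ ρ^(a² + 1) / r²`, the mass has size
  -- `r y`, the Kretschmann scalar `y² / r⁴`, and the gradient `y / r²`.
  have hW := (((hPe.mul he hQe).mul he hY').const_mul (4 / r₀ ^ 2)).eventually_le_rpow hr hr₀
    (a ^ 2 - 1)
  have hH := (hsum.const_mul r₀).eventually_le_rpow hr hr₀ (-a ^ 2)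
  have hK := ((((hsum.pow he 2).const_mul 2).add ((hsum.sub hYAB).pow he 2)).add
    (hYAB.pow he 2)).const_mul (4 / r₀ ^ 4)
  replace hK := hK.eventually_le_rpow hr hr₀ (-2 * a ^ 2 - 6)
  have hG := (hYAB.const_mul (-(1 / r₀ ^ 2))).eventually_le_rpow hr hr₀ (-a ^ 2 - 3)
  filter_upwards [hP.eventually_le fun q hq => (hr q hq).le,
    hQ.eventually_le fun q hq => (hr q hq).le,
    (hP.mul hr1 hA).eventually_le fun q hq => (hr q hq).le,
    (hQ.mul hr1 hB).eventually_le fun q hq => (hr q hq).le,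
    hφ.eventually_le fun q hq => mul_nonneg (hr q hq).le (by positivity), hW, hH, hK, hG]
    with B b1 b2 b3 b4 b5 b6 b7 b8 b9 q hq
  have hq0 := hr q hq
  have hw0 := h.Ωsq_pos q (hJ hq)
  have hYq := hYeq q hq
  have hYp := hYpos q
  have hρ0 : 0 < F.r q / r₀ := by positivity
  set ρ := F.r q / r₀ with hρdef
  have hrρ : F.r q = r₀ * ρ := by rw [hρdef]; field_simp
  have hinv : ∀ b : ℝ, (r₀ / F.r q) ^ b = ρ ^ (-b) := fun b => by
    rw [Real.rpow_neg hρ0.le, ← Real.inv_rpow hρ0.le, hρdef, inv_div]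
  have hone : ρ ^ (a ^ 2 + 1) * ρ ^ (-(a ^ 2 + 1)) = 1 := by
    rw [← Real.rpow_add hρ0, add_neg_cancel, Real.rpow_zero]
  have p1 : ρ ^ (-(a ^ 2)) = ρ ^ (-(a ^ 2 + 1)) * ρ := by
    rw [← Real.rpow_add_one hρ0.ne']; congr 1; ring
  have p2 : ρ ^ (-(a ^ 2 + 3)) = ρ ^ (-(a ^ 2 + 1)) / ρ ^ 2 := by
    rw [← Real.rpow_sub_natCast hρ0.ne']; congr 1; push_cast; ring
  have p3 : ρ ^ (-(2 * (a ^ 2 + 3))) = (ρ ^ (-(a ^ 2 + 1))) ^ 2 / ρ ^ 4 := by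
    rw [pow_two (ρ ^ _), ← Real.rpow_add hρ0, ← Real.rpow_sub_natCast hρ0.ne']
    congr 1; push_cast; ring
  have p4 : ρ ^ (a ^ 2 - 1) = ρ ^ (a ^ 2 + 1) / ρ ^ 2 := by
    rw [← Real.rpow_sub_natCast hρ0.ne']; congr 1; push_cast; ring
  refine ⟨b1 q hq, b2 q hq, ?_, ?_, ?_, ?_, ?_, fun θ hθ ϕ => ?_, fun θ hθ ϕ => ?_⟩
  · rw [← h.mul_A (hJ hq)]
    exact b3 q hq
  · rw [← h.mul_B (hJ hq)]
    exact b4 q hq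
  · rw [mul_assoc]
    exact b5 q hq
  · have h1 := b6 q hq
    rw [← hρdef] at h1
    rw [sub_add_cancel] at h1
    refine le_of_eq_of_le ?_ h1
    congr 1
    have h2 := h.du_r_mul_dv_r (hJ hq)
    rw [hYq, div_eq_iff (by positivity)] at h2
    have h3 : F.Ωsq q = 4 * h.toNullSolution.P q * h.toNullSolution.Q q * (Y q)⁻¹
        * ρ ^ (a ^ 2 + 1) / F.r q ^ 2 := by
      field_simp
      linear_combination (-ρ ^ (a ^ 2 + 1)) * h2 - Y q * F.r q ^ 2 * F.Ωsq q * hone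
    rw [h3, p4, hrρ]
    field_simp
  · have h1 := b7 q hq
    rw [← hρdef] at h1
    refine le_of_eq_of_le ?_ h1
    congr 1
    have h2 : 2 * hawkingMass D F q = F.r q * (1 + Y q * ρ ^ (-(a ^ 2 + 1))) := by
      rw [← hYq, hawkingMass]
      ring
    rw [hinv, h2, p1, hrρ]
    linear_combination (-r₀ * ρ) * hone
  · have h1 := b8 q hq
    rw [← hρdef] at h1
    rw [show -2 * a ^ 2 - 6 + 1 = -2 * a ^ 2 - 5 by ring,
      show -2 * a ^ 2 - 6 = -(2 * (a ^ 2 + 3)) by ring] at h1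
    refine le_of_eq_of_le ?_ h1
    congr 1
    have hx : ![q.1, q.2, θ, ϕ] ∈ spacetime D := ⟨hJ hq, hθ⟩
    rw [h.kretschmann_eq_of_mass hx (q := q) rfl hYq, hinv, p3, hrρ]
    set Z := ρ ^ (-(a ^ 2 + 1))
    have e1 : 1 + Y q * Z = (ρ ^ (a ^ 2 + 1) + Y q) * Z := by linear_combination -hone
    rw [e1]
    field_simp
    ring
  · have h1 := b9 q hq
    rw [← hρdef] at h1
    rw [show -a ^ 2 - 3 + 1 = -a ^ 2 - 2 by ring,
      show -a ^ 2 - 3 = -(a ^ 2 + 3) by ring] at h1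
    refine le_of_eq_of_le ?_ h1
    congr 1
    have hx : ![q.1, q.2, θ, ϕ] ∈ spacetime D := ⟨hJ hq, hθ⟩
    rw [h.gradSq_eq_of_mass hx (q := q) rfl hYq, hinv, p2, hrρ]
    field_simp
    ring

end IsFutureDevelopment


/-! ### Assembly of the theorem -/

theorem HasModulus.congr {ω : ℝ → ℝ} {D : Set (ℝ × ℝ)} {f g : ℝ × ℝ → ℝ}
    (hf : HasModulus ω D f) (hfg : ∀ q ∈ D, g q = f q) : HasModulus ω D g := by
  obtain ⟨K, h1, h2, h3⟩ := hf
  refine ⟨K, fun p hp => hfg p hp ▸ h1 p hp, fun u v v' hv hD => ?_, fun u u' v hu hD => ?_⟩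
  · rw [hfg _ (hD v' (right_mem_Icc.2 hv.le)), hfg _ (hD v (left_mem_Icc.2 hv.le))]
    exact h2 u v v' hv hD
  · rw [hfg _ (hD u' (right_mem_Icc.2 hu.le)), hfg _ (hD u (left_mem_Icc.2 hu.le))]
    exact h3 u u' v hu hD

theorem HasModulus.const_mul {ω : ℝ → ℝ} {D : Set (ℝ × ℝ)} {f : ℝ × ℝ → ℝ}
    (hf : HasModulus ω D f) (b : ℝ) : HasModulus ω D fun q => b * f q := by
  obtain ⟨K, h1, h2, h3⟩ := hf
  refine ⟨|b| * K, fun p hp => ?_, fun u v v' hv hD => ?_, fun u u' v hu hD => ?_⟩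
  · rw [abs_mul]
    exact mul_le_mul_of_nonneg_left (h1 p hp) (abs_nonneg b)
  · rw [← mul_sub, abs_mul, mul_assoc]
    exact mul_le_mul_of_nonneg_left (h2 u v v' hv hD) (abs_nonneg b)
  · rw [← mul_sub, abs_mul, mul_assoc]
    exact mul_le_mul_of_nonneg_left (h3 u u' v hu hD) (abs_nonneg b)

theorem NullSolution.r_le_corner (X : NullSolution) {q : ℝ × ℝ} (hq : q ∈ X.D) :
    X.r q ≤ X.r (X.u₀, X.v₀) := by
  have h1 := X.dom.fst_le _ hq
  have h2 := X.dom.snd_le _ hq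
  have h3 : (q.1, X.v₀) ∈ X.D := X.dom.past _ hq _ h1 le_rfl le_rfl h2
  exact (X.r_anti_v hq le_rfl h2).trans
    (NullSolution.r_anti_v (X := X.swap) (u := X.v₀) (v := X.u₀) (v' := q.1) h3 le_rfl h1)

theorem IsFutureDevelopment.isC1Holder_r_sq {u₀ u₁ v₀ v₁ : ℝ} {D : Set (ℝ × ℝ)} {F : Fields}
    (h : IsFutureDevelopment u₀ u₁ v₀ v₁ D F) {c C : ℝ} (hX : h.toNullSolution.Bounds c C) :
    IsC1Holder (1 / 2) D fun q => F.r q ^ 2 := by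
  have hr : ContDiffOn ℝ 1 F.r D := h.contDiffOn_r.of_le one_le_two
  have hd := hr.differentiableOn one_ne_zero
  refine ⟨hr.pow 2, ?_, ?_⟩
  · refine ((hX.controlled_P.isHolder hX).const_mul (-2)).congr fun q hq => ?_
    simp only [pow_two]
    rw [du_mul (h.uniqueDiffOn q hq) (hd q hq) (hd q hq)]
    change _ = -2 * (-F.r q * du D F.r q)
    ring
  · refine ((hX.controlled_Q.isHolder hX).const_mul (-2)).congr fun q hq => ?_
    simp only [pow_two]
    rw [dv_mul (h.uniqueDiffOn q hq) (hd q hq) (hd q hq)]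
    change _ = -2 * (-F.r q * dv D F.r q)
    ring

theorem extendFrom_eq_of_mem {D : Set (ℝ × ℝ)} {f : ℝ × ℝ → ℝ} (hf : UniformContinuousOn f D)
    {q : ℝ × ℝ} (hq : q ∈ D) : extendFrom D f q = f q :=
  extendFrom_eq (subset_closure hq) (hf.continuousOn q hq)

end ESFSS

theorem theorem3p1 (u₀ u₁ v₀ v₁ : ℝ) (D : Set (ℝ × ℝ)) (F : ESFSS.Fields)
    (uS : ℝ) (vStar : ℝ → ℝ)
    (hmax : ESFSS.IsMaximalFutureDevelopment u₀ u₁ v₀ v₁ D F)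
    (hsing : ESFSS.IsStronglySingular u₀ u₁ v₀ v₁ D F uS vStar)
    (r₀ : ℝ) (hr₀ : r₀ = F.r (u₀, v₀))
    (S : Set (ℝ × ℝ)) (hS : S = ESFSS.singularBoundary uS u₁ vStar) :
    -- (I) asymptotics for `r`
    ESFSS.IsC1Holder (1 / 2) D (fun q => F.r q ^ 2) ∧
    (∃ R₀ R₁ : ℝ, 0 < R₀ ∧ 0 < R₁ ∧ ∀ q ∈ D,
      (R₀ ≤ -F.r q * ESFSS.du D F.r q ∧ -F.r q * ESFSS.du D F.r q ≤ R₁) ∧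
      (R₀ ≤ -F.r q * ESFSS.dv D F.r q ∧ -F.r q * ESFSS.dv D F.r q ≤ R₁)) ∧
    (ContDiffOn ℝ 1 vStar (Icc uS u₁) ∧
      ∃ K : NNReal, HolderOnWith K (1 / 2) (derivWithin vStar (Icc uS u₁)) (Icc uS u₁)) ∧
    ∃ Cu Cv Ψ Ξ 𝔐 : ℝ × ℝ → ℝ,
      (ContinuousOn Cu (D ∪ S) ∧ ∀ q ∈ D, Cu q = -F.r q * ESFSS.du D F.r q) ∧
      (ContinuousOn Cv (D ∪ S) ∧ ∀ q ∈ D, Cv q = -F.r q * ESFSS.dv D F.r q) ∧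
      -- (II) asymptotics for `φ`
      (ESFSS.IsHolder (1 / 2) D Ψ ∧ ContinuousOn Ψ (D ∪ S)) ∧
      (ESFSS.IsLogHolder (1 / 2) D Ξ ∧ ContinuousOn Ξ (D ∪ S)) ∧
      (∀ q ∈ D, F.φ q = Ψ q * Real.log (r₀ / F.r q) + Ξ q) ∧
      -- (III) asymptotics for `Ω²`
      (ESFSS.IsLogHolder (1 / 2) D 𝔐 ∧ ContinuousOn 𝔐 (D ∪ S) ∧ ∀ q ∈ D ∪ S, 0 < 𝔐 q) ∧
      (∀ q ∈ D, 4 * (F.Ωsq q)⁻¹ * ESFSS.du D F.r q * ESFSS.dv D F.r q =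
        𝔐 q * (F.r q / r₀) ^ (-(Ψ q ^ 2 + 1))) ∧
      ∀ p ∈ S, ∃ B : ℝ, 0 < B ∧ ∀ q ∈ ESFSS.causalPast D p,
        -- (IV) estimates localized to the causal past of `p`
        |-F.r q * ESFSS.du D F.r q - Cu p| ≤ B * F.r q ∧
        |-F.r q * ESFSS.dv D F.r q - Cv p| ≤ B * F.r q ∧
        |F.r q ^ 2 * ESFSS.du D F.φ q - Cu p * Ψ p| ≤ B * F.r q ∧
        |F.r q ^ 2 * ESFSS.dv D F.φ q - Cv p * Ψ p| ≤ B * F.r q ∧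
        |F.φ q - Ψ p * Real.log (r₀ / F.r q) - Ξ p| ≤
          B * F.r q * (1 + |Real.log (F.r q)|) ∧
        |F.Ωsq q - 4 * Cu p * Cv p / r₀ ^ 2 * (𝔐 p)⁻¹ * (F.r q / r₀) ^ (Ψ p ^ 2 - 1)| ≤
          B * F.r q ^ (Ψ p ^ 2) * (1 + |Real.log (F.r q)|) ∧
        -- (V) precise blow-up estimates
        |2 * ESFSS.hawkingMass D F q - 𝔐 p * r₀ * (r₀ / F.r q) ^ (Ψ p ^ 2)| ≤
          B * F.r q ^ (-Ψ p ^ 2 + 1) * (1 + |Real.log (F.r q)|) ∧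
        (∀ θ ∈ Ioo 0 Real.pi, ∀ ϕ : ℝ,
          |ESFSS.kretschmann (ESFSS.spacetime D) (ESFSS.metric F) ![q.1, q.2, θ, ϕ]
              - 𝔐 p ^ 2 * (r₀ / F.r q) ^ (2 * (Ψ p ^ 2 + 3))
                * (4 * (3 - 2 * Ψ p ^ 2 + 2 * Ψ p ^ 4) / r₀ ^ 4)| ≤
            B * F.r q ^ (-2 * Ψ p ^ 2 - 5) * (1 + |Real.log (F.r q)|)) ∧
        (∀ θ ∈ Ioo 0 Real.pi, ∀ ϕ : ℝ,
          |ESFSS.gradSq (ESFSS.spacetime D) (ESFSS.metric F) (fun x => F.φ (x 0, x 1))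
                ![q.1, q.2, θ, ϕ]
              + 𝔐 p * Ψ p ^ 2 / r₀ ^ 2 * (r₀ / F.r q) ^ (Ψ p ^ 2 + 3)| ≤
            B * F.r q ^ (-Ψ p ^ 2 - 2) * (1 + |Real.log (F.r q)|)) := by
  obtain ⟨h, -⟩ := hmax
  subst hS
  let X := h.toNullSolution
  obtain ⟨c, C, hX⟩ : ∃ c C, X.Bounds c C := X.exists_bounds
  have h₀ : ∀ q ∈ D, F.r q ≤ r₀ := fun q hq => hr₀ ▸ X.r_le_corner hq
  have hin : ∀ u ∈ Icc u₀ u₁, (u, v₀) ∈ D := fun u hu => h.ingoing_subset ⟨hu, rfl⟩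
  have hr₀pos : 0 < r₀ := by
    rw [hr₀]
    exact h.r_pos _ (hin u₀ (left_mem_Icc.2 h.u_lt.le))
  have hsub : D ∪ ESFSS.singularBoundary uS u₁ vStar ⊆ closure D :=
    union_subset subset_closure (hsing.subset_closure hin)
  -- The gauge interval has to contain the range of `r`, the bound `√(C³/c)` for slice increments,
  -- and `r₀` for the logarithms.
  set R := C + √(C ^ 3 / c) + r₀ with hR
  have hsq := Real.sqrt_nonneg (C ^ 3 / c)
  have hC := hX.C_pos
  have hR1 : C ≤ R := by linarith
  have hR2 : √(C ^ 3 / c) ≤ R := by linarith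
  have hR3 : r₀ ≤ R := by linarith
  have hR4 : C + √(C ^ 3 / c) ≤ R := by linarith
  have HP := hX.controlled_P
  have HQ := hX.controlled_Q
  have HA := hX.controlled_A
  have HΞ := hX.controlled_scalarRemainder h₀ hr₀pos hR3
  have HM := hX.controlled_logMass h₀ hR3
  have uP : UniformContinuousOn X.P D :=
    HP.uniformContinuousOn hX (ESFSS.Gauge.id R) hR2
  have uQ : UniformContinuousOn X.Q D := HQ.uniformContinuousOn hX (ESFSS.Gauge.id R) hR2
  have uA : UniformContinuousOn X.A D := HA.uniformContinuousOn hX (ESFSS.Gauge.id R) hR2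
  have uΞ : UniformContinuousOn (X.scalarRemainder r₀) D :=
    HΞ.uniformContinuousOn hX ESFSS.Gauge.log hR2
  have uM : UniformContinuousOn (X.logMass r₀) D := HM.uniformContinuousOn hX ESFSS.Gauge.log hR2
  have eM : ∀ q ∈ D, Real.exp (extendFrom D (X.logMass r₀) q) = Real.exp (X.logMass r₀ q) :=
    fun q hq => congrArg Real.exp (ESFSS.extendFrom_eq_of_mem uM hq)
  refine ⟨h.isC1Holder_r_sq hX, ⟨c, C, hX.c_pos, hC, fun q hq =>
    ⟨⟨hX.le_P q hq, hX.P_le q hq⟩, ⟨hX.le_Q q hq, hX.Q_le q hq⟩⟩⟩, ?_,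
    extendFrom D X.P, extendFrom D X.Q, extendFrom D X.A, extendFrom D (X.scalarRemainder r₀),
    -- Extending the logarithm and exponentiating afterwards makes `𝔐` positive on the singular
    -- boundary.
    fun q => Real.exp (extendFrom D (X.logMass r₀) q),
    ⟨(ESFSS.UniformContinuousOn.continuousOn_extendFrom uP).mono hsub,
      fun q hq => ESFSS.extendFrom_eq_of_mem uP hq⟩,
    ⟨(ESFSS.UniformContinuousOn.continuousOn_extendFrom uQ).mono hsub,
      fun q hq => ESFSS.extendFrom_eq_of_mem uQ hq⟩,
    ⟨(HA.isHolder hX).congr fun q hq => ESFSS.extendFrom_eq_of_mem uA hq,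
      (ESFSS.UniformContinuousOn.continuousOn_extendFrom uA).mono hsub⟩,
    ⟨(HΞ.isLogHolder hX hR4).congr fun q hq => ESFSS.extendFrom_eq_of_mem uΞ hq,
      (ESFSS.UniformContinuousOn.continuousOn_extendFrom uΞ).mono hsub⟩, fun q hq => ?_,
    ⟨((HM.exp hX ESFSS.Gauge.log hR1).isLogHolder hX hR4).congr eM,
      ((ESFSS.UniformContinuousOn.continuousOn_extendFrom uM).mono hsub).rexp,
      fun q _ => Real.exp_pos _⟩, fun q hq => ?_, fun p hp => ?_⟩
  · obtain ⟨M, hM, hexp⟩ := ESFSS.IsStronglySingular.exists_vStar_expansion hX hsing rfl hin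
      (g := fun u => extendFrom D X.P (u, vStar u) / extendFrom D X.Q (u, vStar u)) fun _ => rfl
    exact ESFSS.contDiffOn_of_expansion hsing.uS_mem.2 hM hexp
  · rw [ESFSS.extendFrom_eq_of_mem uA hq, ESFSS.extendFrom_eq_of_mem uΞ hq]
    change _ = _ + (F.φ q - X.A q * Real.log (r₀ / F.r q))
    ring
  · simp only [eM q hq]
    rw [ESFSS.extendFrom_eq_of_mem uA hq]
    refine Eq.trans ?_ ((h.du_r_mul_dv_r hq).symm.trans (X.exp_logMass hr₀pos hq))
    ring
  · have hJ : ESFSS.causalPast D p ⊆ D := fun q hq => hq.1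
    have hcl : ∀ q ∈ ESFSS.causalPast D p, p ∈ closure (D ∩ Ici q) := fun q hq =>
      hsing.mem_closure hp hq.1 hq.2.1 hq.2.2
    have key := h.eventually_estimates hX hJ (fun q hq => h₀ q (hJ hq)) hr₀pos
      (HP.approxOn hX hR1 hR2 hJ hcl) (HQ.approxOn hX hR1 hR2 hJ hcl)
      (HA.approxOn hX hR1 hR2 hJ hcl) (HΞ.approxOn_log hX hR1 hR2 hJ hcl)
      (HM.approxOn_log hX hR1 hR2 hJ hcl)
    obtain ⟨B, hB, hB0⟩ := (key.and (eventually_gt_atTop 0)).exists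
    exact ⟨B, hB0, hB⟩
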